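/- **Language.** Fix four pairwise disjoint infinite sets of *clusters*: $\sqcup$-, $\sqcap$-, $\exists$- and $\forall$-clusters (countable sets, so that clusters have names over a finite alphabet). There are infinitely many predicate letters of every arity. A *term* is a variable or a constant; the constants are the natural numbers. An *atom* is $p(t_1,\dots,t_n)$, with $p$ an $n$-ary predicate letter. *Cirquents* are built as follows: $\top$, $\bot$, $A$ and $\neg A$ ($A$ an atom) are cirquents (the *literals*); if $A,B$ are cirquents, so are $A\wedge B$, $A\vee B$, $A\sqcap^{c}B$ ($c$ a $\sqcap$-cluster), $A\sqcup^{c}B$ ($c$ a $\sqcup$-cluster), $\forall^{c}x\,A$ ($c$ a $\forall$-cluster) and $\exists^{c}x\,A$ ($c$ an $\exists$-cluster), where $\forall,\exists$ are the choice quantifiers (written $\sqcap x,\sqcup x$ in the literature). Cirquents are identified up to renaming of bound variables, and substitution is capture-avoiding. A cirquent is *closed* if it has no free variables. In writing, $\sqcap,\sqcup$ and the quantifiers bind more strongly than $\wedge,\vee$. **Games.** A *move* is a finite string over a fixed finite alphabet. A *run* is a finite or infinite sequence of moves, each labeled by its author, the machine or the environment. A run is *legal* if every move in it has the form $c.a$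 (the name of a cluster $c$, a dot, a decimal numeral $a$), where $a\in\{0,1\}$ if $c$ is a $\sqcap$- or $\sqcup$-cluster and $a\in\mathbb N$ if $c$ is a $\forall$- or $\exists$-cluster; moves in $\sqcap$- and $\forall$-clusters are made by the environment, and moves in $\sqcup$- and $\exists$-clusters by the machine; and for each cluster $c$ there is at most one move of the form $c.a$. Given a legal run $\Gamma$, a cluster $c$ is *resolved* if $\Gamma$ contains a move $c.a$; then the *resolvent* of $A_0\sqcap^{c}A_1$ or $A_0\sqcup^{c}A_1$ is $A_a$, and that of $\forall^{c}x\,A(x)$ or $\exists^{c}x\,A(x)$ is $A(a)$. An *interpretation* $^*$ assigns to each $n$-ary predicate letter an $n$-ary relation on $\mathbb N$. A legal run $\Gamma$ is a *won* run of a closed cirquent $C$ under $^*$ iff one of the following holds: $C$ is a literal that is true under $^*$; $C=A\wedge B$ and $\Gamma$ is a won run of both $A$ and $B$; $C=A\vee B$ and $\Gamma$ is a won run of at least one of $A$, $B$; $C$ is rooted in a choice operator with resolved cluster and $\Gamma$ is a won run of its resolvent; $C$ has the form $A\sqcap^{c}B$ or $\forall^{c}x\,A$ with $c$ unresolved. An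 illegal run is won by the machine iff its first illegal move (the last move of its shortest illegal initial segment) is made by the environment. **Machines and validity.** A *hard-play machine* (HPM) is a deterministic Turing machine with finitely many states, finitely many read/write work tapes over a finite alphabet, a read-only run tape that at every moment displays the sequence of labeled moves made so far by both players, and a write-only buffer; whenever it enters one of its move states, it makes the move that is written in the buffer, and the buffer is emptied. In each step the environment may make any finite number of arbitrary moves. An HPM *wins* $C$ under $^*$ if, whatever the environment does, the run that arises is won by the machine. A closed cirquent $C$ is *(logically) valid* if there is one HPM that wins $C$ under every interpretation $^*$. **The calculus $\mathbf{CL17}$.** The only axiom is $\top$. The rules, written premises $\leadsto$ conclusion, are the following. Here $X[\;]$ and $Y[\;]$ are arbitrary cirquents with one place left open, $X[A]$ being the result of putting $A$ there; free variables of $A$ may become bound in $X[A]$, except as said under Chall-cleansing. - Commutativity: $X[B\vee A]\leadsto X[A\vee B]$; $\;X[B\wedge A]\leadsto X[A\wedge B]$. - Associativity: $X[A\vee(B\vee C)]\leadsto X[(A\vee B)\vee C]$; $\;X[A\wedge(B\wedge C)]\leadsto X[(A\wedge B)\wedge C]$. - Identity: $X[A]\leadsto X[A\vee\bot]$; $\;X[A]\leadsto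 X[A\wedge\top]$. - Domination: $X[\top]\leadsto X[A\vee\top]$; $\;X[\bot]\leadsto X[A\wedge\bot]$. - Left (right) chor-choosing: $E'\leadsto E$, where $c$ is a $\sqcup$-cluster and $E'$ results from $E$ by replacing every subcirquent of the form $A\sqcup^{c}B$, nested ones included, by $A$ (respectively by $B$). - Chexists-choosing: $E'\leadsto E$, where $c$ is an $\exists$-cluster, $a$ is a constant and $E'$ results from $E$ by replacing every subcirquent of the form $\exists^{c}x\,A(x)$, nested ones included, by $A(a)$. - Chand-cleansing: $X[Y[A]\sqcap^{c}C]\leadsto X[Y[A\sqcap^{c}B]\sqcap^{c}C]$ (left); $\;X[C\sqcap^{c}Y[B]]\leadsto X[C\sqcap^{c}Y[A\sqcap^{c}B]]$ (right). - Chall-cleansing: $X[\forall^{c}x\,Y[A(x)]]\leadsto X[\forall^{c}x\,Y[\forall^{c}y\,A(y)]]$, where $A(x)$ is the result of substituting $x$ for $y$ in $A(y)$, and the $x$ so substituted is bound by the displayed quantifier $\forall^{c}x$ (bound variables being renamed where necessary). - Distribution: $X[(A\vee C)\wedge(B\vee C)]\leadsto X[(A\wedge B)\vee C]$; $\;X[(A\vee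 C)\sqcap^{c}(B\vee C)]\leadsto X[(A\sqcap^{c}B)\vee C]$; $\;X[\forall^{c}x(A\vee B)]\leadsto X[(\forall^{c}x\,A)\vee B]$, where $x$ is not free in $B$. - Trivialization: $X[\top]\leadsto X[\neg A\vee A]$, where $A$ is an atom. - Chandchotomy: $X\bigl[\bigl((A\wedge C\sqcap^{b}D)\sqcap^{a}(B\wedge C\sqcap^{b}D)\bigr)\sqcap^{c}\bigl((A\sqcap^{a}B\wedge C)\sqcap^{b}(A\sqcap^{a}B\wedge D)\bigr)\bigr]\leadsto X[A\sqcap^{a}B\wedge C\sqcap^{b}D]$, where $c$ does not occur in the conclusion. - Challchotomy: $X\bigl[\forall^{a}x(A\wedge\forall^{b}y\,B)\sqcap^{c}\forall^{b}y(\forall^{a}x\,A\wedge B)\bigr]\leadsto X[\forall^{a}x\,A\wedge\forall^{b}y\,B]$, where $c$ does not occur in the conclusion, $x$ is not free in $\forall^{b}y\,B$ and $y$ is not free in $\forall^{a}x\,A$. - Chandallchotomy: $X\bigl[\bigl((A\wedge\forall^{b}x\,C)\sqcap^{a}(B\wedge\forall^{b}x\,C)\bigr)\sqcap^{c}\forall^{b}x(A\sqcap^{a}B\wedge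 C)\bigr]\leadsto X[A\sqcap^{a}B\wedge\forall^{b}x\,C]$, where $c$ does not occur in the conclusion and $x$ is not free in $A\sqcap^{a}B$. - Chand-splitting: $A,\;B\leadsto A\sqcap^{c}B$, where $c$ occurs in neither $A$ nor $B$. - Chall-splitting: $A(a)\leadsto\forall^{c}x\,A(x)$, where neither the cluster $c$ nor the constant $a$ occurs in $A(x)$. **Theorem.** For every closed cirquent $E$: $E$ is logically valid if and only if $\mathbf{CL17}\vdash E$. -/

import Mathlib

namespace CL17

/-! ## Syntax

Cirquents are represented up to renaming of bound variables: a variable is a de Bruijn index, and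
`Cirquent n` is the type of cirquents whose free variables are among `n` given ones
(`0` is the most recently bound one). Closed cirquents are the elements of `Cirquent 0`. -/

/-- The four sorts of clusters: `⊔`, `⊓`, choice `∃` and choice `∀`. -/
inductive ClusterKind : Type
  | chor
  | chand
  | chexists
  | chall
  deriving DecidableEq

/-- A cluster: a sort and an index. Thus there are four pairwise disjoint (countably) infinite
sets of clusters. -/
structure Cluster : Type where
  kind : ClusterKind
  index : ℕ
  deriving DecidableEq

/-- A predicate letter, with its arity. There are infinitely many of each arity. -/
structure PredLetter : Type where
  name : ℕ
  arity : ℕ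
  deriving DecidableEq

/-- A term is a variable or a constant (a natural number). -/
inductive Term (n : ℕ) : Type
  | var (i : Fin n)
  | const (a : ℕ)
  deriving DecidableEq

/-- Cirquents with free variables among `n` given ones. The numbers `c` are the indices of
clusters, the sort of the cluster being that of the operator. -/
inductive Cirquent : ℕ → Type
  /-- the logical literal `⊤` -/
  | top {n : ℕ} : Cirquent n
  /-- the logical literal `⊥` -/
  | bot {n : ℕ} : Cirquent n
  /-- the literal `p(t₁,…,tₖ)` -/
  | atom {n : ℕ} (p : PredLetter) (t : Fin p.arity → Term n) : Cirquent n
  /-- the literal `¬p(t₁,…,tₖ)` -/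
  | natom {n : ℕ} (p : PredLetter) (t : Fin p.arity → Term n) : Cirquent n
  /-- `A ∧ B` -/
  | pand {n : ℕ} (A B : Cirquent n) : Cirquent n
  /-- `A ∨ B` -/
  | por {n : ℕ} (A B : Cirquent n) : Cirquent n
  /-- `A ⊓ᶜ B` -/
  | chand {n : ℕ} (c : ℕ) (A B : Cirquent n) : Cirquent n
  /-- `A ⊔ᶜ B` -/
  | chor {n : ℕ} (c : ℕ) (A B : Cirquent n) : Cirquent n
  /-- choice universal quantification with cluster `c`; it binds variable `0` of `A` -/
  | chall {n : ℕ} (c : ℕ) (A : Cirquent (n + 1)) : Cirquent n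
  /-- choice existential quantification with cluster `c`; it binds variable `0` of `A` -/
  | chexists {n : ℕ} (c : ℕ) (A : Cirquent (n + 1)) : Cirquent n

namespace Term

/-- Simultaneous substitution of terms for variables. -/
def subst {n m : ℕ} (s : Fin n → Term m) : Term n → Term m
  | var i => s i
  | const a => const a

/-- The set of constants occurring in a term. -/
def constants {n : ℕ} : Term n → Finset ℕ
  | var _ => ∅
  | const a => {a}

/-- The number denoted by a closed term. -/
def value : Term 0 → ℕ
  | var i => i.elim0
  | const a => a

/-- The substitution to be used below a binder: the bound variable stays, the others are
treated by `s`. -/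
def liftSubst {n m : ℕ} (s : Fin n → Term m) : Fin (n + 1) → Term (m + 1) :=
  Fin.cases (var 0) (fun i => (s i).subst (fun j => var j.succ))

end Term

namespace Cirquent

/-- Simultaneous (capture-avoiding) substitution of terms for the free variables. -/
def subst : {n m : ℕ} → (Fin n → Term m) → Cirquent n → Cirquent m
  | _, _, _, top => top
  | _, _, _, bot => bot
  | _, _, s, atom p t => atom p (fun i => (t i).subst s)
  | _, _, s, natom p t => natom p (fun i => (t i).subst s)
  | _, _, s, pand A B => pand (A.subst s) (B.subst s)
  | _, _, s, por A B => por (A.subst s) (B.subst s)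
  | _, _, s, chand c A B => chand c (A.subst s) (B.subst s)
  | _, _, s, chor c A B => chor c (A.subst s) (B.subst s)
  | _, _, s, chall c A => chall c (A.subst (Term.liftSubst s))
  | _, _, s, chexists c A => chexists c (A.subst (Term.liftSubst s))

/-- `A(t)`, where `A = A(x)` and `x` is variable `0`. -/
def inst {n : ℕ} (A : Cirquent (n + 1)) (t : Term n) : Cirquent n :=
  A.subst (Fin.cases t Term.var)

/-- `A` itself, viewed as a cirquent below one more binder, whose variable is not free in `A`. -/
def shift {n : ℕ} (A : Cirquent n) : Cirquent (n + 1) :=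
  A.subst (fun i => Term.var i.succ)

/-- The set of clusters occurring in a cirquent. -/
def clusters : {n : ℕ} → Cirquent n → Finset Cluster
  | _, top => ∅
  | _, bot => ∅
  | _, atom _ _ => ∅
  | _, natom _ _ => ∅
  | _, pand A B => A.clusters ∪ B.clusters
  | _, por A B => A.clusters ∪ B.clusters
  | _, chand c A B => insert ⟨.chand, c⟩ (A.clusters ∪ B.clusters)
  | _, chor c A B => insert ⟨.chor, c⟩ (A.clusters ∪ B.clusters)
  | _, chall c A => insert ⟨.chall, c⟩ A.clusters
  | _, chexists c A => insert ⟨.chexists, c⟩ A.clusters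

/-- The set of constants occurring in a cirquent. -/
def constants : {n : ℕ} → Cirquent n → Finset ℕ
  | _, top => ∅
  | _, bot => ∅
  | _, atom _ t => Finset.univ.biUnion fun i => (t i).constants
  | _, natom _ t => Finset.univ.biUnion fun i => (t i).constants
  | _, pand A B => A.constants ∪ B.constants
  | _, por A B => A.constants ∪ B.constants
  | _, chand _ A B => A.constants ∪ B.constants
  | _, chor _ A B => A.constants ∪ B.constants
  | _, chall _ A => A.constants
  | _, chexists _ A => A.constants

/-- The result of replacing every subcirquent `A ⊔ᶜ B` (nested ones included) by `A`. -/
def chooseLeft (c : ℕ) : {n : ℕ} → Cirquent n → Cirquent n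
  | _, top => top
  | _, bot => bot
  | _, atom p t => atom p t
  | _, natom p t => natom p t
  | _, pand A B => pand (A.chooseLeft c) (B.chooseLeft c)
  | _, por A B => por (A.chooseLeft c) (B.chooseLeft c)
  | _, chand d A B => chand d (A.chooseLeft c) (B.chooseLeft c)
  | _, chor d A B =>
      if d = c then A.chooseLeft c else chor d (A.chooseLeft c) (B.chooseLeft c)
  | _, chall d A => chall d (A.chooseLeft c)
  | _, chexists d A => chexists d (A.chooseLeft c)

/-- The result of replacing every subcirquent `A ⊔ᶜ B` (nested ones included) by `B`. -/
def chooseRight (c : ℕ) : {n : ℕ} → Cirquent n → Cirquent n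
  | _, top => top
  | _, bot => bot
  | _, atom p t => atom p t
  | _, natom p t => natom p t
  | _, pand A B => pand (A.chooseRight c) (B.chooseRight c)
  | _, por A B => por (A.chooseRight c) (B.chooseRight c)
  | _, chand d A B => chand d (A.chooseRight c) (B.chooseRight c)
  | _, chor d A B =>
      if d = c then B.chooseRight c else chor d (A.chooseRight c) (B.chooseRight c)
  | _, chall d A => chall d (A.chooseRight c)
  | _, chexists d A => chexists d (A.chooseRight c)

/-- The result of replacing every choice existential subcirquent `∃ᶜx A(x)` (nested ones included)
by `A(a)`, where `a` is a constant. -/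
def chooseConst (c a : ℕ) : {n : ℕ} → Cirquent n → Cirquent n
  | _, top => top
  | _, bot => bot
  | _, atom p t => atom p t
  | _, natom p t => natom p t
  | _, pand A B => pand (A.chooseConst c a) (B.chooseConst c a)
  | _, por A B => por (A.chooseConst c a) (B.chooseConst c a)
  | _, chand d A B => chand d (A.chooseConst c a) (B.chooseConst c a)
  | _, chor d A B => chor d (A.chooseConst c a) (B.chooseConst c a)
  | _, chall d A => chall d (A.chooseConst c a)
  | _, chexists d A =>
      if d = c then (A.chooseConst c a).inst (.const a) else chexists d (A.chooseConst c a)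

end Cirquent

/-- `Ctx m n` is the type of contexts `X[ ]`: cirquents with free variables among `n` given ones,
in which the place of exactly one occurrence of a subcirquent is left open; the subcirquents that
fit there have their free variables among `m` (the `n` given ones, and those bound above the open
place). -/
inductive Ctx (m : ℕ) : ℕ → Type
  | hole : Ctx m m
  | pandL {n : ℕ} (X : Ctx m n) (B : Cirquent n) : Ctx m n
  | pandR {n : ℕ} (A : Cirquent n) (X : Ctx m n) : Ctx m n
  | porL {n : ℕ} (X : Ctx m n) (B : Cirquent n) : Ctx m n
  | porR {n : ℕ} (A : Cirquent n) (X : Ctx m n) : Ctx m n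
  | chandL {n : ℕ} (c : ℕ) (X : Ctx m n) (B : Cirquent n) : Ctx m n
  | chandR {n : ℕ} (c : ℕ) (A : Cirquent n) (X : Ctx m n) : Ctx m n
  | chorL {n : ℕ} (c : ℕ) (X : Ctx m n) (B : Cirquent n) : Ctx m n
  | chorR {n : ℕ} (c : ℕ) (A : Cirquent n) (X : Ctx m n) : Ctx m n
  | chall {n : ℕ} (c : ℕ) (X : Ctx m (n + 1)) : Ctx m n
  | chexists {n : ℕ} (c : ℕ) (X : Ctx m (n + 1)) : Ctx m n

namespace Ctx

/-- `X[A]` -/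
def fill {m : ℕ} : {n : ℕ} → Ctx m n → Cirquent m → Cirquent n
  | _, hole, C => C
  | _, pandL X B, C => .pand (X.fill C) B
  | _, pandR A X, C => .pand A (X.fill C)
  | _, porL X B, C => .por (X.fill C) B
  | _, porR A X, C => .por A (X.fill C)
  | _, chandL c X B, C => .chand c (X.fill C) B
  | _, chandR c A X, C => .chand c A (X.fill C)
  | _, chorL c X B, C => .chor c (X.fill C) B
  | _, chorR c A X, C => .chor c A (X.fill C)
  | _, chall c X, C => .chall c (X.fill C)
  | _, chexists c X, C => .chexists c (X.fill C)

/-- The index that a free variable of the whole context has at the open place. -/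
def holeVar {m : ℕ} : {n : ℕ} → Ctx m n → Fin n → Fin m
  | _, hole, i => i
  | _, pandL X _, i => X.holeVar i
  | _, pandR _ X, i => X.holeVar i
  | _, porL X _, i => X.holeVar i
  | _, porR _ X, i => X.holeVar i
  | _, chandL _ X _, i => X.holeVar i
  | _, chandR _ _ X, i => X.holeVar i
  | _, chorL _ X _, i => X.holeVar i
  | _, chorR _ _ X, i => X.holeVar i
  | _, chall _ X, i => X.holeVar i.succ
  | _, chexists _ X, i => X.holeVar i.succ

end Ctx

/-! ## The calculus -/

open Cirquent in
/-- Provability of closed cirquents in **CL17**. (All premises of a rule with a closed conclusion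
are closed.) -/
inductive Provable : Cirquent 0 → Prop
  | axiom_top : Provable top
  | por_commutativity {m : ℕ} (X : Ctx m 0) (A B : Cirquent m) :
      Provable (X.fill (por B A)) → Provable (X.fill (por A B))
  | pand_commutativity {m : ℕ} (X : Ctx m 0) (A B : Cirquent m) :
      Provable (X.fill (pand B A)) → Provable (X.fill (pand A B))
  | por_associativity {m : ℕ} (X : Ctx m 0) (A B C : Cirquent m) :
      Provable (X.fill (por A (por B C))) → Provable (X.fill (por (por A B) C))
  | pand_associativity {m : ℕ} (X : Ctx m 0) (A B C : Cirquent m) :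
      Provable (X.fill (pand A (pand B C))) → Provable (X.fill (pand (pand A B) C))
  | por_identity {m : ℕ} (X : Ctx m 0) (A : Cirquent m) :
      Provable (X.fill A) → Provable (X.fill (por A bot))
  | pand_identity {m : ℕ} (X : Ctx m 0) (A : Cirquent m) :
      Provable (X.fill A) → Provable (X.fill (pand A top))
  | por_domination {m : ℕ} (X : Ctx m 0) (A : Cirquent m) :
      Provable (X.fill top) → Provable (X.fill (por A top))
  | pand_domination {m : ℕ} (X : Ctx m 0) (A : Cirquent m) :
      Provable (X.fill bot) → Provable (X.fill (pand A bot))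
  | left_chor_choosing (c : ℕ) (E : Cirquent 0) :
      Provable (E.chooseLeft c) → Provable E
  | right_chor_choosing (c : ℕ) (E : Cirquent 0) :
      Provable (E.chooseRight c) → Provable E
  | chexists_choosing (c a : ℕ) (E : Cirquent 0) :
      Provable (E.chooseConst c a) → Provable E
  | left_chand_cleansing {m k : ℕ} (X : Ctx m 0) (c : ℕ) (Y : Ctx k m) (A B : Cirquent k)
      (C : Cirquent m) :
      Provable (X.fill (chand c (Y.fill A) C)) →
      Provable (X.fill (chand c (Y.fill (chand c A B)) C))
  | right_chand_cleansing {m k : ℕ} (X : Ctx m 0) (c : ℕ) (Y : Ctx k m) (A B : Cirquent k)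
      (C : Cirquent m) :
      Provable (X.fill (chand c C (Y.fill B))) →
      Provable (X.fill (chand c C (Y.fill (chand c A B))))
  | chall_cleansing {m k : ℕ} (X : Ctx m 0) (c : ℕ) (Y : Ctx k (m + 1)) (A : Cirquent (k + 1)) :
      Provable (X.fill (chall c (Y.fill (A.inst (.var (Y.holeVar 0)))))) →
      Provable (X.fill (chall c (Y.fill (chall c A))))
  | pand_distribution {m : ℕ} (X : Ctx m 0) (A B C : Cirquent m) :
      Provable (X.fill (pand (por A C) (por B C))) → Provable (X.fill (por (pand A B) C))
  | chand_distribution {m : ℕ} (X : Ctx m 0) (c : ℕ) (A B C : Cirquent m) :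
      Provable (X.fill (chand c (por A C) (por B C))) → Provable (X.fill (por (chand c A B) C))
  | chall_distribution {m : ℕ} (X : Ctx m 0) (c : ℕ) (A : Cirquent (m + 1)) (B : Cirquent m) :
      Provable (X.fill (chall c (por A B.shift))) → Provable (X.fill (por (chall c A) B))
  | trivialization {m : ℕ} (X : Ctx m 0) (p : PredLetter) (t : Fin p.arity → Term m) :
      Provable (X.fill top) → Provable (X.fill (por (natom p t) (atom p t)))
  | chandchotomy {m : ℕ} (X : Ctx m 0) (a b c : ℕ) (A B C D : Cirquent m)
      (hc : ⟨.chand, c⟩ ∉ (X.fill (pand (chand a A B) (chand b C D))).clusters) :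
      Provable (X.fill (chand c
        (chand a (pand A (chand b C D)) (pand B (chand b C D)))
        (chand b (pand (chand a A B) C) (pand (chand a A B) D)))) →
      Provable (X.fill (pand (chand a A B) (chand b C D)))
  | challchotomy {m : ℕ} (X : Ctx m 0) (a b c : ℕ) (A B : Cirquent (m + 1))
      (hc : ⟨.chand, c⟩ ∉ (X.fill (pand (chall a A) (chall b B))).clusters) :
      Provable (X.fill (chand c
        (chall a (pand A (chall b B).shift))
        (chall b (pand (chall a A).shift B)))) →
      Provable (X.fill (pand (chall a A) (chall b B)))
  | chandallchotomy {m : ℕ} (X : Ctx m 0) (a b c : ℕ) (A B : Cirquent m) (C : Cirquent (m + 1))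
      (hc : ⟨.chand, c⟩ ∉ (X.fill (pand (chand a A B) (chall b C))).clusters) :
      Provable (X.fill (chand c
        (chand a (pand A (chall b C)) (pand B (chall b C)))
        (chall b (pand (chand a A B).shift C)))) →
      Provable (X.fill (pand (chand a A B) (chall b C)))
  | chand_splitting (c : ℕ) (A B : Cirquent 0)
      (hA : ⟨.chand, c⟩ ∉ A.clusters) (hB : ⟨.chand, c⟩ ∉ B.clusters) :
      Provable A → Provable B → Provable (chand c A B)
  | chall_splitting (c a : ℕ) (A : Cirquent 1)
      (hc : ⟨.chall, c⟩ ∉ A.clusters) (ha : a ∉ A.constants) :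
      Provable (A.inst (.const a)) → Provable (chall c A)

/-! ## Moves and runs -/

/-- The two players. -/
inductive Player : Type
  | machine
  | environment
  deriving DecidableEq

/-- The alphabet in which moves are written. -/
inductive Key : Type
  | digit (d : Fin 10)
  | dot
  | kind (k : ClusterKind)
  deriving DecidableEq

/-- A move is any finite string. -/
abbrev Move : Type := List Key

/-- The decimal numeral of a natural number, most significant digit first. -/
def numeral (a : ℕ) : List Key :=
  if a = 0 then [.digit 0] else (Nat.digits 10 a).reverse.map fun d => .digit (Fin.ofNat 10 d)

/-- The name of a cluster: the symbol of its sort, followed by the numeral of its index. -/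
def Cluster.name (c : Cluster) : List Key := .kind c.kind :: numeral c.index

/-- The move `c.a`. -/
def Cluster.move (c : Cluster) (a : ℕ) : Move := c.name ++ .dot :: numeral a

/-- A move together with the player who made it. -/
structure LabMove : Type where
  player : Player
  move : Move
  deriving DecidableEq

/-- A position is a finite run. -/
abbrev Position : Type := List LabMove

/-- A run is a finite or infinite sequence of labeled moves. -/
abbrev Run : Type := Stream'.Seq LabMove

/-- The player who may choose in the clusters of a given sort. -/
def ClusterKind.owner : ClusterKind → Player
  | chor => .machine
  | chand => .environment
  | chexists => .machine
  | chall => .environment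

/-- The choices available in the clusters of a given sort: `0` and `1` for `⊔`, `⊓`, all
constants for the quantifiers. -/
def ClusterKind.Choice : ClusterKind → ℕ → Prop
  | chor, a => a = 0 ∨ a = 1
  | chand, a => a = 0 ∨ a = 1
  | chexists, _ => True
  | chall, _ => True

namespace Run

/-- `Γ` contains the move `c.a` (whoever made it). -/
def Has (Γ : Run) (c : Cluster) (a : ℕ) : Prop :=
  ∃ i l, Γ.get? i = some ⟨l, c.move a⟩

/-- Some choice is made in cluster `c`. -/
def Resolved (Γ : Run) (c : Cluster) : Prop := ∃ a, Γ.Has c a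

/-- The legal runs: every move is a choice `c.a` available in a cluster `c`, made by the player
who owns `c`, and in no cluster more than one choice is made. -/
def Legal (Γ : Run) : Prop :=
  (∀ i l, Γ.get? i = some l →
    ∃ (c : Cluster) (a : ℕ), l.move = c.move a ∧ c.kind.Choice a ∧ l.player = c.kind.owner) ∧
  (∀ (c : Cluster) (i j : ℕ) (k l : Player) (a b : ℕ),
    Γ.get? i = some ⟨k, c.move a⟩ → Γ.get? j = some ⟨l, c.move b⟩ → i = j)

/-- The run `Γ` is illegal, and the first illegal move in it is made by player `l`. -/
def FirstIllegalBy (Γ : Run) (l : Player) : Prop :=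
  ∃ (i : ℕ) (α : Move), Γ.get? i = some ⟨l, α⟩ ∧
    Legal (Stream'.Seq.ofList (Γ.take i)) ∧ ¬ Legal (Stream'.Seq.ofList (Γ.take (i + 1)))

end Run

/-! ## Games -/

/-- An interpretation assigns to every `k`-ary predicate letter a `k`-ary relation on `ℕ`. -/
abbrev Interpretation : Type := (p : PredLetter) → Set (Fin p.arity → ℕ)

/-- `WonLegal I Γ C`: the legal run `Γ` is a won (by the machine) run of `C` under the
interpretation `I`. -/
inductive WonLegal (I : Interpretation) (Γ : Run) : Cirquent 0 → Prop
  | top : WonLegal I Γ .top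
  | atom (p : PredLetter) (t : Fin p.arity → Term 0) :
      (fun i => (t i).value) ∈ I p → WonLegal I Γ (.atom p t)
  | natom (p : PredLetter) (t : Fin p.arity → Term 0) :
      (fun i => (t i).value) ∉ I p → WonLegal I Γ (.natom p t)
  | pand (A B : Cirquent 0) : WonLegal I Γ A → WonLegal I Γ B → WonLegal I Γ (.pand A B)
  | por_left (A B : Cirquent 0) : WonLegal I Γ A → WonLegal I Γ (.por A B)
  | por_right (A B : Cirquent 0) : WonLegal I Γ B → WonLegal I Γ (.por A B)
  | chand_left (c : ℕ) (A B : Cirquent 0) :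
      Γ.Has ⟨.chand, c⟩ 0 → WonLegal I Γ A → WonLegal I Γ (.chand c A B)
  | chand_right (c : ℕ) (A B : Cirquent 0) :
      Γ.Has ⟨.chand, c⟩ 1 → WonLegal I Γ B → WonLegal I Γ (.chand c A B)
  | chand_unresolved (c : ℕ) (A B : Cirquent 0) :
      ¬ Γ.Resolved ⟨.chand, c⟩ → WonLegal I Γ (.chand c A B)
  | chor_left (c : ℕ) (A B : Cirquent 0) :
      Γ.Has ⟨.chor, c⟩ 0 → WonLegal I Γ A → WonLegal I Γ (.chor c A B)
  | chor_right (c : ℕ) (A B : Cirquent 0) :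
      Γ.Has ⟨.chor, c⟩ 1 → WonLegal I Γ B → WonLegal I Γ (.chor c A B)
  | chall (c a : ℕ) (A : Cirquent 1) :
      Γ.Has ⟨.chall, c⟩ a → WonLegal I Γ (A.inst (.const a)) → WonLegal I Γ (.chall c A)
  | chall_unresolved (c : ℕ) (A : Cirquent 1) :
      ¬ Γ.Resolved ⟨.chall, c⟩ → WonLegal I Γ (.chall c A)
  | chexists (c a : ℕ) (A : Cirquent 1) :
      Γ.Has ⟨.chexists, c⟩ a → WonLegal I Γ (A.inst (.const a)) → WonLegal I Γ (.chexists c A)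

/-- An arbitrary run of the game `C` under `I` is won by the machine iff it is legal and won in the
above sense, or it is illegal, the environment having made the first illegal move. -/
def Won (I : Interpretation) (Γ : Run) (C : Cirquent 0) : Prop :=
  (Γ.Legal ∧ WonLegal I Γ C) ∨ Γ.FirstIllegalBy .environment

/-! ## Hard-play machines -/

/-- The symbols written on the run tape: the players' labels and the symbols of moves. -/
inductive RunSymbol : Type
  | label (l : Player)
  | key (k : Key)
  deriving DecidableEq

/-- The content of the run tape in a given position: the labeled moves one after another. -/
def spell (Φ : Position) : List RunSymbol :=
  Φ.flatMap fun l => .label l.player :: l.move.map .key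

/-- What a hard-play machine does in one step: it goes to a state, writes a symbol on each work
tape, moves (or not) the heads of the work tapes and of the run tape, and appends at most one
symbol to the buffer. -/
structure Action (State Symbol Tp : Type) : Type where
  next : State
  write : Tp → Symbol
  moveWork : Tp → Option Turing.Dir
  moveRun : Option Turing.Dir
  append : Option Key

/-- A hard-play machine: a deterministic Turing machine with finitely many read/write work tapes,
a read-only run tape that displays the current position, and a write-only buffer in which moves
are assembled. When it enters one of its move states, the machine makes the move that is written in
the buffer. The work tapes are infinite in both directions; `default` is the blank symbol. -/
structure HPM : Type 1 where
  State : Type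
  Symbol : Type
  Tp : Type
  [finiteState : Finite State]
  [finiteSymbol : Finite Symbol]
  [finiteTp : Finite Tp]
  [blank : Inhabited Symbol]
  start : State
  moveStates : Set State
  /-- the transition function: it reads the state, the symbol under the head of the run tape
  (`none` for a blank) and the symbols under the heads of the work tapes -/
  step : State → Option RunSymbol → (Tp → Symbol) → Action State Symbol Tp

attribute [instance] HPM.finiteState HPM.finiteSymbol HPM.finiteTp HPM.blank

namespace HPM

/-- A configuration of a machine. -/
structure Config (M : HPM) : Type where
  state : M.State
  work : M.Tp → Turing.Tape M.Symbol
  runHead : ℕ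
  buffer : List Key
  position : Position

/-- Moving a head on the run tape, whose cells are numbered by `0, 1, 2, …`. -/
def shiftHead (h : ℕ) : Option Turing.Dir → ℕ
  | none => h
  | some .left => h - 1
  | some .right => h + 1

/-- Moving the head of a work tape. -/
def shiftTape {S : Type} [Inhabited S] (T : Turing.Tape S) : Option Turing.Dir → Turing.Tape S
  | none => T
  | some d => T.move d

/-- The initial configuration: everything is empty. -/
def init (M : HPM) : M.Config where
  state := M.start
  work := fun _ => default
  runHead := 0
  buffer := []
  position := []

open Classical in
/-- The configuration after one step during which the environment makes the moves `e` (any finite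
number of arbitrary moves). -/
noncomputable def nextConfig (M : HPM) (C : M.Config) (e : List Move) : M.Config :=
  let act := M.step C.state (spell C.position)[C.runHead]? (fun i => (C.work i).head)
  let buf := C.buffer ++ act.append.toList
  let own : Position := if act.next ∈ M.moveStates then [⟨.machine, buf⟩] else []
  { state := act.next
    work := fun i => shiftTape ((C.work i).write (act.write i)) (act.moveWork i)
    runHead := shiftHead C.runHead act.moveRun
    buffer := if act.next ∈ M.moveStates then [] else buf
    position := C.position ++ own ++ e.map fun α => ⟨.environment, α⟩ }

/-- The computation branch of `M` in which the environment makes the moves `e t` during step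
number `t`. -/
noncomputable def branch (M : HPM) (e : ℕ → List Move) : ℕ → M.Config
  | 0 => M.init
  | t + 1 => M.nextConfig (M.branch e t) (e t)

open Classical in
/-- The run that a computation branch incrementally spells on the run tape. -/
noncomputable def run (M : HPM) (e : ℕ → List Move) : Run :=
  ⟨fun i =>
    if h : ∃ t, i < (M.branch e t).position.length then
      (M.branch e (Nat.find h)).position[i]?
    else none, by
    intro i hi
    by_cases h : ∃ t, i < (M.branch e t).position.length
    · simp only [dif_pos h, List.getElem?_eq_none_iff] at hi
      exact absurd (Nat.find_spec h) (not_lt.mpr hi)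
    · exact dif_neg fun ⟨t, ht⟩ => h ⟨t, by omega⟩⟩

/-- `M` is a solution of `C` under `I`: it wins the game, whatever the environment does. -/
def IsSolution (M : HPM) (I : Interpretation) (C : Cirquent 0) : Prop :=
  ∀ e : ℕ → List Move, Won I (M.run e) C

/-- `M` is a logical solution of `C`: a solution under every interpretation. -/
def IsLogicalSolution (M : HPM) (C : Cirquent 0) : Prop :=
  ∀ I : Interpretation, M.IsSolution I C

end HPM

/-- Logical validity of a closed cirquent. -/
def Valid (C : Cirquent 0) : Prop := ∃ M : HPM, M.IsLogicalSolution C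

end CL17

/-!
Both directions go through games that are simpler than runs of machines.

*Truth at an assignment.* A legal run matters only through the choices that have been made in it,
an assignment `σ`, and it is won iff the cirquent is true at `σ` when an unresolved operator
counts as true for the environment's sorts and as false for the machine's (`Cirquent.ev`,
`wonLegal_iff_ev`). Every cirquent has finitely many clusters, so only finitely many choices
matter.

*Soundness.* In the symbolic game the environment's choice in a `∀`-cluster `d` is represented by
a symbol "the choice made in `d`", and the machine chooses constants or copies such symbols. A
cirquent is `Winnable` if in this game the machine can always reach an assignment where the
cirquent is true under every interpretation. Almost all rules, read from premise to conclusion,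
preserve truth at every assignment. The remaining ones change the strategy by `Win.simulate`: for
choosing, the machine first makes the choice; for splitting, it waits for the environment
(`Winnable.chand`, `Winnable.chall`), and a fresh constant is replaced by a symbol; for the
chotomies, the cluster of the premise records which of the two clusters of the conclusion is
resolved first (`Winnable.chotomy`). Thus provable cirquents are winnable (`Provable.winnable`).
In the symbolic game the environment has only finitely many moves, so a winning strategy is finite
(`Win.exists_strategy`) and can be built into the states of a machine without work tapes
(`Strategy.machine`). The machine keeps scanning the run tape; the beginning of a move, up to a
bounded length, tells it the cluster and, for `⊓`, the choice. A number chosen by the environment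
has no bounded length, but the machine needs it only in order to copy it from the run tape to the
buffer. Its invariant shows that it makes only legal moves (`Strategy.phaseInv_step`); that it
arrives at a node of the strategy which describes the whole run is `Strategy.exists_final`.
Together: `Winnable.valid`.

*Completeness.* If a machine wins `E` under every interpretation, then `E` can be won in a
well-founded game (`CanWin`): from each position, let the environment be silent; either the
machine makes a move in a cluster of `E`, or the position is already won, and it has to remain
winnable after any move of the environment (`HPM.canWin`). Provability follows by induction on
this game. A move of the machine is an application of a choosing rule. In a position where the
machine may wait, the cirquent is true under every interpretation. Backwards, and without loss, it
is brought into a conjunctive normal form (`exists_nf`), in which a disjunction of literals and of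
operators of the machine either reduces to `⊤` by trivialization or can be falsified
(`Clause.dead_or_red`). Chotomies eliminate the conjunctions (`Tree.pand`), and there remains a
tree of choices of the environment, from whose root splitting, preceded by cleansing
(`Provable.chand_root`, `Provable.chall_root`), leads to later positions of the game; falsifiable
leaves cannot occur, since the cirquent is true (`Tree.provable`).
-/

namespace CL17

/-! ### Truth of a cirquent at an assignment of choices -/

/-- The choices in a cluster: a bit (`false` for left, `true` for right) for `⊔` and `⊓`, a value
for the quantifiers. Values range over a type `V`, so that symbolic values are possible. -/
@[reducible] def Cho (V : Type) : ClusterKind → Type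
  | .chor => Bool
  | .chand => Bool
  | .chexists => V
  | .chall => V

/-- An assignment says which clusters are resolved, and by which choices. -/
abbrev Asg (V : Type) : Type := (c : Cluster) → Option (Cho V c.kind)

/-- The assignment in which no cluster is resolved. -/
def Asg.empty (V : Type) : Asg V := fun _ => none

/-- The value of a term, where `ι` evaluates constants and `ρ` variables. -/
def Term.eval {V : Type} {n : ℕ} (ι : ℕ → V) (ρ : Fin n → V) : Term n → V
  | var i => ρ i
  | const a => ι a

/-- Interpretations over an arbitrary domain of values. -/
abbrev Interp (V : Type) : Type := (p : PredLetter) → Set (Fin p.arity → V)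

namespace Cirquent

/-- Truth of a cirquent once play has stopped with the clusters resolved as in `σ`: an unresolved
operator counts as true if it is a choice of the environment, and as false otherwise. -/
def ev {V : Type} (ι : ℕ → V) (I : Interp V) (σ : Asg V) : {n : ℕ} → Cirquent n → (Fin n → V) → Prop
  | _, top, _ => True
  | _, bot, _ => False
  | _, atom p t, ρ => (fun i => (t i).eval ι ρ) ∈ I p
  | _, natom p t, ρ => (fun i => (t i).eval ι ρ) ∉ I p
  | _, pand A B, ρ => A.ev ι I σ ρ ∧ B.ev ι I σ ρ
  | _, por A B, ρ => A.ev ι I σ ρ ∨ B.ev ι I σ ρ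
  | _, chand c A B, ρ =>
      (σ ⟨.chand, c⟩ = some false → A.ev ι I σ ρ) ∧ (σ ⟨.chand, c⟩ = some true → B.ev ι I σ ρ)
  | _, chor c A B, ρ =>
      (σ ⟨.chor, c⟩ = some false ∧ A.ev ι I σ ρ) ∨ (σ ⟨.chor, c⟩ = some true ∧ B.ev ι I σ ρ)
  | _, chall c A, ρ => ∀ v : V, σ ⟨.chall, c⟩ = some v → A.ev ι I σ (Fin.cons v ρ)
  | _, chexists c A, ρ => ∃ v : V, σ ⟨.chexists, c⟩ = some v ∧ A.ev ι I σ (Fin.cons v ρ)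

end Cirquent

section Semantics

variable {V : Type} {ι : ℕ → V} {I : Interp V} {σ : Asg V}

open Cirquent

theorem Term.eval_subst {n m : ℕ} (s : Fin n → Term m) (ρ : Fin m → V) (t : Term n) :
    (t.subst s).eval ι ρ = t.eval ι (fun i => (s i).eval ι ρ) := by
  cases t <;> rfl

theorem Term.eval_liftSubst {n m : ℕ} (s : Fin n → Term m) (ρ : Fin m → V) (v : V) :
    (fun i => (Term.liftSubst s i).eval ι (Fin.cons v ρ : Fin (m + 1) → V)) =
      (Fin.cons v (fun i => (s i).eval ι ρ) : Fin (n + 1) → V) := by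
  funext i
  refine Fin.cases ?_ (fun i => ?_) i
  · simp [Term.liftSubst, Term.eval]
  · simp only [Term.liftSubst, Fin.cases_succ, Term.eval_subst, Fin.cons_succ]
    congr 1

theorem ev_subst {n : ℕ} (A : Cirquent n) : ∀ {m : ℕ} (s : Fin n → Term m) (ρ : Fin m → V),
    (A.subst s).ev ι I σ ρ ↔ A.ev ι I σ (fun i => (s i).eval ι ρ) := by
  induction A with
  | top | bot => intros; rfl
  | atom | natom => intros; simp only [subst, ev, Term.eval_subst]
  | pand _ _ ihA ihB | por _ _ ihA ihB | chand _ _ _ ihA ihB | chor _ _ _ ihA ihB =>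
    intros; simp only [subst, ev, ihA, ihB]
  | chall _ _ ih | chexists _ _ ih =>
    intros; simp only [subst, ev, ih, Term.eval_liftSubst]

theorem ev_inst {n : ℕ} (A : Cirquent (n + 1)) (t : Term n) (ρ : Fin n → V) :
    (A.inst t).ev ι I σ ρ ↔ A.ev ι I σ (Fin.cons (t.eval ι ρ) ρ) := by
  rw [inst, ev_subst]
  refine iff_of_eq (congrArg _ (funext fun i => ?_))
  refine Fin.cases ?_ (fun i => ?_) i <;> simp [Term.eval]

theorem ev_shift {n : ℕ} (A : Cirquent n) (v : V) (ρ : Fin n → V) :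
    A.shift.ev ι I σ (Fin.cons v ρ : Fin (n + 1) → V) ↔ A.ev ι I σ ρ := by
  rw [shift, ev_subst]
  simp [Term.eval]

theorem ev_congr {τ : Asg V} {n : ℕ} (A : Cirquent n) (h : ∀ c ∈ A.clusters, σ c = τ c)
    (ρ : Fin n → V) : A.ev ι I σ ρ ↔ A.ev ι I τ ρ := by
  induction A with
  | top | bot | atom | natom => rfl
  | pand _ _ ihA ihB | por _ _ ihA ihB =>
    simp only [clusters, Finset.mem_union] at h
    simp only [ev, ihA fun c hc => h c (.inl hc), ihB fun c hc => h c (.inr hc)]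
  | chand _ _ _ ihA ihB | chor _ _ _ ihA ihB =>
    simp only [clusters, Finset.mem_insert, Finset.mem_union] at h
    simp only [ev, ihA fun c hc => h c (.inr (.inl hc)), ihB fun c hc => h c (.inr (.inr hc)),
      h _ (.inl rfl)]
  | chall _ _ ih | chexists _ _ ih =>
    simp only [clusters, Finset.mem_insert] at h
    simp only [ev, ih fun c hc => h c (.inr hc), h _ (.inl rfl)]

theorem ev_fill_mono_holeVar {m : ℕ} {A B : Cirquent m} {n : ℕ} (X : Ctx m n) (ρ : Fin n → V)
    (h : ∀ ρ' : Fin m → V, (∀ i, ρ' (X.holeVar i) = ρ i) → A.ev ι I σ ρ' → B.ev ι I σ ρ') :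
    (X.fill A).ev ι I σ ρ → (X.fill B).ev ι I σ ρ := by
  induction X with
  | hole => exact h ρ fun _ => rfl
  | pandL X C ih => exact And.imp_left (ih ρ h)
  | pandR C X ih => exact And.imp_right (ih ρ h)
  | porL X C ih => exact Or.imp_left (ih ρ h)
  | porR C X ih => exact Or.imp_right (ih ρ h)
  | chandL c X C ih => exact And.imp_left fun k e => ih ρ h (k e)
  | chandR c C X ih => exact And.imp_right fun k e => ih ρ h (k e)
  | chorL c X C ih => exact Or.imp_left (And.imp_right (ih ρ h))
  | chorR c C X ih => exact Or.imp_right (And.imp_right (ih ρ h))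
  | chall c X ih =>
    exact fun k v e => ih (Fin.cons v ρ) (fun ρ' hρ' => h ρ' fun i => by
      simpa [Ctx.holeVar] using hρ' i.succ) (k v e)
  | chexists c X ih =>
    exact fun ⟨v, e, k⟩ => ⟨v, e, ih (Fin.cons v ρ) (fun ρ' hρ' => h ρ' fun i => by
      simpa [Ctx.holeVar] using hρ' i.succ) k⟩

theorem ev_fill_mono {m : ℕ} {A B : Cirquent m} {n : ℕ} (X : Ctx m n) (ρ : Fin n → V)
    (h : ∀ ρ' : Fin m → V, A.ev ι I σ ρ' → B.ev ι I σ ρ') :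
    (X.fill A).ev ι I σ ρ → (X.fill B).ev ι I σ ρ :=
  ev_fill_mono_holeVar X ρ fun ρ' _ => h ρ'

theorem ev_chooseLeft {c : ℕ} (h : σ ⟨.chor, c⟩ = some false) {n : ℕ} (A : Cirquent n)
    (ρ : Fin n → V) : (A.chooseLeft c).ev ι I σ ρ ↔ A.ev ι I σ ρ := by
  induction A with
  | top | bot | atom | natom => rfl
  | pand _ _ ihA ihB | por _ _ ihA ihB | chand _ _ _ ihA ihB =>
    simp only [chooseLeft, ev, ihA, ihB]
  | chor d _ _ ihA ihB =>
    by_cases hd : d = c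
    · subst hd; simp [chooseLeft, ev, h, ihA]
    · simp only [chooseLeft, if_neg hd, ev, ihA, ihB]
  | chall _ _ ih | chexists _ _ ih => simp only [chooseLeft, ev, ih]

theorem ev_chooseRight {c : ℕ} (h : σ ⟨.chor, c⟩ = some true) {n : ℕ} (A : Cirquent n)
    (ρ : Fin n → V) : (A.chooseRight c).ev ι I σ ρ ↔ A.ev ι I σ ρ := by
  induction A with
  | top | bot | atom | natom => rfl
  | pand _ _ ihA ihB | por _ _ ihA ihB | chand _ _ _ ihA ihB =>
    simp only [chooseRight, ev, ihA, ihB]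
  | chor d _ _ ihA ihB =>
    by_cases hd : d = c
    · subst hd; simp [chooseRight, ev, h, ihB]
    · simp only [chooseRight, if_neg hd, ev, ihA, ihB]
  | chall _ _ ih | chexists _ _ ih => simp only [chooseRight, ev, ih]

theorem ev_chooseConst {c a : ℕ} (h : σ ⟨.chexists, c⟩ = some (ι a)) {n : ℕ} (A : Cirquent n)
    (ρ : Fin n → V) : (A.chooseConst c a).ev ι I σ ρ ↔ A.ev ι I σ ρ := by
  induction A with
  | top | bot | atom | natom => rfl
  | pand _ _ ihA ihB | por _ _ ihA ihB | chand _ _ _ ihA ihB | chor _ _ _ ihA ihB =>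
    simp only [chooseConst, ev, ihA, ihB]
  | chexists d _ ih =>
    by_cases hd : d = c
    · subst hd; simp [chooseConst, ev, h, ev_inst, ih, Term.eval]
    · simp only [chooseConst, if_neg hd, ev, ih]
  | chall _ _ ih => simp only [chooseConst, ev, ih]

/-- The map on choices induced by a map on values. -/
def Cho.map {V W : Type} (f : V → W) : {k : ClusterKind} → Cho V k → Cho W k
  | .chor, b => b
  | .chand, b => b
  | .chexists, v => f v
  | .chall, v => f v

/-- The map on assignments induced by a map on values. -/
def Asg.map {V W : Type} (f : V → W) (σ : Asg V) : Asg W := fun c => (σ c).map (Cho.map f)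

theorem Asg.map_update {V W : Type} (f : V → W) (σ : Asg V) (c : Cluster) (x : Cho V c.kind) :
    Asg.map f (Function.update σ c (some x)) =
      Function.update (Asg.map f σ) c (some (x.map f)) := by
  funext d
  by_cases h : d = c
  · subst h; simp [Asg.map]
  · simp [Asg.map, Function.update_of_ne h]

theorem ev_map {W : Type} {κ : ℕ → W} {J : Interp W} (f : V → W) {n : ℕ} (A : Cirquent n)
    (hf : ∀ a ∈ A.constants, f (ι a) = κ a) (ρ : Fin n → V) :
    A.ev κ J (σ.map f) (f ∘ ρ) ↔ A.ev ι (fun p => {x | f ∘ x ∈ J p}) σ ρ := by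
  have key : ∀ {n : ℕ} (t : Term n) (ρ : Fin n → V), (∀ a ∈ t.constants, f (ι a) = κ a) →
      t.eval κ (f ∘ ρ) = f (t.eval ι ρ) := by
    intro n t ρ h
    cases t with
    | var => rfl
    | const a => exact (h a (by simp [Term.constants])).symm
  have cons : ∀ {n : ℕ} (ρ : Fin n → V) (v : V),
      (Fin.cons (f v) (f ∘ ρ) : Fin (n + 1) → W) = f ∘ (Fin.cons v ρ : Fin (n + 1) → V) :=
    fun ρ v => (Fin.comp_cons f v ρ).symm
  induction A with
  | top | bot => rfl
  | atom p t | natom p t =>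
    have : (fun i => (t i).eval κ (f ∘ ρ)) = f ∘ fun i => (t i).eval ι ρ := by
      funext i
      refine key _ _ fun a ha => hf a ?_
      simp only [constants, Finset.mem_biUnion]
      exact ⟨i, Finset.mem_univ _, ha⟩
    simp only [ev, this, Set.mem_ofPred_eq]
  | pand _ _ ihA ihB | por _ _ ihA ihB =>
    simp only [constants, Finset.mem_union] at hf
    simp only [ev, ihA fun c hc => hf c (.inl hc), ihB fun c hc => hf c (.inr hc)]
  | chand c _ _ ihA ihB =>
    simp only [constants, Finset.mem_union] at hf
    have : ∀ b : Bool, σ.map f ⟨.chand, c⟩ = some b ↔ σ ⟨.chand, c⟩ = some b := by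
      intro b
      cases h : σ ⟨.chand, c⟩ <;> simp [Asg.map, h, Cho.map]
    simp only [ev, ihA fun c hc => hf c (.inl hc), ihB fun c hc => hf c (.inr hc), this]
  | chor c _ _ ihA ihB =>
    simp only [constants, Finset.mem_union] at hf
    have : ∀ b : Bool, σ.map f ⟨.chor, c⟩ = some b ↔ σ ⟨.chor, c⟩ = some b := by
      intro b
      cases h : σ ⟨.chor, c⟩ <;> simp [Asg.map, h, Cho.map]
    simp only [ev, ihA fun c hc => hf c (.inl hc), ihB fun c hc => hf c (.inr hc), this]
  | chall c A ih =>
    simp only [constants] at hf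
    simp only [ev]
    cases h : σ ⟨.chall, c⟩ <;> simp [Asg.map, h, Cho.map, cons, ← ih hf]
  | chexists c A ih =>
    simp only [constants] at hf
    simp only [ev]
    cases h : σ ⟨.chexists, c⟩ <;> simp [Asg.map, h, Cho.map, cons, ← ih hf]

theorem clusters_subst {n : ℕ} (A : Cirquent n) : ∀ {m : ℕ} (s : Fin n → Term m),
    (A.subst s).clusters = A.clusters := by
  induction A <;> intros <;> simp only [subst, clusters, *]

theorem clusters_inst {n : ℕ} (A : Cirquent (n + 1)) (t : Term n) :
    (A.inst t).clusters = A.clusters := clusters_subst _ _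

theorem clusters_shift {n : ℕ} (A : Cirquent n) : A.shift.clusters = A.clusters :=
  clusters_subst _ _

theorem clusters_chooseLeft (c : ℕ) {n : ℕ} (A : Cirquent n) :
    (A.chooseLeft c).clusters ⊆ A.clusters.erase ⟨.chor, c⟩ := by
  induction A with
  | chor d A B ihA ihB =>
    intro e he
    simp only [chooseLeft] at he
    split_ifs at he with hd <;>
      simp only [clusters, Finset.mem_erase, Finset.mem_insert, Finset.mem_union, Finset.subset_iff]
        at * <;> grind
  | _ =>
    simp only [clusters, chooseLeft, Finset.mem_erase, Finset.mem_insert, Finset.mem_union,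
      Finset.subset_iff] at *
    grind

theorem clusters_chooseRight (c : ℕ) {n : ℕ} (A : Cirquent n) :
    (A.chooseRight c).clusters ⊆ A.clusters.erase ⟨.chor, c⟩ := by
  induction A with
  | chor d A B ihA ihB =>
    intro e he
    simp only [chooseRight] at he
    split_ifs at he with hd <;>
      simp only [clusters, Finset.mem_erase, Finset.mem_insert, Finset.mem_union, Finset.subset_iff]
        at * <;> grind
  | _ =>
    simp only [clusters, chooseRight, Finset.mem_erase, Finset.mem_insert, Finset.mem_union,
      Finset.subset_iff] at *
    grind

theorem clusters_chooseConst (c a : ℕ) {n : ℕ} (A : Cirquent n) :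
    (A.chooseConst c a).clusters ⊆ A.clusters.erase ⟨.chexists, c⟩ := by
  induction A with
  | chexists d A ih =>
    intro e he
    simp only [chooseConst] at he
    split_ifs at he with hd <;>
      simp only [clusters, clusters_inst, Finset.mem_erase, Finset.mem_insert,
        Finset.subset_iff] at * <;> grind
  | _ =>
    simp only [clusters, chooseConst, Finset.mem_erase, Finset.mem_insert, Finset.mem_union,
      Finset.subset_iff] at *
    grind

theorem clusters_fill {m n : ℕ} (X : Ctx m n) (A : Cirquent m) :
    A.clusters ⊆ (X.fill A).clusters := by
  induction X with
  | hole => exact subset_rfl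
  | _ =>
    intro e he
    simp only [Ctx.fill, clusters, Finset.mem_insert, Finset.mem_union, Finset.subset_iff] at *
    grind

end Semantics

/-! ### The symbolic game -/

/-- The values of the symbolic game: a constant, or "whatever constant the environment has chosen
in the `∀`-cluster `d`". -/
inductive Sym : Type
  | const (a : ℕ)
  | copy (d : ℕ)

/-- The moves of the environment in the symbolic game. In a `∀`-cluster `d` there is only one: it
chooses the symbol that stands for its own choice. -/
def EnvOpt : (c : Cluster) → Cho Sym c.kind → Prop
  | ⟨.chor, _⟩, _ => False
  | ⟨.chand, _⟩, _ => True
  | ⟨.chexists, _⟩, _ => False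
  | ⟨.chall, d⟩, x => x = Sym.copy d

/-- The moves of the machine in the symbolic game. In an `∃`-cluster it chooses a constant, or copies
a choice already made by the environment in a `∀`-cluster. -/
def MachOpt (σ : Asg Sym) : (c : Cluster) → Cho Sym c.kind → Prop
  | ⟨.chor, _⟩, _ => True
  | ⟨.chand, _⟩, _ => False
  | ⟨.chexists, _⟩, x => ∀ d, x = Sym.copy d → σ ⟨.chall, d⟩ ≠ none
  | ⟨.chall, _⟩, _ => False

theorem EnvOpt.owner {c : Cluster} {x : Cho Sym c.kind} (h : EnvOpt c x) :
    c.kind.owner = .environment := by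
  obtain ⟨k, i⟩ := c
  cases k <;> first | rfl | exact h.elim

theorem MachOpt.owner {σ : Asg Sym} {c : Cluster} {x : Cho Sym c.kind} (h : MachOpt σ c x) :
    c.kind.owner = .machine := by
  obtain ⟨k, i⟩ := c
  cases k <;> first | rfl | exact h.elim

theorem EnvOpt.ne {σ : Asg Sym} {c d : Cluster} {x : Cho Sym c.kind} {y : Cho Sym d.kind}
    (hx : EnvOpt c x) (hy : MachOpt σ d y) : c ≠ d := by
  rintro rfl
  have := hx.owner.symm.trans hy.owner
  cases this

theorem MachOpt.mono {σ τ : Asg Sym} (h : ∀ d, σ ⟨.chall, d⟩ ≠ none → τ ⟨.chall, d⟩ ≠ none)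
    {c : Cluster} {x : Cho Sym c.kind} (hx : MachOpt σ c x) : MachOpt τ c x := by
  obtain ⟨k, i⟩ := c
  cases k <;> first | exact hx | exact fun d hd => h d (hx d hd)

/-- The machine can win the symbolic game from the assignment `σ`. Here `S` is a finite set of
clusters, in which the environment may move at any time, and `G` is the set of the assignments in
which the machine may stop. -/
inductive Win (S : Finset Cluster) (G : Asg Sym → Prop) : Asg Sym → Prop
  | wait (σ : Asg Sym) : G σ →
      (∀ c ∈ S, σ c = none → ∀ x, EnvOpt c x → Win S G (Function.update σ c (some x))) → Win S G σ
  | move (σ : Asg Sym) (c : Cluster) (x : Cho Sym c.kind) : σ c = none → MachOpt σ c x →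
      Win S G (Function.update σ c (some x)) → Win S G σ

section SymbolicGame

variable {S T : Finset Cluster} {G H : Asg Sym → Prop}

theorem update_ne_none {V : Type} {σ : Asg V} {c d : Cluster} {x : Cho V c.kind}
    (h : σ d ≠ none) : Function.update σ c (some x) d ≠ none := by
  by_cases hd : d = c
  · subst hd; simp
  · rwa [Function.update_of_ne hd]

/-- A move of the environment does not spoil a won position: the moves that the machine was going to
make are still available, so they can be made after it. -/
theorem Win.env {σ : Asg Sym} (h : Win S G σ) {c : Cluster} (hc : c ∈ S) (hσ : σ c = none)
    {x : Cho Sym c.kind} (hx : EnvOpt c x) : Win S G (Function.update σ c (some x)) := by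
  induction h with
  | wait σ _ h _ => exact h c hc hσ x hx
  | move σ d y hd hy _ ih =>
    have hne := hx.ne hy
    refine .move _ d y ?_ (hy.mono fun _ => update_ne_none) ?_
    · rwa [Function.update_of_ne hne.symm]
    · rw [Function.update_comm hne]
      exact ih (by rwa [Function.update_of_ne hne])

/-- A move of the environment in a cluster of `S`. -/
def EnvStep (S : Finset Cluster) (σ τ : Asg Sym) : Prop :=
  ∃ c ∈ S, σ c = none ∧ ∃ x, EnvOpt c x ∧ τ = Function.update σ c (some x)

theorem Win.envSteps {σ τ : Asg Sym} (h : Win S G σ) (hs : Relation.ReflTransGen (EnvStep S) σ τ) :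
    Win S G τ := by
  induction hs with
  | refl => exact h
  | tail _ hs ih =>
    obtain ⟨c, hc, hσ, x, hx, rfl⟩ := hs
    exact ih.env hc hσ hx

/-- Simulation: while playing one game, the machine imagines a second one, in which it follows a
winning strategy. It translates the moves of the environment into the second game, and its own moves
out of it (ignoring those that do not matter). -/
theorem Win.simulate (R : Asg Sym → Asg Sym → Prop)
    (hG : ∀ {σ τ}, R σ τ → G σ → H τ)
    (hE : ∀ {σ τ c x}, R σ τ → c ∈ T → τ c = none → EnvOpt c x →
      ∃ σ', Relation.ReflTransGen (EnvStep S) σ σ' ∧ R σ' (Function.update τ c (some x)))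
    (hM : ∀ {σ τ c x}, R σ τ → σ c = none → MachOpt σ c x →
      R (Function.update σ c (some x)) τ ∨
      ∃ d y, τ d = none ∧ MachOpt τ d y ∧
        R (Function.update σ c (some x)) (Function.update τ d (some y)))
    {σ τ : Asg Sym} (hR : R σ τ) (h : Win S G σ) : Win T H τ := by
  have key : ∀ n : ℕ, ∀ σ, Win S G σ → ∀ τ, R σ τ → (T.filter (τ · = none)).card < n →
      Win T H τ := by
    intro n
    induction n with
    | zero => exact fun _ _ _ _ h => absurd h (Nat.not_lt_zero _)
    | succ n ihn =>
      intro σ h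
      induction h with
      | wait σ g h _ =>
        intro τ hR hn
        refine .wait _ (hG hR g) fun c hc hτ x hx => ?_
        obtain ⟨σ', hs, hR'⟩ := hE hR hc hτ hx
        refine ihn σ' ((Win.wait σ g h).envSteps hs) _ hR' ?_
        refine lt_of_lt_of_le (Finset.card_lt_card ?_) (Nat.lt_succ_iff.1 hn)
        refine (Finset.ssubset_iff_of_subset fun d hd => ?_).2
          ⟨c, by simp [hc, hτ], by simp⟩
        simp only [Finset.mem_filter] at hd ⊢
        exact ⟨hd.1, by_contra fun hn => update_ne_none hn hd.2⟩
      | move σ c x hσ hx _ ih =>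
        intro τ hR hn
        rcases hM hR hσ hx with hR' | ⟨d, y, hτ, hy, hR'⟩
        · exact ih τ hR' hn
        · refine .move _ d y hτ hy (ih _ hR' (lt_of_le_of_lt (Finset.card_le_card ?_) hn))
          intro e he
          simp only [Finset.mem_filter] at he ⊢
          exact ⟨he.1, by_contra fun hn => update_ne_none hn he.2⟩
  exact key _ σ h τ hR (Nat.lt_succ_self _)

theorem EnvStep.single {σ : Asg Sym} {c : Cluster} (hc : c ∈ S) (hσ : σ c = none)
    {x : Cho Sym c.kind} (hx : EnvOpt c x) :
    Relation.ReflTransGen (EnvStep S) σ (Function.update σ c (some x)) :=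
  .single ⟨c, hc, hσ, x, hx, rfl⟩

/-- Simulation by the same moves. -/
theorem Win.mono_of {P : Asg Sym → Prop} (hP : ∀ {σ c x}, P σ → σ c = none →
    P (Function.update σ c (some x))) (hG : ∀ {σ}, P σ → G σ → H σ) {σ : Asg Sym} (hσ : P σ)
    (h : Win S G σ) : Win S H σ := by
  refine h.simulate (fun σ τ => σ = τ ∧ P σ) ?_ ?_ ?_ ⟨rfl, hσ⟩
  · rintro σ _ ⟨rfl, hp⟩; exact hG hp
  · rintro σ _ c x ⟨rfl, hp⟩ hc hn hx
    exact ⟨_, EnvStep.single hc hn hx, rfl, hP hp hn⟩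
  · rintro σ _ c x ⟨rfl, hp⟩ hn hx
    exact .inr ⟨c, x, hn, hx, rfl, hP hp hn⟩

/-- The machine may stop at an assignment at which the cirquent is true under every
interpretation. -/
def Goal (E : Cirquent 0) (σ : Asg Sym) : Prop := ∀ I, E.ev .const I σ Fin.elim0

/-- The cirquent `E` can be won in the symbolic game. -/
def Winnable (E : Cirquent 0) : Prop := ∀ S, Win S (Goal E) (Asg.empty Sym)

theorem Winnable.mono {A B : Cirquent 0} (hA : Winnable A)
    (h : ∀ (I : Interp Sym) (σ : Asg Sym), A.ev .const I σ Fin.elim0 → B.ev .const I σ Fin.elim0) :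
    Winnable B := fun S =>
  (hA S).mono_of (P := fun _ => True) (fun _ _ => trivial) (fun _ g I => h I _ (g I)) trivial

theorem Winnable.fill_mono {m : ℕ} {A B : Cirquent m} {X : Ctx m 0} (hA : Winnable (X.fill A))
    (h : ∀ (I : Interp Sym) (σ : Asg Sym) (ρ : Fin m → Sym),
      A.ev .const I σ ρ → B.ev .const I σ ρ) : Winnable (X.fill B) :=
  hA.mono fun I σ => ev_fill_mono X _ (h I σ)

/-- Choosing: the machine first makes the choice and then plays as before, ignoring any moves that its
old strategy makes in that cluster. -/
theorem Winnable.choose {A B : Cirquent 0} (hA : Winnable A) (c : Cluster) (x : Cho Sym c.kind)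
    (hx : MachOpt (Asg.empty Sym) c x)
    (hc : c ∉ A.clusters)
    (h : ∀ (I : Interp Sym) (σ : Asg Sym), σ c = some x →
      A.ev .const I σ Fin.elim0 → B.ev .const I σ Fin.elim0) : Winnable B := by
  intro S
  refine .move _ c x rfl hx ?_
  have hne : ∀ i, c ≠ ⟨.chall, i⟩ := by
    rintro i rfl
    exact hx
  refine (hA S).simulate (fun σ τ => (∀ d ≠ c, σ d = τ d) ∧ τ c = some x) ?_ ?_ ?_ ?_
  · refine fun hR hG I => h I _ hR.2 ((ev_congr A (fun d hd => hR.1 d ?_) _).1 (hG I))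
    rintro rfl
    exact hc hd
  · rintro σ τ d y ⟨hR, hτ⟩ hd hn hy
    have hdc : d ≠ c := hy.ne hx
    refine ⟨_, EnvStep.single hd ((hR d hdc).trans hn) hy, fun e he => ?_, ?_⟩
    · by_cases hed : e = d
      · subst hed; simp
      · simp [Function.update_of_ne hed, hR e he]
    · rwa [Function.update_of_ne hdc.symm]
  · rintro σ τ d y ⟨hR, hτ⟩ hn hy
    by_cases hdc : d = c
    · subst hdc
      exact .inl ⟨fun e he => by rw [Function.update_of_ne he, hR e he], hτ⟩
    · refine .inr ⟨d, y, (hR d hdc).symm.trans hn, hy.mono fun i hi => ?_, fun e he => ?_, ?_⟩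
      · rwa [← hR _ (hne i).symm]
      · by_cases hed : e = d
        · subst hed; simp
        · simp [Function.update_of_ne hed, hR e he]
      · rwa [Function.update_of_ne (Ne.symm hdc)]
  · exact ⟨fun d hd => by rw [Function.update_of_ne hd], by simp⟩

/-- The three chotomies: the cluster `c` of the premise records which of the environment's clusters
`a` and `b` is resolved first. -/
theorem Winnable.chotomy {A B : Cirquent 0} (hA : Winnable A) (a b : Cluster) (c : ℕ)
    (ha : ∃ x, EnvOpt a x) (hb : ∃ x, EnvOpt b x) (haB : a ∈ B.clusters) (hbB : b ∈ B.clusters)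
    (hcB : ⟨.chand, c⟩ ∉ B.clusters)
    (h : ∀ (I : Interp Sym) (σ : Asg Sym),
      (σ a = none ∧ σ b = none ∨
        σ ⟨.chand, c⟩ = some false ∧ σ a ≠ none ∨ σ ⟨.chand, c⟩ = some true ∧ σ b ≠ none) →
      A.ev .const I σ Fin.elim0 → B.ev .const I σ Fin.elim0) : Winnable B := by
  intro S
  have hca : ⟨.chand, c⟩ ≠ a := fun h => hcB (h ▸ haB)
  have hcb : ⟨.chand, c⟩ ≠ b := fun h => hcB (h ▸ hbB)
  set C : Cluster := ⟨.chand, c⟩ with hC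
  have upd : ∀ {σ τ : Asg Sym} {d : Cluster} {y : Cho Sym d.kind}, (∀ d ≠ C, σ d = τ d) →
      ∀ e ≠ C, Function.update σ d (some y) e = Function.update τ d (some y) e := by
    intro σ τ d y hR e he
    by_cases hed : e = d
    · subst hed; simp
    · simp [Function.update_of_ne hed, hR e he]
  refine (hA (insert C S)).simulate (fun σ τ => (∀ d ≠ C, σ d = τ d) ∧
    (σ C = none ∧ τ a = none ∧ τ b = none ∨
        σ C = some false ∧ τ a ≠ none ∨ σ C = some true ∧ τ b ≠ none)) ?_ ?_ ?_ ?_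
  · rintro σ τ ⟨hR, hcase⟩ g I
    refine (ev_congr B (fun d hd => hR d ?_) _).1 (h I σ ?_ (g I))
    · rintro rfl
      exact hcB hd
    · rw [hR a hca.symm, hR b hcb.symm]
      exact hcase.imp_left And.right
  · rintro σ τ d y ⟨hR, hcase⟩ hd hn hy
    have hdS : d ∈ insert C S := Finset.mem_insert_of_mem hd
    by_cases hdC : d = C
    -- a move in the recording cluster itself means nothing in the second game
    · refine ⟨σ, .refl, fun e he => ?_, ?_⟩
      · rw [Function.update_of_ne (hdC ▸ he), hR e he]
      · rw [Function.update_of_ne (hdC ▸ hca.symm), Function.update_of_ne (hdC ▸ hcb.symm)]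
        exact hcase
    have hσd : σ d = none := (hR d hdC).trans hn
    rcases hcase with ⟨h0, hτa, hτb⟩ | ⟨h0, hτa⟩ | ⟨h0, hτb⟩
    · by_cases hab : d = a ∨ d = b
      · obtain ⟨t, ht⟩ : ∃ t : Bool, (t = false ∧ d = a) ∨ (t = true ∧ d = b) := by
          rcases hab with h | h
          exacts [⟨_, .inl ⟨rfl, h⟩⟩, ⟨_, .inr ⟨rfl, h⟩⟩]
        have s1 : Relation.ReflTransGen (EnvStep (insert C S)) σ
            (Function.update σ C (some t)) :=
          EnvStep.single (c := C) (Finset.mem_insert_self _ _) h0 (x := t) trivial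
        refine ⟨_, s1.trans (EnvStep.single hdS
          (by rwa [Function.update_of_ne hdC]) hy), ?_, ?_⟩
        · refine upd fun e he => ?_
          rw [Function.update_of_ne he, hR e he]
        · rw [Function.update_of_ne (Ne.symm hdC), Function.update_self]
          rcases ht with ⟨rfl, rfl⟩ | ⟨rfl, rfl⟩ <;> simp
      · push Not at hab
        refine ⟨_, EnvStep.single hdS hσd hy, upd hR, .inl ?_⟩
        rw [Function.update_of_ne (Ne.symm hdC), Function.update_of_ne hab.1.symm,
          Function.update_of_ne hab.2.symm]
        exact ⟨h0, hτa, hτb⟩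
    · refine ⟨_, EnvStep.single hdS hσd hy, upd hR, .inr (.inl ⟨?_, update_ne_none hτa⟩)⟩
      rwa [Function.update_of_ne (Ne.symm hdC)]
    · refine ⟨_, EnvStep.single hdS hσd hy, upd hR, .inr (.inr ⟨?_, update_ne_none hτb⟩)⟩
      rwa [Function.update_of_ne (Ne.symm hdC)]
  · rintro σ τ d y ⟨hR, hcase⟩ hn hy
    have hne : ∀ {e : Cluster}, (∃ x, EnvOpt e x) → e ≠ d := fun ⟨x, hx⟩ => hx.ne hy
    have hdC : C ≠ d := hne ⟨true, trivial⟩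
    refine .inr ⟨d, y, (hR d hdC.symm).symm.trans hn, hy.mono fun i hi => ?_, upd hR, ?_⟩
    · rwa [← hR _ (by simp [hC])]
    · rw [Function.update_of_ne hdC, Function.update_of_ne (hne ha), Function.update_of_ne (hne hb)]
      exact hcase
  · exact ⟨fun _ _ => rfl, .inl ⟨rfl, rfl, rfl⟩⟩

end SymbolicGame

/-! ### Provable cirquents can be won in the symbolic game -/

section WinnableOfProvable

variable {S : Finset Cluster} {H : Asg Sym → Prop}

/-- If the machine may stop as long as the environment's cluster `c` is unresolved, then it can wait
for the environment to move there. -/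
theorem Win.of_root {c : Cluster} (W : Asg Sym → Prop)
    (hW : ∀ {σ d x}, W σ → d ∈ S → σ d = none → d ≠ c → EnvOpt d x →
      W (Function.update σ d (some x)))
    (hc : ∀ {σ x}, W σ → c ∈ S → σ c = none → EnvOpt c x →
      Win S H (Function.update σ c (some x)))
    (hH : ∀ {σ : Asg Sym}, σ c = none → H σ) {σ : Asg Sym} (hσ : σ c = none) (h : W σ) :
    Win S H σ := by
  have key : ∀ n : ℕ, ∀ σ, W σ → σ c = none → (S.filter (σ · = none)).card < n →
      Win S H σ := by
    intro n
    induction n with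
    | zero => exact fun _ _ _ h => absurd h (Nat.not_lt_zero _)
    | succ n ihn =>
      intro σ h hσ hn
      refine .wait _ (hH hσ) fun d hd hd0 x hx => ?_
      by_cases hdc : d = c
      · subst hdc
        exact hc h hd hσ hx
      refine ihn _ (hW h hd hd0 hdc hx) (by rwa [Function.update_of_ne (Ne.symm hdc)]) ?_
      refine lt_of_lt_of_le (Finset.card_lt_card ?_) (Nat.lt_succ_iff.1 hn)
      refine (Finset.ssubset_iff_of_subset fun e he => ?_).2 ⟨d, by simp [hd, hd0], by simp⟩
      simp only [Finset.mem_filter] at he ⊢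
      exact ⟨he.1, by_contra fun hn => update_ne_none hn he.2⟩
  exact key _ σ h hσ (Nat.lt_succ_self _)

/-- The machine waits for the choice of the environment, and then follows the strategy for the chosen
component. -/
theorem Winnable.chand {c : ℕ} {A B : Cirquent 0} (hA : Winnable A) (hB : Winnable B) :
    Winnable (.chand c A B) := by
  intro S
  refine Win.of_root (c := ⟨.chand, c⟩) (fun σ => Win S (Goal A) σ ∧ Win S (Goal B) σ)
    (fun h hd hn _ hx => ⟨h.1.env hd hn hx, h.2.env hd hn hx⟩) ?_ ?_ rfl ⟨hA S, hB S⟩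
  · rintro σ (x : Bool) ⟨h1, h2⟩ hc hn hx
    cases x
    · refine (h1.env hc hn hx).mono_of (P := fun σ => σ ⟨.chand, c⟩ = some false) ?_ ?_ (by simp)
      · intro σ d y hσ hd
        rwa [Function.update_of_ne]
        rintro rfl
        simp [hd] at hσ
      · intro σ hσ g I
        simp only [Cirquent.ev, hσ]
        simp [g I]
    · refine (h2.env hc hn hx).mono_of (P := fun σ => σ ⟨.chand, c⟩ = some true) ?_ ?_ (by simp)
      · intro σ d y hσ hd
        rwa [Function.update_of_ne]
        rintro rfl
        simp [hd] at hσ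
      · intro σ hσ g I
        simp only [Cirquent.ev, hσ]
        simp [g I]
  · intro σ hσ I
    simp [Cirquent.ev, hσ]

/-- A fresh constant `a` may be replaced by the symbol for the choice of the environment, once that
choice has been made. -/
theorem Winnable.chall {c a : ℕ} {A : Cirquent 1} (ha : a ∉ A.constants)
    (hA : Winnable (A.inst (.const a))) : Winnable (.chall c A) := by
  classical
  intro S
  let f : Sym → Sym := fun s => if s = .const a then .copy c else s
  have f_env : ∀ {d : Cluster} {x : Cho Sym d.kind}, EnvOpt d x → x.map f = x := by
    rintro ⟨k, d⟩ x hx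
    cases k <;> first | rfl | exact hx.elim | (cases hx; simp [Cho.map, f])
  refine Win.of_root (c := ⟨.chall, c⟩)
    (fun σ => Win S (Goal (A.inst (.const a))) σ ∧ σ.map f = σ) ?_ ?_ ?_ rfl ⟨hA S, rfl⟩
  · rintro σ d x ⟨h, hf⟩ hd hn _ hx
    exact ⟨h.env hd hn hx, by rw [Asg.map_update, f_env hx, hf]⟩
  · rintro σ x ⟨h, hf⟩ hc hn hx
    refine (h.env hc hn hx).simulate
      (fun σ τ => τ = σ.map f ∧ τ ⟨.chall, c⟩ = some (Sym.copy c)) ?_ ?_ ?_ ?_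
    · rintro σ τ ⟨rfl, hτ⟩ g I v hv
      rw [hτ] at hv
      cases hv
      have hcons : (Fin.cons (Sym.copy c) Fin.elim0 : Fin 1 → Sym) =
          f ∘ (Fin.cons (Sym.const a) Fin.elim0) := by
        funext i
        fin_cases i
        simp [f]
      rw [hcons, ev_map f A (ι := Sym.const)]
      · exact (ev_inst A _ _).1 (g _)
      · intro b hb
        have : b ≠ a := fun h => ha (h ▸ hb)
        simp [f, this]
    · rintro σ τ d y ⟨rfl, hτ⟩ hd hn hy
      have hn' : σ d = none := by simpa [Asg.map] using hn
      refine ⟨_, EnvStep.single hd hn' hy, by rw [Asg.map_update, f_env hy], ?_⟩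
      rwa [Function.update_of_ne]
      rintro rfl
      simp [hn] at hτ
    · rintro σ τ d y ⟨rfl, hτ⟩ hn hy
      have hn' : (σ.map f) d = none := by simp [Asg.map, hn]
      refine .inr ⟨d, y.map f, hn', ?_, by rw [Asg.map_update], ?_⟩
      · obtain ⟨k, d⟩ := d
        cases k
        · exact hy
        · exact hy
        · intro e he
          by_cases hya : y = Sym.const a
          · simp only [Cho.map, f, hya, if_true, Sym.copy.injEq] at he
            rw [← he, hτ]
            simp
          · simp only [Cho.map, f, hya, if_false] at he
            simpa [Asg.map] using hy e he
        · exact hy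
      · rwa [Function.update_of_ne]
        rintro rfl
        simp [hn'] at hτ
    · refine ⟨by rw [Asg.map_update, f_env hx, hf], ?_⟩
      cases hx
      simp
  · intro σ hσ I
    simp [Cirquent.ev, hσ]

open Cirquent in
/-- Every provable cirquent can be won in the symbolic game. Most rules preserve truth at every
assignment (towards the conclusion); the choosing, splitting and chotomy rules call for the
corresponding changes of strategy. -/
theorem Provable.winnable {E : Cirquent 0} (h : Provable E) : Winnable E := by
  induction h with
  | axiom_top =>
    exact fun S => Win.of_root (c := ⟨.chor, 0⟩) (fun _ => True) (fun _ _ _ _ _ => trivial)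
      (fun _ _ _ h => h.elim) (fun _ _ => trivial) rfl trivial
  | por_commutativity X A B _ ih =>
    exact ih.fill_mono fun _ _ _ => Or.symm
  | pand_commutativity X A B _ ih =>
    exact ih.fill_mono fun _ _ _ => And.symm
  | por_associativity X A B C _ ih =>
    exact ih.fill_mono fun _ _ _ => or_assoc.2
  | pand_associativity X A B C _ ih =>
    exact ih.fill_mono fun _ _ _ => and_assoc.2
  | por_identity X A _ ih => exact ih.fill_mono fun _ _ _ => .inl
  | pand_identity X A _ ih => exact ih.fill_mono fun _ _ _ h => ⟨h, trivial⟩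
  | por_domination X A _ ih => exact ih.fill_mono fun _ _ _ => .inr
  | pand_domination X A _ ih => exact ih.fill_mono fun _ _ _ => False.elim
  | left_chor_choosing c E _ ih =>
    exact ih.choose ⟨.chor, c⟩ false trivial
      (fun h => Finset.notMem_erase _ _ (clusters_chooseLeft c E h))
      fun I σ hσ => (ev_chooseLeft hσ E _).1
  | right_chor_choosing c E _ ih =>
    exact ih.choose ⟨.chor, c⟩ true trivial
      (fun h => Finset.notMem_erase _ _ (clusters_chooseRight c E h))
      fun I σ hσ => (ev_chooseRight hσ E _).1
  | chexists_choosing c a E _ ih =>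
    exact ih.choose ⟨.chexists, c⟩ (Sym.const a) (fun d hd => by cases hd)
      (fun h => Finset.notMem_erase _ _ (clusters_chooseConst c a E h))
      fun I σ hσ => (ev_chooseConst hσ E _).1
  | left_chand_cleansing X c Y A B C _ ih =>
    refine ih.fill_mono fun I σ ρ h => ?_
    refine ⟨fun hc => ?_, h.2⟩
    exact ev_fill_mono Y ρ (fun ρ' h' => ⟨fun _ => h', fun h => by simp [hc] at h⟩) (h.1 hc)
  | right_chand_cleansing X c Y A B C _ ih =>
    refine ih.fill_mono fun I σ ρ h => ?_
    refine ⟨h.1, fun hc => ?_⟩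
    exact ev_fill_mono Y ρ (fun ρ' h' => ⟨fun h => by simp [hc] at h, fun _ => h'⟩) (h.2 hc)
  | chall_cleansing X c Y A _ ih =>
    refine ih.fill_mono fun I σ ρ h v hv => ?_
    refine ev_fill_mono_holeVar Y _ (fun ρ' hρ' h' w hw => ?_) (h v hv)
    rw [hv] at hw
    cases hw
    have := (ev_inst _ _ _).1 h'
    rwa [Term.eval, hρ' 0, Fin.cons_zero] at this
  | pand_distribution X A B C _ ih =>
    exact ih.fill_mono fun _ _ _ h => by simp only [ev] at h ⊢; tauto
  | chand_distribution X c A B C _ ih =>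
    exact ih.fill_mono fun _ _ _ h => by simp only [ev] at h ⊢; tauto
  | chall_distribution X c A B _ ih =>
    refine ih.fill_mono fun I σ ρ h => ?_
    simp only [ev, ev_shift] at h ⊢
    by_cases hB : B.ev .const I σ ρ
    · exact .inr hB
    · exact .inl fun v hv => (h v hv).resolve_right hB
  | trivialization X p t _ ih => exact ih.fill_mono fun _ _ _ _ => (em _).symm
  | chandchotomy X a b c A B C D hc _ ih =>
    refine ih.chotomy ⟨.chand, a⟩ ⟨.chand, b⟩ c ⟨false, trivial⟩ ⟨false, trivial⟩
      (clusters_fill X _ (by simp [clusters])) (clusters_fill X _ (by simp [clusters])) hc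
      fun I σ hσ => ev_fill_mono X _ fun ρ h => ?_
    simp only [ev] at h ⊢
    rcases hσ with ⟨ha, hb⟩ | ⟨hc, ha⟩ | ⟨hc, hb⟩
    · simp [ha, hb]
    · obtain ⟨x, hx⟩ := Option.ne_none_iff_exists'.1 ha
      simp only [hc, hx] at h ⊢
      cases x <;> simpa using h
    · obtain ⟨x, hx⟩ := Option.ne_none_iff_exists'.1 hb
      simp only [hc, hx] at h ⊢
      cases x <;> simpa using h
  | challchotomy X a b c A B hc _ ih =>
    refine ih.chotomy ⟨.chall, a⟩ ⟨.chall, b⟩ c ⟨_, rfl⟩ ⟨_, rfl⟩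
      (clusters_fill X _ (by simp [clusters])) (clusters_fill X _ (by simp [clusters])) hc
      fun I σ hσ => ev_fill_mono X _ fun ρ h => ?_
    simp only [ev, ev_shift] at h ⊢
    rcases hσ with ⟨ha, hb⟩ | ⟨hc, ha⟩ | ⟨hc, hb⟩
    · simp [ha, hb]
    · obtain ⟨x, hx⟩ := Option.ne_none_iff_exists'.1 ha
      simp only [hc, hx] at h ⊢
      simpa using h
    · obtain ⟨x, hx⟩ := Option.ne_none_iff_exists'.1 hb
      simp only [hc, hx] at h ⊢
      simpa using h
  | chandallchotomy X a b c A B C hc _ ih =>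
    refine ih.chotomy ⟨.chand, a⟩ ⟨.chall, b⟩ c ⟨false, trivial⟩ ⟨_, rfl⟩
      (clusters_fill X _ (by simp [clusters])) (clusters_fill X _ (by simp [clusters])) hc
      fun I σ hσ => ev_fill_mono X _ fun ρ h => ?_
    simp only [ev, ev_shift] at h ⊢
    rcases hσ with ⟨ha, hb⟩ | ⟨hc, ha⟩ | ⟨hc, hb⟩
    · simp [ha, hb]
    · obtain ⟨x, hx⟩ := Option.ne_none_iff_exists'.1 ha
      simp only [hc, hx] at h ⊢
      cases x <;> simpa using h
    · obtain ⟨x, hx⟩ := Option.ne_none_iff_exists'.1 hb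
      simp only [hc, hx] at h ⊢
      simpa using h
  | chand_splitting c A B _ _ _ _ ihA ihB => exact ihA.chand ihB
  | chall_splitting c a A _ ha _ ih => exact ih.chall ha

end WinnableOfProvable

open Cirquent

/-! ### Composition of contexts -/

namespace Ctx

/-- The context `X[Y[ ]]`. -/
def comp {m k : ℕ} : {n : ℕ} → Ctx m n → Ctx k m → Ctx k n
  | _, hole, Y => Y
  | _, pandL X B, Y => pandL (X.comp Y) B
  | _, pandR A X, Y => pandR A (X.comp Y)
  | _, porL X B, Y => porL (X.comp Y) B
  | _, porR A X, Y => porR A (X.comp Y)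
  | _, chandL c X B, Y => chandL c (X.comp Y) B
  | _, chandR c A X, Y => chandR c A (X.comp Y)
  | _, chorL c X B, Y => chorL c (X.comp Y) B
  | _, chorR c A X, Y => chorR c A (X.comp Y)
  | _, chall c X, Y => chall c (X.comp Y)
  | _, chexists c X, Y => chexists c (X.comp Y)

theorem fill_comp {m k n : ℕ} (X : Ctx m n) (Y : Ctx k m) (A : Cirquent k) :
    (X.comp Y).fill A = X.fill (Y.fill A) := by
  induction X <;> simp only [comp, fill, *]

theorem holeVar_comp {m k n : ℕ} (X : Ctx m n) (Y : Ctx k m) (i : Fin n) :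
    (X.comp Y).holeVar i = Y.holeVar (X.holeVar i) := by
  induction X <;> simp only [comp, holeVar, *]

end Ctx

/-! ### Resolving clusters of the environment, and iterated cleansing -/

namespace Cirquent

/-- The result of resolving the `⊓`-clusters as `π` says (`none`: not at all). -/
def res (π : ℕ → Option Bool) : {n : ℕ} → Cirquent n → Cirquent n
  | _, top => top
  | _, bot => bot
  | _, atom p t => atom p t
  | _, natom p t => natom p t
  | _, pand A B => pand (A.res π) (B.res π)
  | _, por A B => por (A.res π) (B.res π)
  | _, chand d A B =>
      match π d with
      | none => chand d (A.res π) (B.res π)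
      | some false => A.res π
      | some true => B.res π
  | _, chor d A B => chor d (A.res π) (B.res π)
  | _, chall d A => chall d (A.res π)
  | _, chexists d A => chexists d (A.res π)

/-- The result of replacing every `∀ᶜy B(y)` by `B(x)`, where `x` is the variable `i`. -/
def cleanse (c : ℕ) : {n : ℕ} → Fin n → Cirquent n → Cirquent n
  | _, _, top => top
  | _, _, bot => bot
  | _, _, atom p t => atom p t
  | _, _, natom p t => natom p t
  | _, i, pand A B => pand (A.cleanse c i) (B.cleanse c i)
  | _, i, por A B => por (A.cleanse c i) (B.cleanse c i)
  | _, i, chand d A B => chand d (A.cleanse c i) (B.cleanse c i)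
  | _, i, chor d A B => chor d (A.cleanse c i) (B.cleanse c i)
  | _, i, chall d A =>
      if d = c then (A.cleanse c i.succ).inst (.var i) else chall d (A.cleanse c i.succ)
  | _, i, chexists d A => chexists d (A.cleanse c i.succ)

end Cirquent

/-- The choices of `π` in `⊓`-clusters, where there are any, and those of `σ` elsewhere. -/
def Asg.override (σ : Asg ℕ) (π : ℕ → Option Bool) : Asg ℕ
  | ⟨.chand, c⟩ => ((π c).or (σ ⟨.chand, c⟩) : Option Bool)
  | ⟨.chor, c⟩ => σ ⟨.chor, c⟩
  | ⟨.chexists, c⟩ => σ ⟨.chexists, c⟩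
  | ⟨.chall, c⟩ => σ ⟨.chall, c⟩

theorem Asg.override_of_kind_ne {σ : Asg ℕ} {π : ℕ → Option Bool} {c : Cluster}
    (h : c.kind ≠ .chand) : σ.override π c = σ c := by
  obtain ⟨k, c⟩ := c
  cases k <;> first | rfl | exact absurd rfl h

theorem Asg.override_of_none {σ : Asg ℕ} {π : ℕ → Option Bool} {c : Cluster}
    (h : π c.index = none) : σ.override π c = σ c := by
  obtain ⟨k, c⟩ := c
  cases k <;> first | rfl | (simp only at h; simp [Asg.override, h])

theorem ev_res {I : Interp ℕ} {σ : Asg ℕ} (π : ℕ → Option Bool) {n : ℕ} (A : Cirquent n)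
    (ρ : Fin n → ℕ) : (A.res π).ev id I σ ρ ↔ A.ev id I (σ.override π) ρ := by
  induction A with
  | top | bot | atom | natom => rfl
  | pand _ _ ihA ihB | por _ _ ihA ihB => simp only [res, ev, ihA, ihB]
  | chor _ _ _ ihA ihB => simp only [res, ev, ihA, ihB, Asg.override]
  | chand c A B ihA ihB =>
    simp only [res]
    split <;> rename_i h <;> simp [ev, ihA, ihB, Asg.override, h]
  | chall _ _ ih | chexists _ _ ih => simp only [res, ev, ih, Asg.override]

/-- The resolution of a single `⊓`-cluster. -/
abbrev single (c : ℕ) (b : Bool) : ℕ → Option Bool := Function.update (fun _ => none) c (some b)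

theorem res_update_res {π : ℕ → Option Bool} {c : ℕ} (b : Bool) (h : π c = none) {n : ℕ}
    (A : Cirquent n) :
    (A.res π).res (single c b) =
      A.res (Function.update π c (some b)) := by
  induction A with
  | chand d A B ihA ihB =>
    by_cases hd : d = c
    · subst hd
      cases b <;> simp [res, h, ihA, ihB]
    · simp only [res, Function.update_of_ne hd]
      split <;> simp [res, ihA, ihB, hd]
  | top | bot | atom | natom => rfl
  | _ => simp only [res, *]

theorem clusters_res_subset (π : ℕ → Option Bool) {n : ℕ} (A : Cirquent n) :
    (A.res π).clusters ⊆ A.clusters := by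
  induction A with
  | chand d A B ihA ihB =>
    simp only [res, Finset.subset_iff] at *
    split <;> simp only [clusters, Finset.mem_insert, Finset.mem_union] <;> grind
  | _ =>
    simp only [res, clusters, Finset.mem_insert, Finset.mem_union, Finset.subset_iff] at *
    grind

theorem notMem_clusters_res {π : ℕ → Option Bool} {c : ℕ} (h : π c ≠ none) {n : ℕ}
    (A : Cirquent n) : ⟨.chand, c⟩ ∉ (A.res π).clusters := by
  induction A with
  | chand d A B ihA ihB =>
    simp only [res]
    split
    · simp only [clusters, Finset.mem_insert, Finset.mem_union, Cluster.mk.injEq]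
      grind
    · exact ihA
    · exact ihB
  | _ => simp [res, clusters, *]

theorem ev_cleanse {I : Interp ℕ} {σ : Asg ℕ} {c : ℕ} {n : ℕ} (A : Cirquent n) (i : Fin n)
    (ρ : Fin n → ℕ) (h : σ ⟨.chall, c⟩ = some (ρ i)) :
    (A.cleanse c i).ev id I σ ρ ↔ A.ev id I σ ρ := by
  induction A with
  | top | bot | atom | natom => rfl
  | pand _ _ ihA ihB | por _ _ ihA ihB | chand _ _ _ ihA ihB | chor _ _ _ ihA ihB =>
    simp only [cleanse, ev, ihA i ρ h, ihB i ρ h]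
  | chall d A ih =>
    have ih' : ∀ v, (A.cleanse c i.succ).ev id I σ (Fin.cons v ρ) ↔
        A.ev id I σ (Fin.cons v ρ) := fun v => ih _ _ (by simpa using h)
    by_cases hd : d = c
    · subst hd
      simp [cleanse, ev, ev_inst, Term.eval, ih', h]
    · simp only [cleanse, if_neg hd, ev, ih']
  | chexists d A ih =>
    have ih' : ∀ v, (A.cleanse c i.succ).ev id I σ (Fin.cons v ρ) ↔
        A.ev id I σ (Fin.cons v ρ) := fun v => ih _ _ (by simpa using h)
    simp only [cleanse, ev, ih']

theorem clusters_cleanse (c : ℕ) {n : ℕ} (A : Cirquent n) (i : Fin n) :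
    (A.cleanse c i).clusters ⊆ A.clusters.erase ⟨.chall, c⟩ := by
  induction A with
  | chall d A ih =>
    have := ih i.succ
    intro e he
    simp only [cleanse] at he
    split_ifs at he with hd <;>
      simp only [clusters, clusters_inst, Finset.mem_erase, Finset.mem_insert,
        Finset.subset_iff] at * <;> grind
  | chexists d A ih =>
    have := ih i.succ
    intro e he
    simp only [clusters, cleanse, Finset.mem_erase, Finset.mem_insert, Finset.subset_iff] at *
    grind
  | _ =>
    simp only [clusters, cleanse, Finset.mem_erase, Finset.mem_insert, Finset.mem_union,
      Finset.subset_iff] at *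
    grind

/-- Iterated chand-cleansing, in a class `W` of contexts in which single cleansing is possible. -/
theorem provable_of_res {c : ℕ} {b : Bool} (W : {k : ℕ} → Ctx k 0 → Prop)
    (hW : ∀ {k l : ℕ} {X : Ctx k 0} (Z : Ctx l k), W X → W (X.comp Z))
    (hrule : ∀ {k : ℕ} {X : Ctx k 0} (A B : Cirquent k), W X →
      Provable (X.fill (bif b then B else A)) → Provable (X.fill (.chand c A B)))
    {k : ℕ} (A : Cirquent k) : ∀ {X : Ctx k 0}, W X →
      Provable (X.fill (A.res (single c b))) →
      Provable (X.fill A) := by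
  induction A with
  | top | bot | atom | natom => exact fun _ h => h
  | pand A B ihA ihB =>
    intro X hX h
    have h1 := ihA (hW (.pandL .hole (B.res (single c b))) hX) (by rwa [Ctx.fill_comp])
    rw [Ctx.fill_comp] at h1
    have h2 := ihB (hW (.pandR A .hole) hX) (by rwa [Ctx.fill_comp])
    rwa [Ctx.fill_comp] at h2
  | por A B ihA ihB =>
    intro X hX h
    have h1 := ihA (hW (.porL .hole (B.res (single c b))) hX) (by rwa [Ctx.fill_comp])
    rw [Ctx.fill_comp] at h1
    have h2 := ihB (hW (.porR A .hole) hX) (by rwa [Ctx.fill_comp])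
    rwa [Ctx.fill_comp] at h2
  | chor d A B ihA ihB =>
    intro X hX h
    have h1 := ihA (hW (.chorL d .hole (B.res (single c b))) hX) (by rwa [Ctx.fill_comp])
    rw [Ctx.fill_comp] at h1
    have h2 := ihB (hW (.chorR d A .hole) hX) (by rwa [Ctx.fill_comp])
    rwa [Ctx.fill_comp] at h2
  | chand d A B ihA ihB =>
    intro X hX h
    by_cases hd : d = c
    · subst hd
      refine hrule A B hX ?_
      cases b
      · exact ihA hX (by simpa [res] using h)
      · exact ihB hX (by simpa [res] using h)
    · simp only [res, Function.update_of_ne hd] at h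
      have h1 := ihA (hW (.chandL d .hole (B.res (single c b))) hX) (by rwa [Ctx.fill_comp])
      rw [Ctx.fill_comp] at h1
      have h2 := ihB (hW (.chandR d A .hole) hX) (by rwa [Ctx.fill_comp])
      rwa [Ctx.fill_comp] at h2
  | chall d A ih =>
    intro X hX h
    have h1 := ih (hW (.chall d .hole) hX) (by rwa [Ctx.fill_comp])
    rwa [Ctx.fill_comp] at h1
  | chexists d A ih =>
    intro X hX h
    have h1 := ih (hW (.chexists d .hole) hX) (by rwa [Ctx.fill_comp])
    rwa [Ctx.fill_comp] at h1

/-- Iterated chall-cleansing, in a class `W` of contexts in which single cleansing is possible; `W X i`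
says that the variable `i` at the open place of `X` is bound by a `∀ᶜ`. -/
theorem provable_of_cleanse {c : ℕ} (W : {k : ℕ} → Ctx k 0 → Fin k → Prop)
    (hW : ∀ {k l : ℕ} {X : Ctx k 0} {i : Fin k} (Z : Ctx l k), W X i → W (X.comp Z) (Z.holeVar i))
    (hrule : ∀ {k : ℕ} {X : Ctx k 0} {i : Fin k} (A : Cirquent (k + 1)), W X i →
      Provable (X.fill (A.inst (.var i))) → Provable (X.fill (.chall c A)))
    {k : ℕ} (A : Cirquent k) : ∀ {X : Ctx k 0} {i : Fin k}, W X i →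
      Provable (X.fill (A.cleanse c i)) → Provable (X.fill A) := by
  induction A with
  | top | bot | atom | natom => exact fun _ h => h
  | pand A B ihA ihB =>
    intro X i hX h
    have h1 := ihA (hW (.pandL .hole (B.cleanse c i)) hX) (by rwa [Ctx.fill_comp])
    rw [Ctx.fill_comp] at h1
    have h2 := ihB (hW (.pandR A .hole) hX) (by rwa [Ctx.fill_comp])
    rwa [Ctx.fill_comp] at h2
  | por A B ihA ihB =>
    intro X i hX h
    have h1 := ihA (hW (.porL .hole (B.cleanse c i)) hX) (by rwa [Ctx.fill_comp])
    rw [Ctx.fill_comp] at h1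
    have h2 := ihB (hW (.porR A .hole) hX) (by rwa [Ctx.fill_comp])
    rwa [Ctx.fill_comp] at h2
  | chor d A B ihA ihB =>
    intro X i hX h
    have h1 := ihA (hW (.chorL d .hole (B.cleanse c i)) hX) (by rwa [Ctx.fill_comp])
    rw [Ctx.fill_comp] at h1
    have h2 := ihB (hW (.chorR d A .hole) hX) (by rwa [Ctx.fill_comp])
    rwa [Ctx.fill_comp] at h2
  | chand d A B ihA ihB =>
    intro X i hX h
    have h1 := ihA (hW (.chandL d .hole (B.cleanse c i)) hX) (by rwa [Ctx.fill_comp])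
    rw [Ctx.fill_comp] at h1
    have h2 := ihB (hW (.chandR d A .hole) hX) (by rwa [Ctx.fill_comp])
    rwa [Ctx.fill_comp] at h2
  | chall d A ih =>
    intro X i hX h
    by_cases hd : d = c
    · subst hd
      simp only [cleanse, if_true] at h
      have h1 := hrule _ hX h
      have h2 := ih (hW (.chall d .hole) hX) (by rwa [Ctx.fill_comp])
      rwa [Ctx.fill_comp] at h2
    · simp only [cleanse, if_neg hd] at h
      have h2 := ih (hW (.chall d .hole) hX) (by rwa [Ctx.fill_comp])
      rwa [Ctx.fill_comp] at h2
  | chexists d A ih =>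
    intro X i hX h
    have h1 := ih (hW (.chexists d .hole) hX) (by rwa [Ctx.fill_comp])
    rwa [Ctx.fill_comp] at h1

/-- Chand-splitting after cleansing. -/
theorem Provable.chand_root {c : ℕ} {A B : Cirquent 0}
    (hA : Provable (A.res (single c false)))
    (hB : Provable (B.res (single c true))) :
    Provable (.chand c A B) := by
  have h0 := Provable.chand_splitting c _ _ (notMem_clusters_res (by simp) A)
    (notMem_clusters_res (by simp) B) hA hB
  have h1 := provable_of_res (c := c) (b := false)
    (fun {k} X => ∃ (Y : Ctx k 0) (C : _), X = Ctx.chandL c Y C)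
    (by rintro k l _ Z ⟨Y, C, rfl⟩; exact ⟨Y.comp Z, C, rfl⟩)
    (by
      rintro k _ P Q ⟨Y, C, rfl⟩ h
      exact Provable.left_chand_cleansing .hole c Y P Q C h)
    A (X := .chandL c .hole (B.res (single c true))) ⟨.hole, _, rfl⟩ h0
  exact provable_of_res (c := c) (b := true)
    (fun {k} X => ∃ (Y : Ctx k 0) (C : _), X = Ctx.chandR c C Y)
    (by rintro k l _ Z ⟨Y, C, rfl⟩; exact ⟨Y.comp Z, C, rfl⟩)
    (by
      rintro k _ P Q ⟨Y, C, rfl⟩ h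
      exact Provable.right_chand_cleansing .hole c Y P Q C h)
    B (X := .chandR c A .hole) ⟨.hole, _, rfl⟩ h1

/-- Chall-splitting after cleansing. -/
theorem Provable.chall_root {c : ℕ} {A : Cirquent 1}
    (h : ∀ a, Provable ((A.cleanse c 0).inst (.const a))) : Provable (.chall c A) := by
  obtain ⟨a, ha⟩ := Infinite.exists_notMem_finset (A.cleanse c 0).constants
  have h0 := Provable.chall_splitting c a _
    (fun h => Finset.notMem_erase _ _ (clusters_cleanse c A 0 h)) ha (h a)
  exact provable_of_cleanse (c := c)
    (fun {k} X i => ∃ Y : Ctx k 1, X = Ctx.chall c Y ∧ i = Y.holeVar 0)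
    (by
      rintro k l _ _ Z ⟨Y, rfl, rfl⟩
      exact ⟨Y.comp Z, rfl, (Ctx.holeVar_comp _ _ _).symm⟩)
    (by
      rintro k _ _ P ⟨Y, rfl, rfl⟩ h
      exact Provable.chall_cleansing .hole c Y P h)
    A (X := .chall c .hole) ⟨.hole, rfl, rfl⟩ h0

/-! ### Rewriting towards premises that remain true -/

theorem clusters_fill_mono {m n : ℕ} (X : Ctx m n) {A B : Cirquent m}
    (h : A.clusters ⊆ B.clusters) : (X.fill A).clusters ⊆ (X.fill B).clusters := by
  induction X with
  | hole => exact h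
  | pandL X C ih | porL X C ih => exact Finset.union_subset_union_left ih
  | pandR C X ih | porR C X ih => exact Finset.union_subset_union_right ih
  | chandL c X C ih | chorL c X C ih =>
    exact Finset.insert_subset_insert _ (Finset.union_subset_union_left ih)
  | chandR c C X ih | chorR c C X ih =>
    exact Finset.insert_subset_insert _ (Finset.union_subset_union_right ih)
  | chall c X ih | chexists c X ih => exact Finset.insert_subset_insert _ ih

/-- `Red A K`: read from conclusions to premises, the rules of the calculus reduce `A`, in any context,
to `K`; moreover this loses nothing, as `A` implies `K` at every assignment, and it does not
introduce clusters. -/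
structure Red {n : ℕ} (A K : Cirquent n) : Prop where
  sem : ∀ (I : Interp ℕ) (σ : Asg ℕ) (ρ : Fin n → ℕ), A.ev id I σ ρ → K.ev id I σ ρ
  clusters : K.clusters ⊆ A.clusters
  prov : ∀ X : Ctx n 0, Provable (X.fill K) → Provable (X.fill A)

namespace Red

variable {n : ℕ} {A B C K : Cirquent n}

theorem refl (A : Cirquent n) : Red A A := ⟨fun _ _ _ h => h, subset_rfl, fun _ h => h⟩

theorem trans (h : Red A B) (k : Red B C) : Red A C :=
  ⟨fun I σ ρ e => k.sem I σ ρ (h.sem I σ ρ e), k.clusters.trans h.clusters,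
    fun X e => h.prov X (k.prov X e)⟩

theorem fill {m : ℕ} (X : Ctx n m) (h : Red A K) : Red (X.fill A) (X.fill K) :=
  ⟨fun I σ ρ => ev_fill_mono X ρ (h.sem I σ), clusters_fill_mono X h.clusters, fun Y e => by
    rw [← Ctx.fill_comp] at e ⊢
    exact h.prov _ e⟩

theorem pand {A' B' : Cirquent n} (hA : Red A A') (hB : Red B B') :
    Red (A.pand B) (A'.pand B') :=
  (hA.fill (.pandL .hole B)).trans (hB.fill (.pandR A' .hole))

theorem por {A' B' : Cirquent n} (hA : Red A A') (hB : Red B B') :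
    Red (A.por B) (A'.por B') :=
  (hA.fill (.porL .hole B)).trans (hB.fill (.porR A' .hole))

theorem chand {A' B' : Cirquent n} (c : ℕ) (hA : Red A A') (hB : Red B B') :
    Red (A.chand c B) (A'.chand c B') :=
  (hA.fill (.chandL c .hole B)).trans (hB.fill (.chandR c A' .hole))

theorem por_comm (A B : Cirquent n) : Red (A.por B) (B.por A) :=
  ⟨fun _ _ _ => Or.symm, by simp only [Cirquent.clusters]; grind,
    fun X => .por_commutativity X A B⟩

theorem pand_comm (A B : Cirquent n) : Red (A.pand B) (B.pand A) :=
  ⟨fun _ _ _ => And.symm, by simp only [Cirquent.clusters]; grind,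
    fun X => .pand_commutativity X A B⟩

theorem por_assoc (A B C : Cirquent n) : Red ((A.por B).por C) (A.por (B.por C)) :=
  ⟨fun _ _ _ => or_assoc.1, by simp only [Cirquent.clusters]; grind,
    fun X => .por_associativity X A B C⟩

theorem pand_top (A : Cirquent n) : Red (A.pand .top) A :=
  ⟨fun _ _ _ => And.left, by simp only [Cirquent.clusters]; grind,
    fun X => .pand_identity X A⟩

theorem top_pand (A : Cirquent n) : Red (Cirquent.top.pand A) A :=
  (pand_comm _ _).trans (pand_top A)

theorem por_top (A : Cirquent n) : Red (A.por .top) .top :=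
  ⟨fun _ _ _ _ => trivial, by simp only [Cirquent.clusters]; grind,
    fun X => .por_domination X A⟩

theorem top_por (A : Cirquent n) : Red (Cirquent.top.por A) .top :=
  (por_comm _ _).trans (por_top A)

theorem natom_por_atom (p : PredLetter) (t : Fin p.arity → Term n) :
    Red ((Cirquent.natom p t).por (.atom p t)) .top :=
  ⟨fun _ _ _ _ => trivial, by simp only [Cirquent.clusters]; grind,
    fun X => .trivialization X p t⟩

theorem pand_por (A B C : Cirquent n) :
    Red ((A.pand B).por C) ((A.por C).pand (B.por C)) :=
  ⟨fun _ _ _ h => by simp only [ev] at h ⊢; tauto, by simp only [Cirquent.clusters]; grind,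
    fun X => .pand_distribution X A B C⟩

theorem chand_por (c : ℕ) (A B C : Cirquent n) :
    Red ((A.chand c B).por C) ((A.por C).chand c (B.por C)) :=
  ⟨fun _ _ _ h => by simp only [ev] at h ⊢; tauto, by simp only [Cirquent.clusters]; grind,
    fun X => .chand_distribution X c A B C⟩

theorem chall_por (c : ℕ) (A : Cirquent (n + 1)) (B : Cirquent n) :
    Red ((Cirquent.chall c A).por B) (.chall c (A.por B.shift)) :=
  ⟨fun _ _ _ h => by
    simp only [ev, ev_shift] at h ⊢
    exact fun v hv => h.imp_left fun h => h v hv,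
    by simp only [Cirquent.clusters, clusters_shift]; grind, fun X => .chall_distribution X c A B⟩

end Red

/-! ### Clauses -/

/-- Clauses: disjunctions of literals and of cirquents rooted in an operator of the machine. -/
inductive Clause {n : ℕ} : Cirquent n → Prop
  | top : Clause .top
  | bot : Clause .bot
  | atom (p : PredLetter) (t : Fin p.arity → Term n) : Clause (.atom p t)
  | natom (p : PredLetter) (t : Fin p.arity → Term n) : Clause (.natom p t)
  | chor (c : ℕ) (A B : Cirquent n) : Clause (.chor c A B)
  | chexists (c : ℕ) (A : Cirquent (n + 1)) : Clause (.chexists c A)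
  | por (A B : Cirquent n) : Clause A → Clause B → Clause (.por A B)

/-- `A` is a disjunct of the given cirquent. -/
inductive Disjunct {n : ℕ} (A : Cirquent n) : Cirquent n → Prop
  | self : Disjunct A A
  | left (L M : Cirquent n) : Disjunct A L → Disjunct A (.por L M)
  | right (L M : Cirquent n) : Disjunct A M → Disjunct A (.por L M)

/-- One of `A` and `B` is an atom, and the other is its negation. -/
def Compl {n : ℕ} (A B : Cirquent n) : Prop :=
  ∃ (p : PredLetter) (t : Fin p.arity → Term n),
    A = .natom p t ∧ B = .atom p t ∨ A = .atom p t ∧ B = .natom p t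

section Clauses

variable {n : ℕ} {A B L M : Cirquent n}

theorem Compl.symm (h : Compl A B) : Compl B A := by
  obtain ⟨p, t, ⟨rfl, rfl⟩ | ⟨rfl, rfl⟩⟩ := h
  exacts [⟨p, t, .inr ⟨rfl, rfl⟩⟩, ⟨p, t, .inl ⟨rfl, rfl⟩⟩]

theorem Compl.red (h : Compl A B) : Red (A.por B) .top := by
  obtain ⟨p, t, ⟨rfl, rfl⟩ | ⟨rfl, rfl⟩⟩ := h
  exacts [.natom_por_atom p t, (Red.por_comm _ _).trans (.natom_por_atom p t)]

theorem Disjunct.red_top (h : Disjunct .top L) : Red L .top := by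
  induction h with
  | self => exact .refl _
  | left L M _ ih => exact (ih.por (.refl M)).trans (.top_por M)
  | right L M _ ih => exact ((Red.refl L).por ih).trans (.por_top L)

theorem Disjunct.por_red_top (h : Disjunct A L) (hB : Compl A B) : Red (L.por B) .top := by
  induction h with
  | self => exact hB.red
  | left L M _ ih =>
    exact ((Red.por_comm L M).por (.refl B)).trans <| (Red.por_assoc _ _ _).trans <|
      ((Red.refl M).por ih).trans (.por_top M)
  | right L M _ ih =>
    exact (Red.por_assoc _ _ _).trans <| ((Red.refl L).por ih).trans (.por_top L)

theorem Disjunct.por_red_top' (hA : Disjunct A L) (hB : Disjunct B M) (h : Compl A B) :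
    Red (L.por M) .top := by
  induction hA with
  | self => exact (Red.por_comm _ _).trans (hB.por_red_top h.symm)
  | left L N _ ih =>
    exact ((Red.por_comm L N).por (.refl M)).trans <| (Red.por_assoc _ _ _).trans <|
      ((Red.refl N).por ih).trans (.por_top N)
  | right L N _ ih =>
    exact (Red.por_assoc _ _ _).trans <| ((Red.refl L).por ih).trans (.por_top L)

theorem Compl.red_top (h : Compl A B) (hA : Disjunct A L) (hB : Disjunct B L) : Red L .top := by
  induction hA with
  | self =>
    exfalso
    obtain ⟨p, t, ⟨rfl, rfl⟩ | ⟨rfl, rfl⟩⟩ := h <;> cases hB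
  | left L M hA ih =>
    cases hB with
    | self => obtain ⟨p, t, ⟨_, h⟩ | ⟨_, h⟩⟩ := h <;> cases h
    | left _ _ hB => exact ((ih hB).por (.refl M)).trans (.top_por M)
    | right _ _ hB => exact hA.por_red_top' hB h
  | right L M hA ih =>
    cases hB with
    | self => obtain ⟨p, t, ⟨_, h⟩ | ⟨_, h⟩⟩ := h <;> cases h
    | left _ _ hB => exact hB.por_red_top' hA h.symm
    | right _ _ hB => exact ((Red.refl L).por (ih hB)).trans (.por_top L)

end Clauses

/-- Some interpretation makes `A` false, however the environment resolves its clusters, when those of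
the machine are as in `σ`. -/
def Dead (σ : Asg ℕ) (A : Cirquent 0) : Prop :=
  ∃ I : Interp ℕ, ∀ τ : Asg ℕ, (∀ c : Cluster, c.kind.owner = .machine → τ c = σ c) →
    ¬ A.ev id I τ Fin.elim0

theorem Term.eq_of_eval {s t : Term 0} (h : s.eval id Fin.elim0 = t.eval (V := ℕ) id Fin.elim0) :
    s = t := by
  cases s with
  | var i => exact i.elim0
  | const a =>
    cases t with
    | var i => exact i.elim0
    | const b => exact congrArg _ h

/-- A clause whose clusters are unresolved is falsifiable unless it contains `⊤` or two complementary
literals. -/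
theorem Clause.dead_or_red {σ : Asg ℕ} {L : Cirquent 0} (hL : Clause L)
    (hσ : ∀ c ∈ L.clusters, σ c = none) : Dead σ L ∨ Red L .top := by
  by_cases htop : Disjunct .top L
  · exact .inr htop.red_top
  by_cases hcompl : ∃ A B, Compl A B ∧ Disjunct A L ∧ Disjunct B L
  · obtain ⟨A, B, h, hA, hB⟩ := hcompl
    exact .inr (h.red_top hA hB)
  refine .inl ⟨fun p => {x | ∃ t : Fin p.arity → Term 0, Disjunct (.natom p t) L ∧
    x = fun i => (t i).eval id Fin.elim0}, fun τ hτ => ?_⟩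
  have key : ∀ M : Cirquent 0, Clause M → (∀ A, Disjunct A M → Disjunct A L) →
      (∀ c ∈ M.clusters, σ c = none) → ¬ M.ev id (fun p => {x | ∃ t : Fin p.arity → Term 0,
        Disjunct (.natom p t) L ∧ x = fun i => (t i).eval id Fin.elim0}) τ Fin.elim0 := by
    intro M hM
    induction hM with
    | top => exact fun h _ => (htop (h _ .self)).elim
    | bot => exact fun _ _ h => h
    | atom p t =>
      rintro h - ⟨s, hs, hst⟩
      have : t = s := funext fun i => Term.eq_of_eval (congrFun hst i)
      subst this
      exact hcompl ⟨_, _, ⟨p, t, .inl ⟨rfl, rfl⟩⟩, hs, h _ .self⟩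
    | natom p t => exact fun h _ hn => hn ⟨t, h _ .self, rfl⟩
    | chor c A B =>
      intro _ hc
      have := (hτ ⟨.chor, c⟩ rfl).trans (hc _ (by simp [clusters]))
      simp [ev, this]
    | chexists c A =>
      intro _ hc
      have := (hτ ⟨.chexists, c⟩ rfl).trans (hc _ (by simp [clusters]))
      simp [ev, this]
    | por A B _ _ ihA ihB =>
      intro h hc
      simp only [clusters, Finset.mem_union] at hc
      exact fun h' => h'.elim
        (ihA (fun D hD => h D (.left _ _ hD)) fun c hA => hc c (.inl hA))
        (ihB (fun D hD => h D (.right _ _ hD)) fun c hB => hc c (.inr hB))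
  exact key L hL (fun _ h => h) hσ

/-! ### Conjunctive normal form -/

/-- The normal form: conjunctions, and choices in `⊓`-clusters outside `F`, of clauses and of cirquents
rooted in an environment's operator (the cluster being in `F` in the case of `⊓`). -/
inductive Nf (F : Finset Cluster) {n : ℕ} : Cirquent n → Prop
  | clause (A : Cirquent n) : Clause A → Nf F A
  | pand (A B : Cirquent n) : Nf F A → Nf F B → Nf F (.pand A B)
  | chand (c : ℕ) (A B : Cirquent n) : (⟨.chand, c⟩ ∉ F → Nf F A) → (⟨.chand, c⟩ ∉ F → Nf F B) →
      Nf F (.chand c A B)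
  | chall (c : ℕ) (A : Cirquent (n + 1)) : Nf F (.chall c A)

theorem Nf.por {F : Finset Cluster} {n : ℕ} {A B : Cirquent n} (hA : Nf F A) (hB : Nf F B) :
    ∃ K, Nf F K ∧ Red (A.por B) K := by
  -- the induction on one disjunct, which is used twice
  have key : ∀ P : Cirquent n → Prop, (∀ A B, Clause A → P B → ∃ K, Nf F K ∧ Red (A.por B) K) →
      ∀ A B, Nf F A → P B → ∃ K, Nf F K ∧ Red (A.por B) K := by
    intro P hP A B hA
    induction hA with
    | clause A h => exact hP A B h
    | pand A₁ A₂ _ _ ih₁ ih₂ =>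
      intro hB
      obtain ⟨K₁, h₁, r₁⟩ := ih₁ hB
      obtain ⟨K₂, h₂, r₂⟩ := ih₂ hB
      exact ⟨_, .pand _ _ h₁ h₂, (Red.pand_por _ _ _).trans (r₁.pand r₂)⟩
    | chand c A₁ A₂ _ _ ih₁ ih₂ =>
      intro hB
      by_cases hc : ⟨.chand, c⟩ ∈ F
      · exact ⟨_, .chand _ _ _ (absurd hc) (absurd hc), Red.chand_por _ _ _ _⟩
      obtain ⟨K₁, h₁, r₁⟩ := ih₁ hc hB
      obtain ⟨K₂, h₂, r₂⟩ := ih₂ hc hB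
      exact ⟨_, .chand _ _ _ (fun _ => h₁) (fun _ => h₂),
        (Red.chand_por _ _ _ _).trans (r₁.chand c r₂)⟩
    | chall c A => exact fun _ => ⟨_, .chall _ _, Red.chall_por _ _ _⟩
  refine key (Nf F) (fun A B hA hB => ?_) A B hA hB
  obtain ⟨K, hK, r⟩ := key Clause (fun B A hB hA => ⟨_, .clause _ (.por _ _ hB hA), .refl _⟩)
    B A hB hA
  exact ⟨K, hK, (Red.por_comm _ _).trans r⟩

/-- Every cirquent has a normal form: disjunction is distributed over conjunction and over the
operators of the environment. -/
theorem exists_nf (F : Finset Cluster) {n : ℕ} (A : Cirquent n) : ∃ K, Nf F K ∧ Red A K := by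
  induction A with
  | top => exact ⟨_, .clause _ .top, .refl _⟩
  | bot => exact ⟨_, .clause _ .bot, .refl _⟩
  | atom p t => exact ⟨_, .clause _ (.atom p t), .refl _⟩
  | natom p t => exact ⟨_, .clause _ (.natom p t), .refl _⟩
  | chor c A B => exact ⟨_, .clause _ (.chor c A B), .refl _⟩
  | chexists c A => exact ⟨_, .clause _ (.chexists c A), .refl _⟩
  | chall c A => exact ⟨_, .chall c A, .refl _⟩
  | pand A B ihA ihB =>
    obtain ⟨K, hK, rK⟩ := ihA
    obtain ⟨L, hL, rL⟩ := ihB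
    exact ⟨_, .pand _ _ hK hL, rK.pand rL⟩
  | por A B ihA ihB =>
    obtain ⟨K, hK, rK⟩ := ihA
    obtain ⟨L, hL, rL⟩ := ihB
    obtain ⟨M, hM, rM⟩ := hK.por hL
    exact ⟨M, hM, (rK.por rL).trans rM⟩
  | chand c A B ihA ihB =>
    obtain ⟨K, hK, rK⟩ := ihA
    obtain ⟨L, hL, rL⟩ := ihB
    exact ⟨_, .chand c _ _ (fun _ => hK) (fun _ => hL), rK.chand c rL⟩

/-! ### Eliminating conjunctions by chotomies -/

/-- Trees of choices in `⊓`-clusters outside `F`, whose leaves are `⊤`, dead, or rooted in an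
environment's operator (the cluster being in `F` in the case of `⊓`). -/
inductive Tree (F : Finset Cluster) (σ : Asg ℕ) : Cirquent 0 → Prop
  | top : Tree F σ .top
  | dead (A : Cirquent 0) : Dead σ A → Tree F σ A
  | chand (c : ℕ) (A B : Cirquent 0) : (⟨.chand, c⟩ ∉ F → Tree F σ A) →
      (⟨.chand, c⟩ ∉ F → Tree F σ B) → Tree F σ (.chand c A B)
  | chall (c : ℕ) (A : Cirquent 1) : Tree F σ (.chall c A)

/-- In the context `X`, the cirquent `A` reduces to some tree, without loss, the only new clusters being
`⊓`-clusters outside `F`. -/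
def HasTree (F : Finset Cluster) (σ : Asg ℕ) (X : Ctx 0 0) (A : Cirquent 0) : Prop :=
  ∃ T, Tree F σ T ∧
    (∀ (I : Interp ℕ) (τ : Asg ℕ), A.ev id I τ Fin.elim0 → T.ev id I τ Fin.elim0) ∧
    (∀ c ∈ T.clusters, c ∈ A.clusters ∨ c.kind = .chand ∧ c ∉ F) ∧
    (Provable (X.fill T) → Provable (X.fill A))

section Trees

variable {F : Finset Cluster} {σ : Asg ℕ} {A B L R : Cirquent 0} {X : Ctx 0 0}

theorem Tree.hasTree (h : Tree F σ A) : HasTree F σ X A :=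
  ⟨A, h, fun _ _ h => h, fun _ h => .inl h, fun h => h⟩

theorem Red.hasTree (h : Red A B) (hB : HasTree F σ X B) : HasTree F σ X A := by
  obtain ⟨T, hT, hs, hc, hp⟩ := hB
  exact ⟨T, hT, fun I τ e => hs I τ (h.sem I τ _ e),
    fun c hcT => (hc c hcT).imp_left fun e => h.clusters e, fun e => h.prov X (hp e)⟩

theorem HasTree.chand {c : ℕ} (hA : ⟨.chand, c⟩ ∉ F → ∀ X, HasTree F σ X A)
    (hB : ⟨.chand, c⟩ ∉ F → ∀ X, HasTree F σ X B) : HasTree F σ X (.chand c A B) := by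
  by_cases hc : ⟨.chand, c⟩ ∈ F
  · exact (Tree.chand c A B (absurd hc) (absurd hc)).hasTree
  obtain ⟨T, hT, hTs, hTc, hTp⟩ := hA hc (X.comp (.chandL c .hole B))
  obtain ⟨U, hU, hUs, hUc, hUp⟩ := hB hc (X.comp (.chandR c T .hole))
  refine ⟨.chand c T U, .chand c T U (fun _ => hT) (fun _ => hU), fun I τ h => ?_, ?_, fun h => ?_⟩
  · exact ⟨fun e => hTs I τ (h.1 e), fun e => hUs I τ (h.2 e)⟩
  · simp only [clusters, Finset.mem_insert, Finset.mem_union]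
    grind
  · simp only [Ctx.fill_comp] at hTp hUp
    exact hTp (hUp h)

/-- The common form of the chotomies: `A` reduces to `L ⊓ R`, for any new cluster, and implies both
`L` and `R`. -/
theorem HasTree.of_chotomy
    (hL : ∀ (I : Interp ℕ) (τ : Asg ℕ), A.ev id I τ Fin.elim0 → L.ev id I τ Fin.elim0)
    (hR : ∀ (I : Interp ℕ) (τ : Asg ℕ), A.ev id I τ Fin.elim0 → R.ev id I τ Fin.elim0)
    (hLc : L.clusters ⊆ A.clusters) (hRc : R.clusters ⊆ A.clusters)
    (hp : ∀ c, ⟨.chand, c⟩ ∉ (X.fill A).clusters → Provable (X.fill (.chand c L R)) →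
      Provable (X.fill A))
    (htL : ∀ X, HasTree F σ X L) (htR : ∀ X, HasTree F σ X R) : HasTree F σ X A := by
  obtain ⟨_, ⟨c, rfl⟩, hc⟩ := (Set.infinite_range_of_injective
    (f := fun c : ℕ => (⟨.chand, c⟩ : Cluster)) fun a b h => by simpa using h).exists_notMem_finset
    ((X.fill A).clusters ∪ F)
  simp only [Finset.mem_union, not_or] at hc
  obtain ⟨T, hT, hs, hTc, hTp⟩ :=
    HasTree.chand (c := c) (X := X) (fun _ => htL) (fun _ => htR)
  refine ⟨T, hT, fun I τ h => hs I τ ⟨fun _ => hL I τ h, fun _ => hR I τ h⟩, fun d hd => ?_,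
    fun h => hp c hc.1 (hTp h)⟩
  rcases hTc d hd with h | h
  · simp only [clusters, Finset.mem_insert, Finset.mem_union] at h
    rcases h with rfl | h | h
    exacts [.inr ⟨rfl, hc.2⟩, .inl (hLc h), .inl (hRc h)]
  · exact .inr h

/-- The step for `⊓` and `∀`, which is used in both orders. -/
theorem Tree.pand_chand_chall {b a : ℕ} {B₁ B₂ : Cirquent 0} {A₁ : Cirquent 1}
    (h₁ : ⟨.chand, b⟩ ∉ F → ∀ X, HasTree F σ X (.pand B₁ (.chall a A₁)))
    (h₂ : ⟨.chand, b⟩ ∉ F → ∀ X, HasTree F σ X (.pand B₂ (.chall a A₁))) :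
    HasTree F σ X (.pand (.chand b B₁ B₂) (.chall a A₁)) := by
  refine HasTree.of_chotomy (L := .chand b (.pand B₁ (.chall a A₁)) (.pand B₂ (.chall a A₁)))
    (R := .chall a (.pand (Cirquent.chand b B₁ B₂).shift A₁)) ?_ ?_ ?_ ?_
    (fun c hc => .chandallchotomy X b a c B₁ B₂ A₁ hc)
    (fun X => HasTree.chand h₁ h₂) (fun X => (Tree.chall _ _).hasTree)
  · exact fun I τ h => ⟨fun e => ⟨h.1.1 e, h.2⟩, fun e => ⟨h.1.2 e, h.2⟩⟩
  · exact fun I τ h v e => ⟨(ev_shift _ _ _).2 h.1, h.2 v e⟩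
  · simp only [clusters]; grind
  · simp only [clusters, clusters_shift]; grind

/-- A conjunction of two trees reduces to a tree: a chotomy pulls the root of either one to the front,
and this goes on in the branches. -/
theorem Tree.pand (hA : Tree F σ A) (hB : Tree F σ B) : ∀ X, HasTree F σ X (.pand A B) := by
  induction hA generalizing B with
  | top => exact fun X => (Red.top_pand B).hasTree hB.hasTree
  | dead A h =>
    obtain ⟨I, h⟩ := h
    exact fun X => (Tree.dead (.pand A B) ⟨I, fun τ hτ e => h τ hτ e.1⟩).hasTree
  | chand a A₁ A₂ _ _ ih₁ ih₂ =>
    induction hB with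
    | top => exact fun X => (Red.pand_top _).hasTree (Tree.chand a A₁ A₂ ‹_› ‹_›).hasTree
    | dead B h =>
      obtain ⟨I, h⟩ := h
      exact fun X => (Tree.dead (.pand (.chand a A₁ A₂) B) ⟨I, fun τ hτ e => h τ hτ e.2⟩).hasTree
    | chand b B₁ B₂ h₁ h₂ ihB₁ ihB₂ =>
      have hB : Tree F σ (.chand b B₁ B₂) := .chand b B₁ B₂ h₁ h₂
      refine fun X => HasTree.of_chotomy
        (L := .chand a (.pand A₁ (.chand b B₁ B₂)) (.pand A₂ (.chand b B₁ B₂)))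
        (R := .chand b (.pand (.chand a A₁ A₂) B₁) (.pand (.chand a A₁ A₂) B₂)) ?_ ?_ ?_ ?_
        (fun c hc => .chandchotomy X a b c A₁ A₂ B₁ B₂ hc)
        (fun X => HasTree.chand (fun h => ih₁ h hB) (fun h => ih₂ h hB))
        (fun X => HasTree.chand ihB₁ ihB₂)
      · exact fun I τ h => ⟨fun e => ⟨h.1.1 e, h.2⟩, fun e => ⟨h.1.2 e, h.2⟩⟩
      · exact fun I τ h => ⟨fun e => ⟨h.1, h.2.1 e⟩, fun e => ⟨h.1, h.2.2 e⟩⟩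
      · simp only [clusters]; grind
      · simp only [clusters]; grind
    | chall b B =>
      exact fun X => Tree.pand_chand_chall (fun h => ih₁ h (.chall b B))
        (fun h => ih₂ h (.chall b B))
  | chall a A =>
    induction hB with
    | top => exact fun X => (Red.pand_top _).hasTree (Tree.chall a A).hasTree
    | dead B h =>
      obtain ⟨I, h⟩ := h
      exact fun X => (Tree.dead (.pand (.chall a A) B) ⟨I, fun τ hτ e => h τ hτ e.2⟩).hasTree
    | chand b B₁ B₂ h₁ h₂ ihB₁ ihB₂ =>
      exact fun X => (Red.pand_comm _ _).hasTree <| Tree.pand_chand_chall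
        (fun h X => (Red.pand_comm _ _).hasTree (ihB₁ h X))
        (fun h X => (Red.pand_comm _ _).hasTree (ihB₂ h X))
    | chall b B =>
      refine fun X => HasTree.of_chotomy (L := .chall a (.pand A (Cirquent.chall b B).shift))
        (R := .chall b (.pand (Cirquent.chall a A).shift B)) ?_ ?_ ?_ ?_
        (fun c hc => .challchotomy X a b c A B hc)
        (fun X => (Tree.chall _ _).hasTree) (fun X => (Tree.chall _ _).hasTree)
      · exact fun I τ h v e => ⟨h.1 v e, (ev_shift _ _ _).2 h.2⟩
      · exact fun I τ h v e => ⟨(ev_shift _ _ _).2 h.1, h.2 v e⟩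
      · simp only [clusters, clusters_shift]; grind
      · simp only [clusters, clusters_shift]; grind

theorem HasTree.pand (hA : ∀ X, HasTree F σ X A) (hB : ∀ X, HasTree F σ X B) :
    HasTree F σ X (.pand A B) := by
  obtain ⟨T, hT, hTs, hTc, hTp⟩ := hA (X.comp (.pandL .hole B))
  obtain ⟨U, hU, hUs, hUc, hUp⟩ := hB (X.comp (.pandR T .hole))
  obtain ⟨V, hV, hVs, hVc, hVp⟩ := hT.pand hU X
  refine ⟨V, hV, fun I τ h => hVs I τ ⟨hTs I τ h.1, hUs I τ h.2⟩, fun c hc => ?_, fun h => ?_⟩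
  · have := hVc c hc
    simp only [clusters, Finset.mem_union] at this ⊢
    grind
  · simp only [Ctx.fill_comp] at hTp hUp
    exact hTp (hUp (hVp h))

theorem Nf.hasTree (hA : Nf F A) (hσ : ∀ c ∈ A.clusters, σ c = none) : ∀ X, HasTree F σ X A := by
  induction hA with
  | clause A h =>
    intro X
    rcases h.dead_or_red hσ with h | h
    · exact (Tree.dead A h).hasTree
    · exact h.hasTree Tree.top.hasTree
  | pand A B _ _ ihA ihB =>
    simp only [clusters, Finset.mem_union] at hσ
    exact fun X => .pand (ihA fun c hc => hσ c (.inl hc)) (ihB fun c hc => hσ c (.inr hc))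
  | chand c A B _ _ ihA ihB =>
    simp only [clusters, Finset.mem_insert, Finset.mem_union] at hσ
    exact fun X => .chand (fun h => ihA h fun c hc => hσ c (.inr (.inl hc)))
      (fun h => ihB h fun c hc => hσ c (.inr (.inr hc)))
  | chall c A => exact fun X => (Tree.chall c A).hasTree

end Trees

/-! ### Cirquents that can be won are provable -/

/-- The machine can win `E` from the assignment `σ`, in the game played with actual constants, in which
the environment may move at any time. -/
inductive CanWin (E : Cirquent 0) : Asg ℕ → Prop
  | wait (σ : Asg ℕ) : (∀ I, E.ev id I σ Fin.elim0) →
      (∀ c ∈ E.clusters, σ c = none → c.kind.owner = .environment →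
        ∀ x, CanWin E (Function.update σ c (some x))) → CanWin E σ
  | move (σ : Asg ℕ) (c : Cluster) (x : Cho ℕ c.kind) : c ∈ E.clusters → σ c = none →
      c.kind.owner = .machine → CanWin E (Function.update σ c (some x)) → CanWin E σ

/-- `A` may stand for the position `σ` of the game `E`: whatever happens from `σ` on, it is true if `E`
is, its clusters are unresolved, and except for some `⊓`-clusters they are clusters of `E`. -/
structure StandsFor (E : Cirquent 0) (σ : Asg ℕ) (A : Cirquent 0) : Prop where
  sem : ∀ (I : Interp ℕ) (τ : Asg ℕ), (∀ c, σ c ≠ none → τ c = σ c) →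
    E.ev id I τ Fin.elim0 → A.ev id I τ Fin.elim0
  unresolved : ∀ c ∈ A.clusters, σ c = none
  mem : ∀ c ∈ A.clusters, c.kind ≠ .chand → c ∈ E.clusters

theorem StandsFor.resolve {E A B : Cirquent 0} {σ : Asg ℕ} (h : StandsFor E σ A) {c : Cluster}
    {x : Cho ℕ c.kind} (hσ : σ c = none) (hB : B.clusters ⊆ A.clusters.erase c)
    (hs : ∀ (I : Interp ℕ) (τ : Asg ℕ), τ c = some x → A.ev id I τ Fin.elim0 →
      B.ev id I τ Fin.elim0) :
    StandsFor E (Function.update σ c (some x)) B where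
  sem I τ hτ hE := by
    refine hs I τ (by simpa using hτ c (by simp)) (h.sem I τ (fun d hd => ?_) hE)
    have hdc : d ≠ c := by
      rintro rfl
      exact hd hσ
    rw [hτ d (by rwa [Function.update_of_ne hdc]), Function.update_of_ne hdc]
  unresolved d hd := by
    have := Finset.mem_erase.1 (hB hd)
    rw [Function.update_of_ne this.1]
    exact h.unresolved d this.2
  mem d hd := h.mem d (Finset.mem_of_mem_erase (hB hd))

theorem res_none {n : ℕ} (A : Cirquent n) : A.res (fun _ => none) = A := by
  induction A with
  | top | bot | atom | natom => rfl
  | _ => simp only [res, *]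

theorem StandsFor.of_red {E A K : Cirquent 0} {σ : Asg ℕ} (h : StandsFor E σ A) (r : Red A K) :
    StandsFor E σ K :=
  ⟨fun I τ hτ e => r.sem I τ _ (h.sem I τ hτ e), fun c hc => h.unresolved c (r.clusters hc),
    fun c hc => h.mem c (r.clusters hc)⟩

/-- If the machine may wait, then the trees that stand for the position are provable, by splitting. The
clusters outside `E` that are met on the way are resolved by `π`. -/
theorem Tree.provable {E : Cirquent 0} {σ : Asg ℕ} (hE : ∀ I, E.ev id I σ Fin.elim0)
    (ih : ∀ c ∈ E.clusters, σ c = none → c.kind.owner = .environment → ∀ x A,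
      StandsFor E (Function.update σ c (some x)) A → Provable A)
    {T : Cirquent 0} (hT : Tree E.clusters σ T) : ∀ π : ℕ → Option Bool,
    (∀ c, π c ≠ none → ⟨.chand, c⟩ ∉ E.clusters) → StandsFor E σ (T.res π) → Provable (T.res π) := by
  induction hT with
  | top => exact fun _ _ _ => .axiom_top
  | dead A h =>
    intro π hπE hA
    obtain ⟨I, h⟩ := h
    have := hA.sem I σ (fun _ _ => rfl) (hE I)
    rw [ev_res] at this
    refine absurd this (h _ fun c hc => Asg.override_of_kind_ne ?_)
    intro hk
    rw [hk] at hc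
    cases hc
  | chand c A B _ _ ihA ihB =>
    intro π hπE hA
    rcases hπ : π c with _ | _ | _
    · simp only [res, hπ] at hA ⊢
      have hσ := hA.unresolved ⟨.chand, c⟩ (by simp [clusters])
      have hcl : ∀ (b : Bool) (D : Cirquent 0), (D.res (single c b)).clusters ⊆
          D.clusters.erase ⟨.chand, c⟩ := fun b D d hd => Finset.mem_erase.2
        ⟨fun h => notMem_clusters_res (by simp) D (h ▸ hd), clusters_res_subset _ _ hd⟩
      have hov : ∀ {b : Bool} {τ : Asg ℕ}, τ ⟨.chand, c⟩ = some b → τ.override (single c b) = τ := by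
        intro b τ hτ
        funext d
        by_cases hd : d = ⟨.chand, c⟩
        · subst hd
          simpa [Asg.override] using hτ.symm
        · obtain ⟨k, i⟩ := d
          cases k <;> try rfl
          refine Asg.override_of_none (Function.update_of_ne ?_ _ _)
          rintro rfl
          exact hd rfl
      have hL : StandsFor E (Function.update σ ⟨.chand, c⟩ (some false))
          ((A.res π).res (single c false)) := by
        refine hA.resolve hσ ((hcl _ _).trans (Finset.erase_subset_erase _ ?_)) fun I τ hτ h => ?_
        · simp only [clusters]; grind
        · rw [ev_res, hov hτ]
          exact h.1 hτ
      have hR : StandsFor E (Function.update σ ⟨.chand, c⟩ (some true))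
          ((B.res π).res (single c true)) := by
        refine hA.resolve hσ ((hcl _ _).trans (Finset.erase_subset_erase _ ?_)) fun I τ hτ h => ?_
        · simp only [clusters]; grind
        · rw [ev_res, hov hτ]
          exact h.2 hτ
      by_cases hc : ⟨.chand, c⟩ ∈ E.clusters
      · exact .chand_root (ih _ hc hσ rfl _ _ hL) (ih _ hc hσ rfl _ _ hR)
      -- as the cluster does not occur in `E`, resolving it leaves the position as it is
      have hdrop : ∀ {b : Bool} {D : Cirquent 0},
          StandsFor E (Function.update σ ⟨.chand, c⟩ (some b)) (D.res (single c b)) →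
          StandsFor E σ (D.res (single c b)) := by
        intro b D h
        refine ⟨fun I τ hτ e => ?_, fun d hd => ?_, h.mem⟩
        · have h1 := h.sem I (Function.update τ ⟨.chand, c⟩ (some b)) (fun d hd => ?_)
            ((ev_congr E (fun d hd => ?_) _).1 e)
          · refine (ev_congr _ (fun d hd => ?_) _).1 h1
            rw [Function.update_of_ne]
            rintro rfl
            exact notMem_clusters_res (by simp) D hd
          · by_cases hdc : d = ⟨.chand, c⟩
            · subst hdc; simp
            · rw [Function.update_of_ne hdc] at hd ⊢
              rw [Function.update_of_ne hdc]
              exact hτ d hd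
          · rw [Function.update_of_ne]
            rintro rfl
            exact hc hd
        · have := h.unresolved d hd
          rwa [Function.update_of_ne] at this
          rintro rfl
          exact notMem_clusters_res (by simp) D hd
      have hπE' : ∀ b d, Function.update π c (some b) d ≠ none → ⟨.chand, d⟩ ∉ E.clusters := by
        intro b d hd
        by_cases hdc : d = c
        · exact hdc ▸ hc
        · exact hπE d (by rwa [Function.update_of_ne hdc] at hd)
      refine .chand_root ?_ ?_
      · have := hdrop hL
        rw [res_update_res _ hπ] at this ⊢
        exact ihA hc _ (hπE' _) this
      · have := hdrop hR
        rw [res_update_res _ hπ] at this ⊢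
        exact ihB hc _ (hπE' _) this
    · simp only [res, hπ] at hA ⊢
      exact ihA (hπE c (by simp [hπ])) π hπE hA
    · simp only [res, hπ] at hA ⊢
      exact ihB (hπE c (by simp [hπ])) π hπE hA
  | chall c A =>
    intro π hπE hA
    simp only [res] at hA ⊢
    have hσ := hA.unresolved ⟨.chall, c⟩ (by simp [clusters])
    have hc := hA.mem ⟨.chall, c⟩ (by simp [clusters]) (by simp)
    refine .chall_root fun a => ih _ hc hσ rfl a _ (hA.resolve hσ ?_ fun I τ hτ h => ?_)
    · rw [clusters_inst]
      refine (clusters_cleanse _ _ _).trans (Finset.erase_subset_erase _ ?_)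
      simp only [clusters]; grind
    · rw [ev_inst, ev_cleanse]
      · exact h a hτ
      · exact hτ

/-- A position that the machine can win is provable, in each form that it may be given. -/
theorem CanWin.provable {E : Cirquent 0} {σ : Asg ℕ} (h : CanWin E σ)
    (hsupp : ∀ c ∉ E.clusters, σ c = none) {A : Cirquent 0} (hA : StandsFor E σ A) :
    Provable A := by
  have hsupp' : ∀ {σ : Asg ℕ} {c : Cluster} {x : Cho ℕ c.kind}, c ∈ E.clusters →
      (∀ c ∉ E.clusters, σ c = none) →
      ∀ d ∉ E.clusters, Function.update σ c (some x) d = none := by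
    intro σ c x hc h d hd
    rw [Function.update_of_ne]
    · exact h d hd
    · rintro rfl
      exact hd hc
  induction h generalizing A with
  | wait σ hE _ ih =>
    obtain ⟨K, hK, r⟩ := exists_nf E.clusters A
    have hKs := hA.of_red r
    obtain ⟨T, hT, hs, hc, hp⟩ := hK.hasTree hKs.unresolved .hole
    have hTs : StandsFor E σ T := by
      refine ⟨fun I τ hτ e => hs I τ (hKs.sem I τ hτ e), fun c hcT => ?_, fun c hcT hk => ?_⟩
      · rcases hc c hcT with h | h
        exacts [hKs.unresolved c h, hsupp c h.2]
      · rcases hc c hcT with h | h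
        exacts [hKs.mem c h hk, absurd h.1 hk]
    refine r.prov .hole (hp ?_)
    have := hT.provable hE (fun c hc hσ ho x A h => ih c hc hσ ho x (hsupp' hc hsupp) h)
      (fun _ => none) (fun _ h => absurd rfl h)
    rw [res_none] at this
    exact this hTs
  | move σ c x hc hσ ho _ ih =>
    obtain ⟨k, c⟩ := c
    cases k
    · cases x
      · exact .left_chor_choosing c A (ih (hsupp' hc hsupp) (hA.resolve hσ
          (clusters_chooseLeft c A) fun I τ hτ => (ev_chooseLeft hτ A _).2))
      · exact .right_chor_choosing c A (ih (hsupp' hc hsupp) (hA.resolve hσ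
          (clusters_chooseRight c A) fun I τ hτ => (ev_chooseRight hτ A _).2))
    · cases ho
    · exact .chexists_choosing c x A (ih (hsupp' hc hsupp) (hA.resolve hσ
        (clusters_chooseConst c x A) fun I τ hτ => (ev_chooseConst hτ A _).2))
    · cases ho

theorem CanWin.provable_of_empty {E : Cirquent 0} (h : CanWin E (Asg.empty ℕ)) : Provable E :=
  h.provable (fun _ _ => rfl) ⟨fun _ _ _ e => e, fun _ _ => rfl, fun _ h _ => h⟩

/-! ### Moves -/

theorem dot_notMem_numeral (a : ℕ) : Key.dot ∉ numeral a := by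
  unfold numeral
  split_ifs <;> simp

theorem numeral_injective : Function.Injective numeral := by
  have key : ∀ a, a ≠ 0 → numeral a ≠ [.digit 0] := by
    intro a ha h
    rw [numeral, if_neg ha] at h
    have h1 : (Nat.digits 10 a).reverse.map (fun d => Key.digit (Fin.ofNat 10 d)) =
        [0].map (fun d => Key.digit (Fin.ofNat 10 d)) := h
    have hlen : (Nat.digits 10 a).length = 1 := by simpa using congrArg List.length h1
    obtain ⟨d, hd⟩ := List.length_eq_one_iff.1 hlen
    have hlt : d < 10 := Nat.digits_lt_base (by norm_num) (by rw [hd]; simp)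
    rw [hd] at h1
    have h0 : d = 0 := by
      have := congrArg (fun l => l.map fun k => match k with
        | Key.digit e => e.val | _ => 0) h1
      simpa [Fin.ofNat, Nat.mod_eq_of_lt hlt] using this
    subst h0
    have := Nat.ofDigits_digits 10 a
    rw [hd] at this
    simp at this
    exact ha this.symm
  intro a b h
  by_cases ha : a = 0
  · by_contra hb
    refine key b (fun h0 => hb (ha.trans h0.symm)) ?_
    rw [← h, ha]
    simp [numeral]
  by_cases hb : b = 0
  · refine absurd ?_ (key a ha)
    rw [h, hb]
    simp [numeral]
  rw [numeral, numeral, if_neg ha, if_neg hb] at h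
  have h2 := congrArg (fun l => (l.map fun k => match k with
    | Key.digit e => e.val | _ => 0).reverse) h
  have h3 : ∀ n : ℕ, (List.map (fun k => match k with
      | Key.digit e => e.val | _ => 0)
      ((Nat.digits 10 n).reverse.map (fun d => Key.digit (Fin.ofNat 10 d)))).reverse =
      Nat.digits 10 n := by
    intro n
    rw [List.map_map, ← List.map_reverse, List.reverse_reverse]
    conv_rhs => rw [← List.map_id (Nat.digits 10 n)]
    refine List.map_congr_left fun d hd => ?_
    simp [Fin.ofNat, Nat.mod_eq_of_lt (Nat.digits_lt_base (by norm_num) hd)]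
  simp only [h3] at h2
  exact Nat.digits_inj_iff.1 h2

theorem append_cons_inj {α : Type*} {d : α} : ∀ {l₁ l₂ r₁ r₂ : List α}, d ∉ l₁ → d ∉ l₂ →
    l₁ ++ d :: r₁ = l₂ ++ d :: r₂ → l₁ = l₂ ∧ r₁ = r₂
  | [], [], _, _, _, _, h => ⟨rfl, (List.cons.inj h).2⟩
  | [], b :: l₂, _, _, _, h₂, h => absurd (List.cons.inj h).1 fun e => h₂ (e ▸ List.mem_cons_self)
  | a :: l₁, [], _, _, h₁, _, h =>
    absurd (List.cons.inj h).1 fun e => h₁ (e ▸ List.mem_cons_self)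
  | a :: l₁, b :: l₂, _, _, h₁, h₂, h => by
    have h' := List.cons.inj h
    obtain ⟨e, e'⟩ := append_cons_inj (fun m => h₁ (List.mem_cons_of_mem _ m))
      (fun m => h₂ (List.mem_cons_of_mem _ m)) h'.2
    exact ⟨by rw [h'.1, e], e'⟩

theorem dot_notMem_name (c : Cluster) : Key.dot ∉ c.name := by
  simp [Cluster.name, dot_notMem_numeral]

theorem Cluster.name_injective : Function.Injective Cluster.name := by
  rintro ⟨k, i⟩ ⟨l, j⟩ h
  simp only [Cluster.name, List.cons.injEq, Key.kind.injEq] at h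
  rw [h.1, numeral_injective h.2]

theorem Cluster.move_inj {c d : Cluster} {a b : ℕ} (h : c.move a = d.move b) :
    c = d ∧ a = b := by
  obtain ⟨h1, h2⟩ := append_cons_inj (dot_notMem_name c) (dot_notMem_name d) h
  exact ⟨Cluster.name_injective h1, numeral_injective h2⟩

/-- The number by which a choice is written in a move. -/
def Cho.num : {k : ClusterKind} → Cho ℕ k → ℕ
  | .chor, b => cond b 1 0
  | .chand, b => cond b 1 0
  | .chexists, a => a
  | .chall, a => a

theorem Cho.num_injective {k : ClusterKind} : Function.Injective (Cho.num (k := k)) := by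
  cases k
  · rintro (_ | _) (_ | _) h <;> first | rfl | cases h
  · rintro (_ | _) (_ | _) h <;> first | rfl | cases h
  · exact fun _ _ h => h
  · exact fun _ _ h => h

theorem choice_iff {k : ClusterKind} {a : ℕ} : k.Choice a ↔ ∃ x : Cho ℕ k, x.num = a := by
  cases k
  · exact ⟨fun h => h.elim (fun h => ⟨false, h.symm⟩) (fun h => ⟨true, h.symm⟩),
      fun ⟨x, hx⟩ => by cases x <;> simp_all [Cho.num, ClusterKind.Choice]⟩
  · exact ⟨fun h => h.elim (fun h => ⟨false, h.symm⟩) (fun h => ⟨true, h.symm⟩),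
      fun ⟨x, hx⟩ => by cases x <;> simp_all [Cho.num, ClusterKind.Choice]⟩
  · exact ⟨fun _ => ⟨a, rfl⟩, fun _ => trivial⟩
  · exact ⟨fun _ => ⟨a, rfl⟩, fun _ => trivial⟩

/-! ### Legal positions and runs -/

/-- A legal position. -/
def LegalPos (Φ : Position) : Prop := Run.Legal (Stream'.Seq.ofList Φ)

theorem legalPos_nil : LegalPos [] := by
  constructor <;> simp

theorem legalPos_snoc {Φ : Position} {m : LabMove} : LegalPos (Φ ++ [m]) ↔
    LegalPos Φ ∧ ∃ (c : Cluster) (x : Cho ℕ c.kind), m = ⟨c.kind.owner, c.move x.num⟩ ∧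
      ∀ m' ∈ Φ, ∀ b, m'.move ≠ c.move b := by
  have hget : ∀ {i : ℕ} {m' : LabMove}, Φ[i]? = some m' → (Φ ++ [m])[i]? = some m' := by
    intro i m' h
    obtain ⟨hi, -⟩ := List.getElem?_eq_some_iff.1 h
    rwa [List.getElem?_append_left hi]
  have hlast : (Φ ++ [m])[Φ.length]? = some m := by simp
  have hcases : ∀ {i : ℕ} {m' : LabMove}, (Φ ++ [m])[i]? = some m' →
      Φ[i]? = some m' ∨ i = Φ.length ∧ m' = m := by
    intro i m' h
    rcases lt_or_ge i Φ.length with hi | hi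
    · rw [List.getElem?_append_left hi] at h
      exact .inl h
    · rw [List.getElem?_append_right hi, List.getElem?_eq_some_iff] at h
      obtain ⟨h0, h1⟩ := h
      simp only [List.length_singleton, Nat.lt_one_iff] at h0
      simp only [h0, List.getElem_cons_zero] at h1
      exact .inr ⟨by omega, h1.symm⟩
  simp only [LegalPos, Run.Legal, Stream'.Seq.ofList_get?]
  constructor
  · rintro ⟨h1, h2⟩
    refine ⟨⟨fun i l h => h1 i l (hget h), fun c i j k l a b hi hj => h2 c i j k l a b
      (hget hi) (hget hj)⟩, ?_⟩
    obtain ⟨c, a, hm, ha, ho⟩ := h1 _ _ hlast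
    obtain ⟨x, rfl⟩ := choice_iff.1 ha
    have hm' : m = ⟨c.kind.owner, c.move x.num⟩ := by
      obtain ⟨p, w⟩ := m
      simp only at hm ho
      rw [hm, ho]
    refine ⟨c, x, hm', fun m' hm'Φ b hb => ?_⟩
    obtain ⟨i, hi⟩ := List.mem_iff_getElem?.1 hm'Φ
    obtain ⟨p, w⟩ := m'
    simp only at hb
    subst hb
    have := h2 c i Φ.length _ _ _ _ (hget hi) (by rw [hlast, hm'])
    subst this
    simp at hi
  · rintro ⟨⟨h1, h2⟩, c, x, rfl, hc⟩
    refine ⟨fun i l h => ?_, fun d i j k l a b hi hj => ?_⟩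
    · rcases hcases h with h | ⟨-, rfl⟩
      exacts [h1 i l h, ⟨c, x.num, rfl, choice_iff.2 ⟨x, rfl⟩, rfl⟩]
    · rcases hcases hi with hi' | ⟨hi', ei⟩ <;> rcases hcases hj with hj' | ⟨hj', ej⟩
      · exact h2 d i j k l a b hi' hj'
      · obtain ⟨rfl, -⟩ := Cluster.move_inj (LabMove.mk.inj ej).2
        exact absurd rfl (hc _ (List.mem_of_getElem? hi') a)
      · obtain ⟨rfl, -⟩ := Cluster.move_inj (LabMove.mk.inj ei).2
        exact absurd rfl (hc _ (List.mem_of_getElem? hj') b)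
      · exact hi'.trans hj'.symm

theorem LegalPos.of_append {Φ Ψ : Position} (h : LegalPos (Φ ++ Ψ)) : LegalPos Φ := by
  induction Ψ using List.reverseRecOn with
  | nil => simpa using h
  | append_singleton Ψ m ih =>
    rw [← List.append_assoc, legalPos_snoc] at h
    exact ih h.1

theorem LegalPos.of_prefix {Φ Ψ : Position} (h : LegalPos Ψ) (hp : Φ <+: Ψ) : LegalPos Φ := by
  obtain ⟨Ψ, rfl⟩ := hp
  exact h.of_append

/-- Every move in a legal position is a choice by the owner of its cluster. -/
theorem LegalPos.eq_move {Φ : Position} (h : LegalPos Φ) {m : LabMove} (hm : m ∈ Φ) :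
    ∃ (c : Cluster) (x : Cho ℕ c.kind), m = ⟨c.kind.owner, c.move x.num⟩ := by
  obtain ⟨i, hi⟩ := List.mem_iff_getElem?.1 hm
  obtain ⟨c, a, h1, h2, h3⟩ := h.1 i m (by simpa using hi)
  obtain ⟨x, rfl⟩ := choice_iff.1 h2
  obtain ⟨p, w⟩ := m
  simp only at h1 h3
  exact ⟨c, x, by rw [h1, h3]⟩

/-- In a legal position there is at most one move in each cluster. -/
theorem LegalPos.unique {Φ : Position} (h : LegalPos Φ) {c : Cluster} {a b : ℕ} {k l : Player}
    (h1 : ⟨k, c.move a⟩ ∈ Φ) (h2 : ⟨l, c.move b⟩ ∈ Φ) : a = b := by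
  obtain ⟨i, hi⟩ := List.mem_iff_getElem?.1 h1
  obtain ⟨j, hj⟩ := List.mem_iff_getElem?.1 h2
  have := h.2 c i j k l a b (by simpa using hi) (by simpa using hj)
  subst this
  rw [hi] at hj
  exact (Cluster.move_inj (LabMove.mk.inj (Option.some.inj hj)).2).2

namespace HPM

variable {M : HPM} {e : ℕ → List Move}

open Classical in
/-- The moves (at most one) that the machine makes in the step after the configuration `C`. -/
noncomputable def own (M : HPM) (C : M.Config) : Position :=
  let act := M.step C.state (spell C.position)[C.runHead]? (fun i => (C.work i).head)
  if act.next ∈ M.moveStates then [⟨.machine, C.buffer ++ act.append.toList⟩] else []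

theorem position_succ (M : HPM) (e : ℕ → List Move) (t : ℕ) :
    (M.branch e (t + 1)).position =
      (M.branch e t).position ++ M.own (M.branch e t) ++ (e t).map fun α => ⟨.environment, α⟩ := rfl

theorem own_eq_nil_or (M : HPM) (C : M.Config) :
    M.own C = [] ∨ ∃ w, M.own C = [⟨.machine, w⟩] := by
  simp only [own]
  split_ifs
  exacts [.inr ⟨_, rfl⟩, .inl rfl]

theorem position_prefix (M : HPM) (e : ℕ → List Move) {s t : ℕ} (h : s ≤ t) :
    (M.branch e s).position <+: (M.branch e t).position := by
  induction t, h using Nat.le_induction with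
  | base => exact List.prefix_rfl
  | succ t _ ih =>
    rw [position_succ, List.append_assoc]
    exact ih.trans (List.prefix_append _ _)

theorem branch_congr (M : HPM) {e e' : ℕ → List Move} {t : ℕ} (h : ∀ s < t, e s = e' s) :
    M.branch e t = M.branch e' t := by
  induction t with
  | zero => rfl
  | succ t ih =>
    rw [branch, branch, ih fun s hs => h s (hs.trans (Nat.lt_succ_self t)), h t (Nat.lt_succ_self t)]

theorem run_get? (M : HPM) (e : ℕ → List Move) (i : ℕ) (m : LabMove) :
    (M.run e).get? i = some m ↔ ∃ t, (M.branch e t).position[i]? = some m := by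
  classical
  have hp : ∀ {s t : ℕ}, s ≤ t → i < (M.branch e s).position.length →
      (M.branch e s).position[i]? = (M.branch e t).position[i]? := by
    intro s t hst hi
    obtain ⟨Ψ, h⟩ := M.position_prefix e hst
    rw [← h, List.getElem?_append_left hi]
  show (if h : ∃ t, i < (M.branch e t).position.length then
      (M.branch e (Nat.find h)).position[i]? else none) = some m ↔ _
  constructor
  · intro h
    split_ifs at h with hex
    exact ⟨_, h⟩
  · rintro ⟨t, ht⟩
    obtain ⟨hi, -⟩ := List.getElem?_eq_some_iff.1 ht
    have hex : ∃ t, i < (M.branch e t).position.length := ⟨t, hi⟩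
    rw [dif_pos hex, hp (Nat.find_min' hex hi) (Nat.find_spec hex), ht]

theorem legal_run_iff (M : HPM) (e : ℕ → List Move) :
    (M.run e).Legal ↔ ∀ t, LegalPos (M.branch e t).position := by
  have hp : ∀ {s t i : ℕ} {m : LabMove}, s ≤ t → (M.branch e s).position[i]? = some m →
      (M.branch e t).position[i]? = some m := by
    intro s t i m hst h
    obtain ⟨hi, -⟩ := List.getElem?_eq_some_iff.1 h
    obtain ⟨Ψ, h'⟩ := M.position_prefix e hst
    rwa [← h', List.getElem?_append_left hi]
  constructor
  · rintro ⟨h1, h2⟩ t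
    refine ⟨fun i l h => h1 i l ((M.run_get? e i l).2 ⟨t, by simpa using h⟩),
      fun c i j k l a b hi hj => h2 c i j k l a b ((M.run_get? e _ _).2 ⟨t, by simpa using hi⟩)
        ((M.run_get? e _ _).2 ⟨t, by simpa using hj⟩)⟩
  · intro h
    refine ⟨fun i l hi => ?_, fun c i j k l a b hi hj => ?_⟩
    · obtain ⟨t, ht⟩ := (M.run_get? e i l).1 hi
      exact (h t).1 i l (by simpa using ht)
    · obtain ⟨s, hs⟩ := (M.run_get? e _ _).1 hi
      obtain ⟨t, ht⟩ := (M.run_get? e _ _).1 hj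
      exact (h (max s t)).2 c i j k l a b (by simpa using hp (le_max_left s t) hs)
        (by simpa using hp (le_max_right s t) ht)

theorem take_run (M : HPM) (e : ℕ → List Move) {t i : ℕ}
    (h : i ≤ (M.branch e t).position.length) :
    (M.run e).take i = (M.branch e t).position.take i := by
  refine List.ext_getElem? fun j => ?_
  by_cases hj : j < i
  · have hjt := List.getElem?_eq_getElem (lt_of_lt_of_le hj h)
    rw [Stream'.Seq.getElem?_take, if_pos hj, List.getElem?_take, if_pos hj, hjt]
    exact (M.run_get? e j _).2 ⟨t, hjt⟩
  · rw [Stream'.Seq.getElem?_take, if_neg hj, List.getElem?_take, if_neg hj]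

theorem has_run_iff (M : HPM) (e : ℕ → List Move) (c : Cluster) (a : ℕ) :
    (M.run e).Has c a ↔ ∃ t l, ⟨l, c.move a⟩ ∈ (M.branch e t).position := by
  simp only [Run.Has, run_get?, List.mem_iff_getElem?]
  exact ⟨fun ⟨i, l, t, h⟩ => ⟨t, l, i, h⟩, fun ⟨t, l, i, h⟩ => ⟨i, l, t, h⟩⟩

/-- The time at which the first illegal move is made. -/
theorem exists_first_illegal (h : ¬ (M.run e).Legal) :
    ∃ t, LegalPos (M.branch e t).position ∧ ¬ LegalPos (M.branch e (t + 1)).position := by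
  classical
  rw [legal_run_iff, not_forall] at h
  have h0 : Nat.find h ≠ 0 := fun h' => (h' ▸ Nat.find_spec h) legalPos_nil
  obtain ⟨t, ht⟩ := Nat.exists_eq_succ_of_ne_zero h0
  exact ⟨t, not_not.1 (Nat.find_min h (ht ▸ Nat.lt_succ_self t)), fun h' =>
    Nat.find_spec h (by rw [ht]; exact h')⟩

theorem firstIllegalBy_of_legal_own {t : ℕ}
    (h : LegalPos ((M.branch e t).position ++ M.own (M.branch e t)))
    (h' : ¬ LegalPos (M.branch e (t + 1)).position) :
    (M.run e).FirstIllegalBy .environment := by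
  -- the shortest illegal extension by moves of the environment
  have key : ∀ (w : List Move) (Φ : Position), LegalPos Φ →
      ¬ LegalPos (Φ ++ w.map fun α => ⟨.environment, α⟩) → ∃ u α v, w = u ++ α :: v ∧
        LegalPos (Φ ++ u.map fun α => ⟨.environment, α⟩) ∧
        ¬ LegalPos (Φ ++ (u.map fun α => ⟨.environment, α⟩) ++ [⟨.environment, α⟩]) := by
    intro w
    induction w using List.reverseRecOn with
    | nil => exact fun Φ h h' => absurd (by simpa using h) h'
    | append_singleton w α ih =>
      intro Φ h h'
      by_cases hw : LegalPos (Φ ++ w.map fun α => ⟨.environment, α⟩)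
      · exact ⟨w, α, [], rfl, hw, by simpa using h'⟩
      · obtain ⟨u, β, v, hv, h1, h2⟩ := ih Φ h hw
        exact ⟨u, β, v ++ [α], by simp [hv], h1, h2⟩
  rw [position_succ] at h'
  obtain ⟨u, α, v, hw, h1, h2⟩ := key _ _ h h'
  set Ψ := (M.branch e t).position ++ M.own (M.branch e t) ++
    u.map fun α => (⟨.environment, α⟩ : LabMove) with hΨ
  have hpos : (M.branch e (t + 1)).position =
      Ψ ++ ⟨.environment, α⟩ :: v.map fun α => ⟨.environment, α⟩ := by
    rw [position_succ, hw, hΨ]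
    simp
  refine ⟨Ψ.length, α, (M.run_get? e _ _).2 ⟨t + 1, by simp [hpos]⟩, ?_, ?_⟩
  · rw [M.take_run e (t := t + 1) (by simp [hpos]), hpos, List.take_left]
    exact h1
  · rw [M.take_run e (t := t + 1) (by simp [hpos]), hpos]
    change ¬ LegalPos _
    rw [List.take_append, List.take_of_length_le (Nat.le_succ _)]
    simpa only [Nat.add_sub_cancel_left, List.take_succ_cons, List.take_zero] using h2

theorem exists_of_firstIllegalBy {l : Player} (h : (M.run e).FirstIllegalBy l) :
    ∃ (t i : ℕ) (α : Move), (M.branch e t).position[i]? = some ⟨l, α⟩ ∧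
      ¬ LegalPos ((M.branch e t).position.take (i + 1)) := by
  obtain ⟨i, α, h1, -, h3⟩ := h
  obtain ⟨t, ht⟩ := (M.run_get? e _ _).1 h1
  refine ⟨t, i, α, ht, ?_⟩
  obtain ⟨hi, -⟩ := List.getElem?_eq_some_iff.1 ht
  rwa [M.take_run e hi] at h3

end HPM

/-! ### Won runs and assignments -/

section Won

variable {I : Interpretation} {Γ : Run} {σ : Asg ℕ}

/-- On the clusters in `F`, the assignment `σ` consists of the choices that are made in `Γ`. -/
def Agrees (F : Finset Cluster) (Γ : Run) (σ : Asg ℕ) : Prop :=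
  ∀ c ∈ F, ∀ x : Cho ℕ c.kind, σ c = some x ↔ Γ.Has c x.num

theorem not_resolved_iff (hΓ : Γ.Legal) {F : Finset Cluster} (h : Agrees F Γ σ) {c : Cluster}
    (hc : c ∈ F) : ¬ Γ.Resolved c ↔ σ c = none := by
  constructor
  · intro hr
    by_contra hn
    obtain ⟨x, hx⟩ := Option.ne_none_iff_exists'.1 hn
    exact hr ⟨_, (h c hc x).1 hx⟩
  · rintro hn ⟨a, i, l, hi⟩
    obtain ⟨d, b, h1, h2, -⟩ := hΓ.1 _ _ hi
    obtain ⟨rfl, rfl⟩ := Cluster.move_inj h1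
    obtain ⟨x, hx⟩ := choice_iff.1 h2
    rw [(h c hc x).2 ⟨i, l, by rw [hx]; exact hi⟩] at hn
    cases hn

theorem WonLegal.ev (hΓ : Γ.Legal) {E : Cirquent 0} (h : WonLegal I Γ E) :
    Agrees E.clusters Γ σ → E.ev id I σ Fin.elim0 := by
  have hval : ∀ t : Term 0, t.eval id Fin.elim0 = t.value := by
    rintro (i | a)
    exacts [i.elim0, rfl]
  induction h with
  | top => exact fun _ => trivial
  | atom p t h | natom p t h =>
    intro _
    simp only [Cirquent.ev, hval]
    exact h
  | pand A B _ _ ihA ihB =>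
    exact fun h => ⟨ihA fun c hc => h c (by simp [Cirquent.clusters, hc]),
      ihB fun c hc => h c (by simp [Cirquent.clusters, hc])⟩
  | por_left A B _ ih => exact fun h => .inl (ih fun c hc => h c (by simp [Cirquent.clusters, hc]))
  | por_right A B _ ih => exact fun h => .inr (ih fun c hc => h c (by simp [Cirquent.clusters, hc]))
  | chand_left c A B hc _ ih =>
    intro h
    have := (h ⟨.chand, c⟩ (by simp [Cirquent.clusters]) false).2 hc
    have ih' := ih fun c hc => h c (by simp [Cirquent.clusters, hc])
    exact ⟨fun _ => ih', fun e => by simp [this] at e⟩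
  | chand_right c A B hc _ ih =>
    intro h
    have := (h ⟨.chand, c⟩ (by simp [Cirquent.clusters]) true).2 hc
    have ih' := ih fun c hc => h c (by simp [Cirquent.clusters, hc])
    exact ⟨fun e => by simp [this] at e, fun _ => ih'⟩
  | chand_unresolved c A B hc =>
    intro h
    have := (not_resolved_iff hΓ h (by simp [Cirquent.clusters])).1 hc
    exact ⟨fun e => by simp [this] at e, fun e => by simp [this] at e⟩
  | chor_left c A B hc _ ih =>
    exact fun h => .inl ⟨(h ⟨.chor, c⟩ (by simp [Cirquent.clusters]) false).2 hc,
      ih fun c hc => h c (by simp [Cirquent.clusters, hc])⟩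
  | chor_right c A B hc _ ih =>
    exact fun h => .inr ⟨(h ⟨.chor, c⟩ (by simp [Cirquent.clusters]) true).2 hc,
      ih fun c hc => h c (by simp [Cirquent.clusters, hc])⟩
  | chall c a A hc _ ih =>
    intro h v hv
    have := (h ⟨.chall, c⟩ (by simp [Cirquent.clusters]) a).2 hc
    rw [this] at hv
    cases hv
    exact (ev_inst A _ _).1 (ih fun c hc => h c (by
      rw [clusters_inst] at hc; simp [Cirquent.clusters, hc]))
  | chall_unresolved c A hc =>
    intro h v hv
    simp [(not_resolved_iff hΓ h (by simp [Cirquent.clusters])).1 hc] at hv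
  | chexists c a A hc _ ih =>
    intro h
    exact ⟨a, (h ⟨.chexists, c⟩ (by simp [Cirquent.clusters]) a).2 hc,
      (ev_inst A _ _).1 (ih fun c hc => h c (by
        rw [clusters_inst] at hc; simp [Cirquent.clusters, hc]))⟩

end Won

section Substitution

theorem Term.subst_subst {n m k : ℕ} (s : Fin n → Term m) (s' : Fin m → Term k) (t : Term n) :
    (t.subst s).subst s' = t.subst fun i => (s i).subst s' := by
  cases t <;> rfl

theorem Term.subst_liftSubst {n m k : ℕ} (s : Fin n → Term m) (s' : Fin m → Term k) :
    (fun i => (Term.liftSubst s i).subst (Term.liftSubst s')) =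
      Term.liftSubst fun i => (s i).subst s' := by
  funext i
  refine Fin.cases ?_ (fun i => ?_) i
  · rfl
  · simp only [Term.liftSubst, Fin.cases_succ]
    cases s i <;> rfl

theorem subst_subst {n : ℕ} (A : Cirquent n) : ∀ {m k : ℕ} (s : Fin n → Term m)
    (s' : Fin m → Term k), (A.subst s).subst s' = A.subst fun i => (s i).subst s' := by
  induction A <;> intros <;>
    simp only [subst, Term.subst_subst, Term.subst_liftSubst, *]

theorem Term.subst_var {n : ℕ} (t : Term n) : t.subst Term.var = t := by
  cases t <;> rfl

theorem Term.liftSubst_var {n : ℕ} : Term.liftSubst (Term.var (n := n)) = Term.var := by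
  funext i
  refine Fin.cases ?_ (fun i => ?_) i <;> rfl

theorem subst_var {n : ℕ} (A : Cirquent n) : A.subst Term.var = A := by
  induction A <;> simp only [subst, Term.subst_var, Term.liftSubst_var, *]

theorem inst_subst_liftSubst {n : ℕ} (A : Cirquent (n + 1)) (ρ : Fin n → ℕ) (a : ℕ) :
    (A.subst (Term.liftSubst fun i => .const (ρ i))).inst (.const a) =
      A.subst (m := 0) fun i => .const ((Fin.cons a ρ : Fin (n + 1) → ℕ) i) := by
  rw [inst, subst_subst]
  congr 1
  funext i
  refine Fin.cases ?_ (fun i => ?_) i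
  · simp [Term.liftSubst, Term.subst]
  · simp [Term.liftSubst, Term.subst]

end Substitution

section Won

variable {I : Interpretation} {Γ : Run} {σ : Asg ℕ}

theorem wonLegal_subst_of_ev (hΓ : Γ.Legal) {n : ℕ} (A : Cirquent n) :
    ∀ ρ : Fin n → ℕ, Agrees A.clusters Γ σ → A.ev id I σ ρ →
      WonLegal I Γ (A.subst fun i => .const (ρ i)) := by
  have hval : ∀ {n : ℕ} (ρ : Fin n → ℕ) (t : Term n),
      (t.subst (m := 0) fun i => .const (ρ i)).value = t.eval id ρ := by
    rintro n ρ (i | a) <;> rfl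
  induction A with
  | top => exact fun _ _ _ => .top
  | bot => exact fun _ _ h => h.elim
  | atom p t =>
    intro ρ _ h
    exact .atom p _ (by simpa only [hval, ev] using h)
  | natom p t =>
    intro ρ _ h
    exact .natom p _ (by simpa only [hval, ev] using h)
  | pand A B ihA ihB =>
    exact fun ρ h e => .pand _ _ (ihA ρ (fun c hc => h c (by simp [clusters, hc])) e.1)
      (ihB ρ (fun c hc => h c (by simp [clusters, hc])) e.2)
  | por A B ihA ihB =>
    intro ρ h e
    rcases e with e | e
    · exact .por_left _ _ (ihA ρ (fun c hc => h c (by simp [clusters, hc])) e)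
    · exact .por_right _ _ (ihB ρ (fun c hc => h c (by simp [clusters, hc])) e)
  | chand c A B ihA ihB =>
    intro ρ h e
    have hc : (⟨.chand, c⟩ : Cluster) ∈ (Cirquent.chand c A B).clusters := by simp [clusters]
    rcases hx : σ ⟨.chand, c⟩ with _ | _ | _
    · exact .chand_unresolved c _ _ ((not_resolved_iff hΓ h hc).2 hx)
    · exact .chand_left c _ _ ((h _ hc false).1 hx)
        (ihA ρ (fun c hc => h c (by simp [clusters, hc])) (e.1 hx))
    · exact .chand_right c _ _ ((h _ hc true).1 hx)
        (ihB ρ (fun c hc => h c (by simp [clusters, hc])) (e.2 hx))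
  | chor c A B ihA ihB =>
    intro ρ h e
    have hc : (⟨.chor, c⟩ : Cluster) ∈ (Cirquent.chor c A B).clusters := by simp [clusters]
    rcases e with ⟨hx, e⟩ | ⟨hx, e⟩
    · exact .chor_left c _ _ ((h _ hc false).1 hx)
        (ihA ρ (fun c hc => h c (by simp [clusters, hc])) e)
    · exact .chor_right c _ _ ((h _ hc true).1 hx)
        (ihB ρ (fun c hc => h c (by simp [clusters, hc])) e)
  | chall c A ih =>
    intro ρ h e
    have hc : (⟨.chall, c⟩ : Cluster) ∈ (Cirquent.chall c A).clusters := by simp [clusters]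
    rcases hx : σ ⟨.chall, c⟩ with _ | a
    · exact .chall_unresolved c _ ((not_resolved_iff hΓ h hc).2 hx)
    · refine .chall c a _ ((h _ hc a).1 hx) ?_
      rw [inst_subst_liftSubst]
      exact ih _ (fun c hc => h c (by simp [clusters, hc])) (e a hx)
  | chexists c A ih =>
    rintro ρ h ⟨a, hx, e⟩
    refine .chexists c a _ ((h ⟨.chexists, c⟩ (by simp [clusters]) a).1 hx) ?_
    rw [inst_subst_liftSubst]
    exact ih _ (fun c hc => h c (by simp [clusters, hc])) e

theorem wonLegal_iff_ev (hΓ : Γ.Legal) {E : Cirquent 0} (h : Agrees E.clusters Γ σ) :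
    WonLegal I Γ E ↔ E.ev id I σ Fin.elim0 := by
  refine ⟨fun hw => hw.ev hΓ h, fun he => ?_⟩
  have := wonLegal_subst_of_ev hΓ E _ h he
  rwa [show (fun i : Fin 0 => Term.const (n := 0) (Fin.elim0 i)) = Term.var from
    funext fun i => i.elim0, subst_var] at this

end Won

/-! ### Valid cirquents can be won -/

open Classical in
/-- The choices made in the position `Φ` in clusters of `F`. -/
noncomputable def Asg.ofPos (F : Finset Cluster) (Φ : Position) : Asg ℕ := fun c =>
  if h : c ∈ F ∧ ∃ x : Cho ℕ c.kind, ∃ l, ⟨l, c.move x.num⟩ ∈ Φ then some h.2.choose else none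

section OfPos

variable {F : Finset Cluster} {Φ : Position}

theorem ofPos_eq_some (h : LegalPos Φ) {c : Cluster} {x : Cho ℕ c.kind} :
    Asg.ofPos F Φ c = some x ↔ c ∈ F ∧ ∃ l, ⟨l, c.move x.num⟩ ∈ Φ := by
  unfold Asg.ofPos
  constructor
  · intro hx
    split_ifs at hx with hc
    cases hx
    exact ⟨hc.1, hc.2.choose_spec⟩
  · rintro ⟨hc, l, hl⟩
    have hex : c ∈ F ∧ ∃ x : Cho ℕ c.kind, ∃ l, ⟨l, c.move x.num⟩ ∈ Φ := ⟨hc, x, l, hl⟩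
    rw [dif_pos hex]
    obtain ⟨l', hl'⟩ := hex.2.choose_spec
    exact congrArg some (Cho.num_injective (h.unique hl' hl))

theorem ofPos_eq_none (h : LegalPos Φ) {c : Cluster} (hc : c ∈ F) :
    Asg.ofPos F Φ c = none ↔ ∀ m ∈ Φ, ∀ b, m.move ≠ c.move b := by
  constructor
  · rintro hn m hm b hb
    obtain ⟨d, x, rfl⟩ := h.eq_move hm
    obtain ⟨rfl, rfl⟩ := Cluster.move_inj hb
    rw [(ofPos_eq_some h).2 ⟨hc, _, hm⟩] at hn
    cases hn
  · intro hn
    by_contra hs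
    obtain ⟨x, hx⟩ := Option.ne_none_iff_exists'.1 hs
    obtain ⟨-, l, hl⟩ := (ofPos_eq_some h).1 hx
    exact hn _ hl _ rfl

theorem ofPos_of_notMem {c : Cluster} (hc : c ∉ F) : Asg.ofPos F Φ c = none := by
  unfold Asg.ofPos
  rw [dif_neg fun h => hc h.1]

theorem ofPos_snoc {c : Cluster} {x : Cho ℕ c.kind} {l : Player}
    (h : LegalPos (Φ ++ [⟨l, c.move x.num⟩])) :
    Asg.ofPos F (Φ ++ [⟨l, c.move x.num⟩]) =
      if c ∈ F then Function.update (Asg.ofPos F Φ) c (some x) else Asg.ofPos F Φ := by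
  have hΦ := h.of_append
  funext d
  have hiff : ∀ y : Cho ℕ d.kind, d ≠ c →
      (Asg.ofPos F (Φ ++ [⟨l, c.move x.num⟩]) d = some y ↔ Asg.ofPos F Φ d = some y) := by
    intro y hd
    rw [ofPos_eq_some h, ofPos_eq_some hΦ]
    refine and_congr_right fun _ => exists_congr fun k => ?_
    simp only [List.mem_append, List.mem_singleton, LabMove.mk.injEq, or_iff_left_iff_imp]
    exact fun h => absurd (Cluster.move_inj h.2).1 hd
  by_cases hd : d = c
  · subst hd
    split_ifs with hF
    · rw [Function.update_self]
      exact (ofPos_eq_some h).2 ⟨hF, l, by simp⟩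
    · rw [ofPos_of_notMem hF, ofPos_of_notMem hF]
  · have : Asg.ofPos F (Φ ++ [⟨l, c.move x.num⟩]) d = Asg.ofPos F Φ d :=
      Option.ext fun y => by simpa using hiff y hd
    split_ifs
    · rw [Function.update_of_ne hd, this]
    · exact this

theorem card_filter_update_lt {V : Type} {σ : Asg V} {c : Cluster} {x : Cho V c.kind} (hc : c ∈ F)
    (hσ : σ c = none) : (F.filter (Function.update σ c (some x) · = none)).card <
      (F.filter (σ · = none)).card := by
  refine Finset.card_lt_card ((Finset.ssubset_iff_of_subset fun d hd => ?_).2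
    ⟨c, by simp [hc, hσ], by simp⟩)
  simp only [Finset.mem_filter] at hd ⊢
  exact ⟨hd.1, by_contra fun hn => update_ne_none hn hd.2⟩

end OfPos

/-- If the machine `M` wins `E`, then every legal position that arises in a play can be won. It is
watched what `M` does if the environment makes no further move: either it moves in a cluster of `E`, or
it is content with the position, and this must remain so after any move of the environment. -/
theorem HPM.canWin {M : HPM} {E : Cirquent 0} (hM : M.IsLogicalSolution E) (n : ℕ) :
    ∀ (e : ℕ → List Move) (t : ℕ), LegalPos (M.branch e t).position →
      (E.clusters.filter (Asg.ofPos E.clusters (M.branch e t).position · = none)).card < n →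
      CanWin E (Asg.ofPos E.clusters (M.branch e t).position) := by
  induction n with
  | zero => exact fun _ _ _ h => absurd h (Nat.not_lt_zero _)
  | succ n ihn =>
    intro e₁ t hpos₁ hn
    -- the environment that stops moving at time `t`
    obtain ⟨e, he, hee⟩ : ∃ e : ℕ → List Move, (∀ s, t ≤ s → e s = []) ∧ ∀ s < t, e₁ s = e s :=
      ⟨fun s => if s < t then e₁ s else [], fun s hs => if_neg (not_lt.2 hs),
        fun s hs => (if_pos hs).symm⟩
    rw [M.branch_congr hee] at hpos₁ hn ⊢
    set σ := Asg.ofPos E.clusters (M.branch e t).position with hσ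
    have hrun : (M.run e).Legal ∧ ∀ I, WonLegal I (M.run e) E := by
      have hno : ¬ (M.run e).FirstIllegalBy .environment := by
        intro h
        obtain ⟨s, i, α, hi, hill⟩ := HPM.exists_of_firstIllegalBy h
        -- the moves of the environment are among the first ones, which are legal
        have key : ∀ s, t ≤ s → ∀ i : ℕ, (M.branch e s).position[i]? = some ⟨.environment, α⟩ →
            i < (M.branch e t).position.length := by
          intro s hs
          induction s, hs using Nat.le_induction with
          | base =>
            intro i hi
            exact (List.getElem?_eq_some_iff.1 hi).1
          | succ s hs ih =>
            intro i hi
            rw [HPM.position_succ, he s hs, List.map_nil, List.append_nil] at hi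
            rcases lt_or_ge i (M.branch e s).position.length with hlt | hge
            · rw [List.getElem?_append_left hlt] at hi
              exact ih i hi
            · rw [List.getElem?_append_right hge] at hi
              have hmem := List.mem_of_getElem? hi
              rcases M.own_eq_nil_or (M.branch e s) with h0 | ⟨w, h0⟩
              · simp [h0] at hmem
              · simp [h0] at hmem
        have hp : ∀ {r : ℕ}, i < (M.branch e t).position.length →
            (M.branch e r).position.take (i + 1) <+: (M.branch e (max r t)).position :=
          fun _ => (List.take_prefix _ _).trans (M.position_prefix e (le_max_left _ _))
        have hlt : i < (M.branch e t).position.length := by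
          refine key (max s t) (le_max_right _ _) i ?_
          obtain ⟨Ψ, h'⟩ := M.position_prefix e (le_max_left s t)
          obtain ⟨hi', -⟩ := List.getElem?_eq_some_iff.1 hi
          rw [← h', List.getElem?_append_left hi', hi]
        refine hill (hpos₁.of_prefix (List.prefix_of_prefix_length_le (hp hlt)
          (M.position_prefix e (le_max_right s t)) ?_))
        exact (List.length_take_le _ _).trans hlt
      have h := fun I => (hM I e).resolve_right hno
      exact ⟨(h fun _ => ∅).1, fun I => (h I).2⟩
    obtain ⟨hleg, hwon⟩ := hrun
    have hlegt := (M.legal_run_iff e).1 hleg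
    by_cases hmove : ∃ s, t ≤ s ∧ Asg.ofPos E.clusters (M.branch e s).position ≠ σ
    · classical
      obtain ⟨hts, hne⟩ := Nat.find_spec hmove
      have hmin := fun s h => Nat.find_min hmove (m := s) h
      generalize Nat.find hmove = s at hts hne hmin
      obtain ⟨s, rfl⟩ : ∃ r, s = r + 1 := by
        cases s with
        | zero => exact absurd (by rw [hσ, Nat.le_zero.1 hts]) hne
        | succ r => exact ⟨r, rfl⟩
      have hts' : t ≤ s := by
        rcases Nat.lt_or_ge s t with h | h
        · exact absurd (by rw [hσ, show t = s + 1 by omega]) hne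
        · exact h
      have hs : Asg.ofPos E.clusters (M.branch e s).position = σ := by
        by_contra h
        exact hmin s (Nat.lt_succ_self s) ⟨hts', h⟩
      have hpos := M.position_succ e s
      rw [he s hts', List.map_nil, List.append_nil] at hpos
      rcases M.own_eq_nil_or (M.branch e s) with h0 | ⟨w, h0⟩
      · rw [h0, List.append_nil] at hpos
        exact absurd (by rw [hpos, hs]) hne
      rw [h0] at hpos
      have hl := hlegt (s + 1)
      have hih := ihn e (s + 1) hl
      rw [hpos] at hl hih hne
      obtain ⟨-, c, x, hc, hfresh⟩ := legalPos_snoc.1 hl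
      obtain ⟨ho, rfl⟩ := LabMove.mk.inj hc
      rw [ofPos_snoc hl, hs] at hne hih
      split_ifs at hne hih with hcE
      · have hσc : σ c = none := by
          rw [← hs]
          exact (ofPos_eq_none (hlegt s) hcE).2 hfresh
        exact .move σ c x hcE hσc ho.symm
          (hih ((card_filter_update_lt hcE hσc).trans_le (Nat.lt_succ_iff.1 hn)))
      · exact absurd rfl hne
    · push Not at hmove
      refine .wait σ (fun I => ?_) fun c hc hσc ho x => ?_
      · refine (wonLegal_iff_ev hleg fun c hc x => ?_).1 (hwon I)
        rw [HPM.has_run_iff]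
        constructor
        · intro h
          exact ⟨t, ((ofPos_eq_some (hlegt t)).1 h).2⟩
        · rintro ⟨s, l, hl⟩
          rw [← hmove (max s t) (le_max_right _ _)]
          exact (ofPos_eq_some (hlegt _)).2
            ⟨hc, l, (M.position_prefix e (le_max_left _ _)).subset hl⟩
      · obtain ⟨e', he', hee'⟩ : ∃ e' : ℕ → List Move, e' t = [c.move x.num] ∧
            ∀ s < t, e s = e' s :=
          ⟨Function.update e t [c.move x.num], by simp,
            fun s hs => by rw [Function.update_of_ne hs.ne]⟩
        have hpos : (M.branch e' (t + 1)).position =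
            (M.branch e (t + 1)).position ++ [⟨.environment, c.move x.num⟩] := by
          rw [HPM.position_succ, HPM.position_succ, M.branch_congr hee', he', he t le_rfl]
          simp
        have hl : LegalPos ((M.branch e (t + 1)).position ++
            [⟨.environment, c.move x.num⟩]) := by
          refine legalPos_snoc.2 ⟨hlegt _, c, x, by rw [ho], ?_⟩
          refine (ofPos_eq_none (F := E.clusters) (hlegt (t + 1)) hc).1 ?_
          rw [hmove _ (Nat.le_succ t), hσc]
        have hih := ihn e' (t + 1) (hpos ▸ hl)
        rw [hpos, ofPos_snoc hl, if_pos hc, hmove _ (Nat.le_succ t)] at hih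
        exact hih ((card_filter_update_lt hc hσc).trans_le (Nat.lt_succ_iff.1 hn))

theorem Valid.provable {E : Cirquent 0} (h : Valid E) : Provable E := by
  obtain ⟨M, hM⟩ := h
  refine CanWin.provable_of_empty ?_
  have := M.canWin hM _ (fun _ => []) 0 legalPos_nil (Nat.lt_succ_self _)
  have h0 : Asg.ofPos E.clusters (M.branch (fun _ => []) 0).position = Asg.empty ℕ := by
    funext c
    unfold Asg.ofPos
    rw [dif_neg]
    · rfl
    · rintro ⟨-, x, l, hl⟩
      simp [HPM.branch, HPM.init] at hl
  rwa [h0] at this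

/-! ### Finite strategies -/

/-- A finite strategy for the symbolic game: a finite set of assignments, and for each of them the
machine's decision, to wait (`none`) or to make a certain move. -/
structure Strategy (F : Finset Cluster) (G : Asg Sym → Prop) where
  /-- the assignments to which play may lead -/
  nodes : Set (Asg Sym)
  finite : nodes.Finite
  /-- `none` for waiting, or else the cluster and the choice in it -/
  decision : Asg Sym → Option (Σ c : Cluster, Cho Sym c.kind)
  root : Asg.empty Sym ∈ nodes
  wait : ∀ q ∈ nodes, decision q = none → G q ∧
    ∀ c ∈ F, q c = none → ∀ x, EnvOpt c x → Function.update q c (some x) ∈ nodes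
  move : ∀ q ∈ nodes, ∀ c x, decision q = some ⟨c, x⟩ →
    q c = none ∧ MachOpt q c x ∧ Function.update q c (some x) ∈ nodes

theorem finite_envOpt (c : Cluster) : {x : Cho Sym c.kind | EnvOpt c x}.Finite := by
  obtain ⟨k, d⟩ := c
  cases k
  · exact Set.finite_empty.subset fun _ h => h.elim
  · exact (Set.toFinite (Set.univ : Set Bool)).subset fun _ _ => trivial
  · exact Set.finite_empty.subset fun _ h => h.elim
  · exact (Set.finite_singleton (Sym.copy d)).subset fun _ h => h

/-- As the environment has only finitely many symbolic moves, finitely many nodes are enough. -/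
theorem Win.exists_strategy {F : Finset Cluster} {G : Asg Sym → Prop}
    (h : Win F G (Asg.empty Sym)) : Nonempty (Strategy F G) := by
  classical
  -- the nodes of `Q` have what they need in `Q`
  let Closed (Q : Set (Asg Sym)) (q : Asg Sym) : Prop :=
    (G q ∧ ∀ c ∈ F, q c = none → ∀ x, EnvOpt c x → Function.update q c (some x) ∈ Q) ∨
      ∃ (c : Cluster) (x : Cho Sym c.kind), q c = none ∧ MachOpt q c x ∧
        Function.update q c (some x) ∈ Q
  have mono : ∀ {Q R q}, Q ⊆ R → Closed Q q → Closed R q := by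
    rintro Q R q hQR (⟨h1, h2⟩ | ⟨c, x, h1, h2, h3⟩)
    · exact .inl ⟨h1, fun c hc hn x hx => hQR (h2 c hc hn x hx)⟩
    · exact .inr ⟨c, x, h1, h2, hQR h3⟩
  have key : ∀ σ, Win F G σ → ∃ Q : Set (Asg Sym), Q.Finite ∧ σ ∈ Q ∧ ∀ q ∈ Q, Closed Q q := by
    intro σ h
    induction h with
    | wait σ hG _ ih =>
      have : ∀ (c : Cluster) (x : Cho Sym c.kind), ∃ Q : Set (Asg Sym), Q.Finite ∧
          (∀ q ∈ Q, Closed Q q) ∧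
          (c ∈ F → σ c = none → EnvOpt c x → Function.update σ c (some x) ∈ Q) := by
        intro c x
        by_cases h : c ∈ F ∧ σ c = none ∧ EnvOpt c x
        · obtain ⟨Q, h1, h2, h3⟩ := ih c h.1 h.2.1 x h.2.2
          exact ⟨Q, h1, h3, fun _ _ _ => h2⟩
        · exact ⟨∅, Set.finite_empty, fun _ h => h.elim, fun h1 h2 h3 => (h ⟨h1, h2, h3⟩).elim⟩
      choose Q hQ1 hQ2 hQ3 using this
      have hsub : ∀ c ∈ F, ∀ x, EnvOpt c x →
          Q c x ⊆ insert σ (⋃ c ∈ F, ⋃ x ∈ {x | EnvOpt c x}, Q c x) := by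
        intro c hc x hx q hq
        refine Set.mem_insert_of_mem _ ?_
        simp only [Set.mem_iUnion]
        exact ⟨c, hc, x, hx, hq⟩
      refine ⟨insert σ (⋃ c ∈ F, ⋃ x ∈ {x | EnvOpt c x}, Q c x), ?_, Set.mem_insert _ _, ?_⟩
      · refine Set.Finite.insert _ (Set.Finite.biUnion F.finite_toSet fun c _ => ?_)
        exact Set.Finite.biUnion (finite_envOpt c) fun x _ => hQ1 c x
      · rintro q (rfl | hq)
        · exact .inl ⟨hG, fun c hc hn x hx => hsub c hc x hx (hQ3 c x hc hn hx)⟩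
        · simp only [Set.mem_iUnion] at hq
          obtain ⟨c, hc, x, hx, hq⟩ := hq
          exact mono (hsub c hc x hx) (hQ2 c x q hq)
    | move σ c x hn hx _ ih =>
      obtain ⟨Q, h1, h2, h3⟩ := ih
      refine ⟨insert σ Q, h1.insert _, Set.mem_insert _ _, ?_⟩
      rintro q (rfl | hq)
      · exact .inr ⟨c, x, hn, hx, Set.mem_insert_of_mem _ h2⟩
      · exact mono (Set.subset_insert _ _) (h3 q hq)
  obtain ⟨Q, h1, h2, h3⟩ := key _ h
  let IsMove (q : Asg Sym) (m : Σ c : Cluster, Cho Sym c.kind) : Prop :=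
    q m.1 = none ∧ MachOpt q m.1 m.2 ∧ Function.update q m.1 (some m.2) ∈ Q
  refine ⟨⟨Q, h1, fun q => if h : ∃ m, IsMove q m then some h.choose else none, h2, ?_, ?_⟩⟩
  · intro q hq hd
    have hno : ¬ ∃ m, IsMove q m := fun h => by simp [h] at hd
    rcases h3 q hq with h | ⟨c, x, h⟩
    · exact h
    · exact (hno ⟨⟨c, x⟩, h⟩).elim
  · intro q hq c x hd
    split_ifs at hd with h
    have := h.choose_spec
    rwa [Option.some.inj hd] at this

/-! ### Symbolic choices and actual moves -/

/-- The symbolic choice that stands for an actual choice of the environment. -/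
def Cho.symb : (c : Cluster) → Cho ℕ c.kind → Cho Sym c.kind
  | ⟨.chor, _⟩, b => b
  | ⟨.chand, _⟩, b => b
  | ⟨.chexists, _⟩, a => Sym.const a
  | ⟨.chall, d⟩, _ => Sym.copy d

/-- In the position `Φ`, the symbol `s` stands for the number `a`. -/
def Sym.Means (Φ : Position) (s : Sym) (a : ℕ) : Prop :=
  s = .const a ∨ ∃ d, s = .copy d ∧ ⟨.environment, Cluster.move ⟨.chall, d⟩ a⟩ ∈ Φ

/-- In the position `Φ`, the symbolic choice `x` stands for the actual choice `y`. -/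
def Cho.Means (Φ : Position) : {k : ClusterKind} → Cho Sym k → Cho ℕ k → Prop
  | .chor, b, b' => b = b'
  | .chand, b, b' => b = b'
  | .chexists, s, a => Sym.Means Φ s a
  | .chall, s, a => Sym.Means Φ s a

theorem Cho.Means.mono {Φ Ψ : Position} (h : Φ ⊆ Ψ) {k : ClusterKind} {x : Cho Sym k}
    {y : Cho ℕ k} (hx : x.Means Φ y) : x.Means Ψ y := by
  have key : ∀ {s a}, Sym.Means Φ s a → Sym.Means Ψ s a := fun hs =>
    hs.imp_right fun ⟨d, h1, h2⟩ => ⟨d, h1, h h2⟩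
  cases k <;> first | exact hx | exact key hx

theorem Cho.means_symb {Φ : Position} {c : Cluster} {y : Cho ℕ c.kind}
    (h : ⟨c.kind.owner, c.move y.num⟩ ∈ Φ) : (Cho.symb c y).Means Φ y := by
  obtain ⟨k, d⟩ := c
  cases k
  · rfl
  · rfl
  · exact .inl rfl
  · exact .inr ⟨d, rfl, h⟩

theorem EnvOpt.symb {c : Cluster} (hc : c.kind.owner = .environment) (y : Cho ℕ c.kind) :
    EnvOpt c (Cho.symb c y) := by
  obtain ⟨k, d⟩ := c
  cases k
  · cases hc
  · trivial
  · cases hc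
  · rfl

/-- The `∀`-cluster from which the choice `x` of the machine is to be copied, if any. -/
def Cho.source : {k : ClusterKind} → Cho Sym k → Option ℕ
  | .chexists, .copy d => some d
  | _, _ => none

/-- A choice that need not be copied, as a number. -/
def Cho.plain : {k : ClusterKind} → Cho Sym k → Cho ℕ k
  | .chor, b => b
  | .chand, b => b
  | .chexists, .const a => a
  | .chexists, .copy _ => (0 : ℕ)
  | .chall, _ => (0 : ℕ)

/-- The part of the machine's move that is written without looking at the run tape. -/
def Cho.text (c : Cluster) (x : Cho Sym c.kind) : List Key :=
  match x.source with
  | none => c.move x.plain.num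
  | some _ => c.name ++ [.dot]

theorem Cho.means_plain {σ : Asg Sym} {Φ : Position} {c : Cluster} {x : Cho Sym c.kind}
    (hx : MachOpt σ c x) (h : x.source = none) : x.Means Φ x.plain := by
  obtain ⟨k, d⟩ := c
  cases k
  · rfl
  · rfl
  · cases x with
    | const a => exact .inl rfl
    | copy d => cases h
  · exact hx.elim

theorem Cho.means_copy {σ : Asg Sym} {Φ : Position} {c : Cluster} {x : Cho Sym c.kind} {d a : ℕ}
    (hx : MachOpt σ c x) (h : x.source = some d)
    (hd : ⟨.environment, Cluster.move ⟨.chall, d⟩ a⟩ ∈ Φ) :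
    σ ⟨.chall, d⟩ ≠ none ∧ ∃ y : Cho ℕ c.kind, y.num = a ∧ x.Means Φ y := by
  obtain ⟨k, i⟩ := c
  cases k
  · cases h
  · cases h
  · cases x with
    | const a => cases h
    | copy e =>
      cases h
      exact ⟨hx d rfl, a, rfl, .inr ⟨d, rfl, hd⟩⟩
  · cases h

/-- The beginning of a move, if it is long enough, determines the cluster, and the choice up to its
symbolic value. -/
theorem symb_eq_of_take_eq {K : ℕ} {c d : Cluster} {x : Cho ℕ c.kind} {y : Cho ℕ d.kind}
    (hK : c.name.length + 2 ≤ K) (h : (c.move x.num).take K = (d.move y.num).take K)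
    (hc : c.kind.owner = .environment) :
    ∃ e : c = d, Cho.symb c x = Cho.symb c (e ▸ y) := by
  have hcd : c = d := by
    obtain ⟨j, hj⟩ : ∃ j, K - c.name.length = j + 1 := ⟨K - c.name.length - 1, by omega⟩
    have h0 : (c.move x.num).take K = c.name ++ .dot :: (numeral x.num).take j := by
      rw [Cluster.move, List.take_append, List.take_of_length_le (by omega), hj,
        List.take_succ_cons]
    have h1 : c.name ++ Key.dot :: ((numeral x.num).take j ++ (d.move y.num).drop K) =
        d.name ++ .dot :: numeral y.num := by
      rw [← Cluster.move]
      conv_rhs => rw [← List.take_append_drop K (d.move y.num), ← h, h0]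
      simp
    exact Cluster.name_injective
      (append_cons_inj (dot_notMem_name c) (dot_notMem_name d) h1).1
  subst hcd
  refine ⟨rfl, ?_⟩
  obtain ⟨k, i⟩ := c
  cases k
  · cases hc
  · have hlen : ∀ z : Cho ℕ ClusterKind.chand,
        (Cluster.move ⟨.chand, i⟩ z.num).length ≤ K := by
      have h1 : ∀ z : Cho ℕ ClusterKind.chand, (numeral z.num).length = 1 := by
        intro z
        cases z <;> simp [Cho.num, numeral]
      intro z
      simp only [Cluster.move, List.length_append, List.length_cons, h1]
      omega
    rw [List.take_of_length_le (hlen x), List.take_of_length_le (hlen y)] at h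
    exact Cho.num_injective (Cluster.move_inj h).2
  · cases hc
  · rfl

/-! ### The content of the run tape -/

theorem spell_append (Φ Ψ : Position) : spell (Φ ++ Ψ) = spell Φ ++ spell Ψ :=
  List.flatMap_append

theorem spell_cons (m : LabMove) (Φ : Position) :
    spell (m :: Φ) = .label m.player :: (m.move.map .key ++ spell Φ) := rfl

/-- The cell `h` of the run tape is in a move of player `p`, or directly behind it; `m` is the part of
the move to the left of that cell, and `w` is the rest. -/
def Loc (Φ : Position) (h : ℕ) (p : Player) (m w : List Key) : Prop :=
  ∃ Φ₁ Φ₂, Φ = Φ₁ ++ ⟨p, m ++ w⟩ :: Φ₂ ∧ h = (spell Φ₁).length + 1 + m.length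

theorem Loc.le_length {Φ : Position} {h : ℕ} {p : Player} {m w : List Key} (hl : Loc Φ h p m w) :
    h ≤ (spell Φ).length := by
  obtain ⟨Φ₁, Φ₂, rfl, rfl⟩ := hl
  rw [spell_append, spell_cons]
  simp
  omega

theorem Loc.append {Φ : Position} {h : ℕ} {p : Player} {m w : List Key} (hl : Loc Φ h p m w)
    (Ψ : Position) : Loc (Φ ++ Ψ) h p m w := by
  obtain ⟨Φ₁, Φ₂, rfl, hh⟩ := hl
  exact ⟨Φ₁, Φ₂ ++ Ψ, by simp, hh⟩

theorem Loc.mem {Φ : Position} {h : ℕ} {p : Player} {m w : List Key} (hl : Loc Φ h p m w) :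
    ⟨p, m ++ w⟩ ∈ Φ := by
  obtain ⟨Φ₁, Φ₂, rfl, -⟩ := hl
  simp

theorem getElem?_length_append {α : Type*} (u r : List α) : (u ++ r)[u.length]? = r.head? := by
  rw [List.getElem?_append_right le_rfl, Nat.sub_self, List.head?_eq_getElem?]

theorem spell_getElem? {Φ₁ Φ₂ : Position} {p : Player} {m w : List Key} :
    (spell (Φ₁ ++ ⟨p, m ++ w⟩ :: Φ₂))[(spell Φ₁).length + 1 + m.length]? =
      (w.map RunSymbol.key ++ spell Φ₂).head? := by
  have : spell (Φ₁ ++ ⟨p, m ++ w⟩ :: Φ₂) =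
      (spell Φ₁ ++ RunSymbol.label p :: m.map RunSymbol.key) ++ (w.map RunSymbol.key ++ spell Φ₂) := by
    rw [spell_append, spell_cons]
    simp
  rw [this, ← getElem?_length_append (spell Φ₁ ++ RunSymbol.label p :: m.map RunSymbol.key)]
  simp [Nat.add_comm, Nat.add_left_comm]

theorem Loc.key {Φ : Position} {h : ℕ} {p : Player} {m w : List Key} {k : Key}
    (hl : Loc Φ h p m w) (hk : (spell Φ)[h]? = some (.key k)) :
    ∃ w', w = k :: w' ∧ Loc Φ (h + 1) p (m ++ [k]) w' := by
  obtain ⟨Φ₁, Φ₂, rfl, rfl⟩ := hl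
  rw [spell_getElem?] at hk
  cases w with
  | nil =>
    cases Φ₂ with
    | nil => simp [spell] at hk
    | cons a Φ₂ => simp [spell_cons] at hk
  | cons k' w =>
    simp at hk
    subst hk
    exact ⟨w, rfl, Φ₁, Φ₂, by simp, by simp; omega⟩

theorem Loc.label {Φ : Position} {h : ℕ} {p l : Player} {m w : List Key}
    (hl : Loc Φ h p m w) (hk : (spell Φ)[h]? = some (.label l)) :
    w = [] ∧ ∃ w', Loc Φ (h + 1) l [] w' := by
  obtain ⟨Φ₁, Φ₂, rfl, rfl⟩ := hl
  rw [spell_getElem?] at hk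
  cases w with
  | cons k' w => simp at hk
  | nil =>
    cases Φ₂ with
    | nil => simp [spell] at hk
    | cons a Φ₂ =>
      simp [spell_cons] at hk
      subst hk
      refine ⟨rfl, a.move, Φ₁ ++ [⟨p, m⟩], Φ₂, by simp, ?_⟩
      simp [spell]
      omega

theorem Loc.none {Φ : Position} {h : ℕ} {p : Player} {m w : List Key}
    (hl : Loc Φ h p m w) (hk : (spell Φ)[h]? = none) : w = [] := by
  obtain ⟨Φ₁, Φ₂, rfl, rfl⟩ := hl
  rw [spell_getElem?] at hk
  cases w with
  | cons k' w => simp at hk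
  | nil => rfl

/-- At the end of a move, there is no symbol of a move. -/
theorem Loc.eq_nil_of_not_key {Φ : Position} {h : ℕ} {p : Player} {m w : List Key}
    (hl : Loc Φ h p m w) (hk : ∀ k, (spell Φ)[h]? ≠ some (.key k)) : w = [] := by
  rcases hs : (spell Φ)[h]? with _ | l | k
  · exact hl.none hs
  · exact (hl.label hs).1
  · exact absurd hs (hk k)

theorem Loc.not_key {Φ : Position} {h : ℕ} {p : Player} {m : List Key}
    (hl : Loc Φ h p m []) (k : Key) : (spell Φ)[h]? ≠ some (.key k) := by
  intro hk
  obtain ⟨w', hw, -⟩ := hl.key hk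
  cases hw

/-- A cell behind the first one is in one move only. -/
theorem Loc.unique {Φ : Position} {h : ℕ} {p p' : Player} {m m' w w' : List Key}
    (hl : Loc Φ h p m w) (hl' : Loc Φ h p' m' w') : p = p' ∧ m = m' ∧ w = w' := by
  obtain ⟨Φ₁, Φ₂, rfl, hh⟩ := hl
  obtain ⟨Φ₁', Φ₂', he, hh'⟩ := hl'
  -- neither of the two moves can be before the other one
  have key : ∀ {Φ₁ Φ₂ Φ₁' Φ₂' : Position} {p p' : Player} {m m' w w' : List Key},
      Φ₁ ++ ⟨p, m ++ w⟩ :: Φ₂ = Φ₁' ++ ⟨p', m' ++ w'⟩ :: Φ₂' → Φ₁.length < Φ₁'.length →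
      (spell Φ₁).length + m.length < (spell Φ₁').length + m'.length := by
    intro Φ₁ Φ₂ Φ₁' Φ₂' p p' m m' w w' he hlt
    have hpre : Φ₁ ++ [⟨p, m ++ w⟩] <+: Φ₁' := by
      refine List.prefix_of_prefix_length_le (l₃ := Φ₁' ++ ⟨p', m' ++ w'⟩ :: Φ₂') ?_
        (List.prefix_append _ _) (by simpa using hlt)
      rw [← he]
      exact ⟨Φ₂, by simp⟩
    obtain ⟨Ψ, rfl⟩ := hpre
    simp [spell]
    omega
  rcases lt_trichotomy Φ₁.length Φ₁'.length with hlt | heq | hgt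
  · have := key he hlt
    omega
  · obtain ⟨rfl, h2⟩ := List.append_inj he heq
    simp only [List.cons.injEq, LabMove.mk.injEq] at h2
    have hm : m.length = m'.length := by omega
    obtain ⟨h3, h4⟩ := List.append_inj h2.1.2 hm
    exact ⟨h2.1.1, h3, h4⟩
  · have := key he.symm hgt
    omega

theorem spell_zero {Φ : Position} {s : RunSymbol} (h : (spell Φ)[0]? = some s) :
    ∃ l w, s = .label l ∧ Loc Φ 1 l [] w := by
  cases Φ with
  | nil => simp [spell] at h
  | cons m Φ =>
    simp [spell_cons] at h
    exact ⟨m.player, m.move, h.symm, [], Φ, rfl, by simp [spell]⟩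

theorem loc_of_label {Φ : Position} {h : ℕ} {l : Player} (hk : (spell Φ)[h]? = some (.label l)) :
    ∃ w, Loc Φ (h + 1) l [] w := by
  induction Φ generalizing h with
  | nil => simp [spell] at hk
  | cons m Φ ih =>
    rw [spell_cons] at hk
    cases h with
    | zero =>
      simp at hk
      subst hk
      exact ⟨m.move, [], Φ, rfl, by simp [spell]⟩
    | succ h =>
      rw [List.getElem?_cons_succ] at hk
      rcases lt_or_ge h (m.move.map RunSymbol.key).length with hlt | hge
      · rw [List.getElem?_append_left hlt] at hk
        simp at hk
      · rw [List.getElem?_append_right hge] at hk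
        obtain ⟨w, Φ₁, Φ₂, rfl, hh⟩ := ih hk
        refine ⟨w, m :: Φ₁, Φ₂, rfl, ?_⟩
        simp only [List.length_map] at hge hh
        simp [spell_cons] at hh ⊢
        omega

/-- In a legal position there are no empty moves, so labels are not adjacent. -/
theorem LegalPos.not_adjacent {Φ : Position} (hΦ : LegalPos Φ) {h : ℕ} {l l' : Player}
    (h1 : (spell Φ)[h]? = some (.label l)) (h2 : (spell Φ)[h + 1]? = some (.label l')) : False := by
  obtain ⟨w, hl⟩ := loc_of_label h1
  obtain ⟨rfl, -⟩ := hl.label h2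
  obtain ⟨c, x, hm⟩ := hΦ.eq_move hl.mem
  have := (LabMove.mk.inj hm).2
  simp [Cluster.move] at this

/-! ### The machine that follows a finite strategy -/

/-- Strings of keys of length at most `K`. -/
abbrev Word (K : ℕ) : Type := {l : List Key // l.length ≤ K}

instance : Finite Key := by
  refine Finite.of_surjective (fun s : Fin 10 ⊕ Unit ⊕ Fin 4 => match s with
    | .inl d => Key.digit d
    | .inr (.inl _) => Key.dot
    | .inr (.inr 0) => Key.kind .chor
    | .inr (.inr 1) => Key.kind .chand
    | .inr (.inr 2) => Key.kind .chexists
    | .inr (.inr 3) => Key.kind .chall) ?_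
  rintro (d | _ | (_ | _ | _ | _))
  exacts [⟨.inl d, rfl⟩, ⟨.inr (.inl ()), rfl⟩, ⟨.inr (.inr 0), rfl⟩, ⟨.inr (.inr 1), rfl⟩,
    ⟨.inr (.inr 2), rfl⟩, ⟨.inr (.inr 3), rfl⟩]

instance (K : ℕ) : Finite (Word K) := (List.finite_length_le Key K).to_subtype

/-- The first `K` keys of a string. -/
def Word.clip (K : ℕ) (l : List Key) : Word K := ⟨l.take K, by simp⟩

/-- What the machine is doing at a node of its strategy. -/
inductive Phase (K : ℕ) : Type
  /-- `l` is still to be written into the buffer -/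
  | write (l : Word K)
  /-- moving to the left end of the run tape -/
  | rewind
  /-- one step to the left of a label; this is the left end if there is a label here, too -/
  | atLabel
  /-- moving to the next label -/
  | skip
  /-- reading a move of the environment, which so far begins with `l` -/
  | read (l : Word K)
  /-- copying the rest of the current move into the buffer -/
  | copy
  /-- the move state: the machine has made its move -/
  | moved

instance (K : ℕ) : Finite (Phase K) := by
  refine Finite.of_surjective (fun s : Word K ⊕ Word K ⊕ Fin 5 => match s with
    | .inl l => Phase.write l
    | .inr (.inl l) => Phase.read l
    | .inr (.inr 0) => Phase.rewind
    | .inr (.inr 1) => Phase.atLabel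
    | .inr (.inr 2) => Phase.skip
    | .inr (.inr 3) => Phase.copy
    | .inr (.inr 4) => Phase.moved) ?_
  rintro (l | _ | _ | _ | l | _ | _)
  exacts [⟨.inl l, rfl⟩, ⟨.inr (.inr 0), rfl⟩, ⟨.inr (.inr 1), rfl⟩, ⟨.inr (.inr 2), rfl⟩,
    ⟨.inr (.inl l), rfl⟩, ⟨.inr (.inr 3), rfl⟩, ⟨.inr (.inr 4), rfl⟩]

namespace Strategy

variable {F : Finset Cluster} {G : Asg Sym → Prop} (S : Strategy F G) (K : ℕ)

/-- The states of the machine. -/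
abbrev State : Type := S.nodes × Phase K

/-- What a transition consists of: the new state, the motion of the head of the run tape, and the symbol
appended to the buffer. -/
abbrev Trans : Type := S.State K × Option Turing.Dir × Option Key

/-- The phase in which the work at a node begins. -/
def startPhase (q : Asg Sym) : Phase K :=
  match S.decision q with
  | none => .rewind
  | some ⟨c, x⟩ => .write (Word.clip K (x.text c))

open Classical in
/-- The state in which the work at the node `q` begins. -/
noncomputable def entry (q : Asg Sym) : S.State K :=
  if h : q ∈ S.nodes then (⟨q, h⟩, S.startPhase K q) else (⟨_, S.root⟩, .skip)

variable {K}

/-- One step to the right over the run tape, remembering the beginning of the current move if it is the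
environment's. At the right end, the machine waits for the next move. -/
def scan (q : S.nodes) (f : Phase K) : Option RunSymbol → S.Trans K
  | none => ((q, f), none, none)
  | some (.label .machine) => ((q, .skip), some .right, none)
  | some (.label .environment) => ((q, .read (Word.clip K [])), some .right, none)
  | some (.key k) =>
      ((q, match f with
        | .read l => .read (Word.clip K (l.1 ++ [k]))
        | f => f), some .right, none)

/-- The environment has made the choice `y` in the cluster `c` of `F`, unresolved at `q`, if it has made
a move that begins with `l`. -/
def Detects (F : Finset Cluster) (q : Asg Sym) (l : Word K) (m : Σ c : Cluster, Cho ℕ c.kind) :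
    Prop :=
  m.1 ∈ F ∧ m.1.kind.owner = .environment ∧ q m.1 = none ∧ l.1 = (m.1.move m.2.num).take K

open Classical in
/-- The transition function. -/
noncomputable def trans (q : S.nodes) : Phase K → Option RunSymbol → S.Trans K
  | .write ⟨[], _⟩, _ =>
      ((q, if ∃ c x, S.decision q = some ⟨c, x⟩ ∧ x.source ≠ none then .rewind else .moved),
        none, none)
  | .write ⟨k :: l, h⟩, _ => ((q, .write ⟨l, (Nat.le_succ _).trans h⟩), none, some k)
  | .rewind, some (.label _) => ((q, .atLabel), some .left, none)
  | .rewind, _ => ((q, .rewind), some .left, none)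
  | .atLabel, some (.label _) => ((q, .skip), none, none)
  | .atLabel, _ => ((q, .rewind), some .left, none)
  | .skip, s => S.scan q .skip s
  | .read l, s =>
      match S.decision q with
      | none =>
          if h : (∀ k, s ≠ some (.key k)) ∧ ∃ m, Detects F q l m then
            (S.entry K (Function.update q.1 h.2.choose.1
              (some (Cho.symb h.2.choose.1 h.2.choose.2))), none, none)
          else S.scan q (.read l) s
      | some ⟨_, x⟩ =>
          if ∃ d, x.source = some d ∧ l.1 = Cluster.name ⟨.chall, d⟩ ++ [.dot] then
            ((q, .copy), none, none)
          else S.scan q (.read l) s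
  | .copy, some (.key k) => ((q, .copy), some .right, some k)
  | .copy, _ => ((q, .moved), none, none)
  | .moved, _ =>
      match S.decision q with
      | none => (S.entry K q, none, none)
      | some ⟨c, x⟩ => (S.entry K (Function.update q.1 c (some x)), none, none)

variable (K)

instance : Finite S.nodes := S.finite.to_subtype

/-- The machine that follows the strategy `S`. It has no work tapes. -/
noncomputable def machine : HPM where
  State := S.State K
  Symbol := Unit
  Tp := Empty
  start := S.entry K (Asg.empty Sym)
  moveStates := {s | s.2 = .moved}
  step s a _ :=
    { next := (S.trans s.1 s.2 a).1
      write := Empty.elim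
      moveWork := Empty.elim
      moveRun := (S.trans s.1 s.2 a).2.1
      append := (S.trans s.1 s.2 a).2.2 }

theorem entry_of_mem {q : Asg Sym} (h : q ∈ S.nodes) :
    S.entry K q = (⟨q, h⟩, S.startPhase K q) := dif_pos h

/-- The bounds on `K` that make sure that the machine can keep in mind what it has to. -/
structure Bound : Prop where
  text : ∀ q ∈ S.nodes, ∀ c x, S.decision q = some ⟨c, x⟩ → (Cho.text c x).length ≤ K
  name : ∀ c ∈ F, c.name.length + 2 ≤ K

theorem exists_bound : ∃ K, S.Bound K := by
  obtain ⟨K₁, h₁⟩ : ∃ K, ∀ q ∈ S.nodes, ∀ c x, S.decision q = some ⟨c, x⟩ →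
      (Cho.text c x).length ≤ K := by
    obtain ⟨K, hK⟩ := (S.finite.image fun q => match S.decision q with
      | none => 0
      | some ⟨c, x⟩ => (Cho.text c x).length).bddAbove
    refine ⟨K, fun q hq c x h => ?_⟩
    have := hK (Set.mem_image_of_mem _ hq)
    simpa only [h] using this
  refine ⟨max K₁ (F.sup fun c => c.name.length + 2), fun q hq c x h =>
    (h₁ q hq c x h).trans (le_max_left _ _), fun c hc => ?_⟩
  exact (Finset.le_sup (f := fun c => c.name.length + 2) hc).trans (le_max_right _ _)

/-! ### Safety: the machine's knowledge is correct, and its moves are legal -/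

/-- The node `q` describes the position `Φ` correctly, as far as it goes: its choices have been made, all
choices of the machine are in it, and its choices of the environment are in clusters of `F`. The
cluster of a move that the machine has just made is `just`. -/
structure Knows (F : Finset Cluster) (q : Asg Sym) (just : Option Cluster) (Φ : Position) :
    Prop where
  made : ∀ c x, q c = some x → ∃ y : Cho ℕ c.kind, ⟨c.kind.owner, c.move y.num⟩ ∈ Φ ∧ x.Means Φ y
  machine : ∀ m ∈ Φ, m.player = .machine → ∃ c a, m.move = c.move a ∧ (q c ≠ none ∨ just = some c)
  env : ∀ c, q c ≠ none → c.kind.owner = .environment → c ∈ F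

variable {K}

/-- What is known in each phase. -/
def PhaseInv (q : Asg Sym) (f : Phase K) (h : ℕ) (b : List Key) (Φ : Position) : Prop :=
  match f with
  | .write l => Knows F q none Φ ∧ ∃ c x, S.decision q = some ⟨c, x⟩ ∧ b ++ l.1 = x.text c
  | .rewind => Knows F q none Φ ∧ (S.decision q = none ∧ b = [] ∨
      ∃ c x d, S.decision q = some ⟨c, x⟩ ∧ x.source = some d ∧ b = x.text c)
  | .atLabel => Knows F q none Φ ∧ (S.decision q = none ∧ b = [] ∨
      ∃ c x d, S.decision q = some ⟨c, x⟩ ∧ x.source = some d ∧ b = x.text c) ∧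
      ∃ h' l, h = h' - 1 ∧ (spell Φ)[h']? = some (.label l)
  | .skip => Knows F q none Φ ∧ (S.decision q = none ∧ b = [] ∨
      ∃ c x d, S.decision q = some ⟨c, x⟩ ∧ x.source = some d ∧ b = x.text c) ∧
      (h = 0 ∨ ∃ m w, Loc Φ h .machine m w)
  | .read l => Knows F q none Φ ∧ (S.decision q = none ∧ b = [] ∨
      ∃ c x d, S.decision q = some ⟨c, x⟩ ∧ x.source = some d ∧ b = x.text c) ∧
      ∃ m w, Loc Φ h .environment m w ∧ l.1 = m.take K
  | .copy => Knows F q none Φ ∧ ∃ c x d, S.decision q = some ⟨c, x⟩ ∧ x.source = some d ∧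
      ∃ r w, Loc Φ h .environment (Cluster.name ⟨.chall, d⟩ ++ .dot :: r) w ∧ b = x.text c ++ r
  | .moved => b = [] ∧ ∃ c x, S.decision q = some ⟨c, x⟩ ∧ Knows F q (some c) Φ ∧
      ∃ y : Cho ℕ c.kind, ⟨c.kind.owner, c.move y.num⟩ ∈ Φ ∧ x.Means Φ y

/-- The invariant of the machine. -/
def Inv (C : (S.machine K).Config) : Prop :=
  S.PhaseInv C.state.1 C.state.2 C.runHead C.buffer C.position

theorem Knows.append {q : Asg Sym} {just : Option Cluster} {Φ : Position}
    (h : Knows F q just Φ) (e : List Move) :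
    Knows F q just (Φ ++ e.map fun α => ⟨.environment, α⟩) where
  made c x hx := by
    obtain ⟨y, h1, h2⟩ := h.made c x hx
    exact ⟨y, List.mem_append_left _ h1, h2.mono (List.subset_append_left _ _)⟩
  machine m hm hp := by
    rcases List.mem_append.1 hm with hm | hm
    · exact h.machine m hm hp
    · obtain ⟨α, -, rfl⟩ := List.mem_map.1 hm
      cases hp
  env := h.env

theorem PhaseInv.append {q : Asg Sym} {f : Phase K} {h : ℕ} {b : List Key} {Φ : Position}
    (hi : S.PhaseInv q f h b Φ) (e : List Move) :
    S.PhaseInv q f h b (Φ ++ e.map fun α => ⟨.environment, α⟩) := by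
  have hget : ∀ {i : ℕ} {s : RunSymbol} (Ψ : Position), (spell Φ)[i]? = some s → (spell (Φ ++ Ψ))[i]? = some s := by
    intro i s Ψ hs
    obtain ⟨hi, -⟩ := List.getElem?_eq_some_iff.1 hs
    rw [spell_append, List.getElem?_append_left hi, hs]
  cases f with
  | write l => exact ⟨hi.1.append e, hi.2⟩
  | rewind => exact ⟨hi.1.append e, hi.2⟩
  | atLabel =>
    obtain ⟨h1, h2, h', l, h3, h4⟩ := hi
    exact ⟨h1.append e, h2, h', l, h3, hget _ h4⟩
  | skip =>
    obtain ⟨h1, h2, h3⟩ := hi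
    exact ⟨h1.append e, h2, h3.imp_right fun ⟨m, w, hl⟩ => ⟨m, w, hl.append _⟩⟩
  | read l =>
    obtain ⟨h1, h2, m, w, hl, h3⟩ := hi
    exact ⟨h1.append e, h2, m, w, hl.append _, h3⟩
  | copy =>
    obtain ⟨h1, c, x, d, h2, h3, r, w, hl, h4⟩ := hi
    exact ⟨h1.append e, c, x, d, h2, h3, r, w, hl.append _, h4⟩
  | moved =>
    obtain ⟨h1, c, x, h2, h3, y, h4, h5⟩ := hi
    exact ⟨h1, c, x, h2, h3.append e, y, List.mem_append_left _ h4,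
      h5.mono (List.subset_append_left _ _)⟩

/-- The symbol that the machine reads. -/
def sym (C : (S.machine K).Config) : Option RunSymbol := (spell C.position)[C.runHead]?

/-- The transition that the machine makes. -/
noncomputable def act (C : (S.machine K).Config) : S.Trans K :=
  S.trans C.state.1 C.state.2 (S.sym C)

theorem startPhase_ne_moved (q : Asg Sym) : S.startPhase K q ≠ .moved := by
  unfold startPhase
  split <;> simp

/-- The invariant at the beginning of the work at a node. -/
theorem phaseInv_start (hK : S.Bound K) {q : Asg Sym} (hq : q ∈ S.nodes) {h : ℕ} {Φ : Position}
    (hk : Knows F q none Φ) : S.PhaseInv q (S.startPhase K q) h [] Φ := by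
  unfold startPhase
  split
  · rename_i hd
    exact ⟨hk, .inl ⟨hd, rfl⟩⟩
  · rename_i c x hd
    exact ⟨hk, c, x, hd, List.take_of_length_le (hK.text q hq c x hd)⟩

theorem Knows.update {q : Asg Sym} {Φ : Position} {c : Cluster} {x : Cho Sym c.kind}
    {y : Cho ℕ c.kind} {just : Option Cluster} (h : Knows F q just Φ)
    (hjust : ∀ d, just = some d → d = c)
    (hy : ⟨c.kind.owner, c.move y.num⟩ ∈ Φ) (hxy : x.Means Φ y)
    (hc : c.kind.owner = .environment → c ∈ F) :
    Knows F (Function.update q c (some x)) none Φ where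
  made d z hz := by
    by_cases hd : d = c
    · subst hd
      rw [Function.update_self] at hz
      cases hz
      exact ⟨y, hy, hxy⟩
    · rw [Function.update_of_ne hd] at hz
      exact h.made d z hz
  machine m hm hp := by
    obtain ⟨d, a, h1, h2⟩ := h.machine m hm hp
    refine ⟨d, a, h1, .inl ?_⟩
    by_cases hd : d = c
    · subst hd
      simp
    · rw [Function.update_of_ne hd]
      exact h2.resolve_right fun hj => hd (hjust d hj)
  env d hd ho := by
    by_cases hdc : d = c
    · subst hdc
      exact hc ho
    · rw [Function.update_of_ne hdc] at hd
      exact h.env d hd ho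

/-- A move of the environment that is detected has really been made. -/
theorem detected (hK : S.Bound K) {q : Asg Sym} {Φ : Position} (hΦ : LegalPos Φ) {h : ℕ}
    {m : List Key} (hl : Loc Φ h .environment m []) {l : Word K} (hlm : l.1 = m.take K)
    {n : Σ c : Cluster, Cho ℕ c.kind} (hn : Detects F q l n) :
    ∃ y : Cho ℕ n.1.kind, ⟨n.1.kind.owner, n.1.move y.num⟩ ∈ Φ ∧ Cho.symb n.1 n.2 = Cho.symb n.1 y := by
  obtain ⟨c, x⟩ := n
  obtain ⟨hc, ho, -, hlx⟩ := hn
  have hmem := hl.mem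
  rw [List.append_nil] at hmem
  obtain ⟨d, y, hm⟩ := hΦ.eq_move hmem
  obtain ⟨-, rfl⟩ := LabMove.mk.inj hm
  obtain ⟨rfl, hs⟩ := symb_eq_of_take_eq (hK.name c hc) (hlx.symm.trans hlm) ho
  exact ⟨y, hm ▸ hmem, hs⟩

theorem scan_phase_ne_moved (q : S.nodes) {f : Phase K} (hf : f ≠ .moved) (s : Option RunSymbol) :
    (S.scan q f s).1.2 ≠ .moved := by
  unfold scan
  split <;> simp only [ne_eq]
  · exact hf
  · simp
  · simp
  · split
    · simp
    · exact hf

/-- Scanning preserves the invariant. -/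
theorem phaseInv_scan {q : S.nodes} {f : Phase K} {h : ℕ} {b : List Key} {Φ : Position}
    (hf : f = .skip ∨ ∃ l, f = .read l) (hi : S.PhaseInv q f h b Φ) :
    S.PhaseInv (S.scan q f (spell Φ)[h]?).1.1 (S.scan q f (spell Φ)[h]?).1.2
      (HPM.shiftHead h (S.scan q f (spell Φ)[h]?).2.1)
      (b ++ (S.scan q f (spell Φ)[h]?).2.2.toList) Φ := by
  have hk : Knows F q none Φ := by
    rcases hf with rfl | ⟨l, rfl⟩ <;> exact hi.1
  have hd : S.decision q = none ∧ b = [] ∨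
      ∃ c x d, S.decision q = some ⟨c, x⟩ ∧ x.source = some d ∧ b = x.text c := by
    rcases hf with rfl | ⟨l, rfl⟩ <;> exact hi.2.1
  have hlabel : ∀ l, (spell Φ)[h]? = some (.label l) → ∃ w, Loc Φ (h + 1) l [] w :=
    fun l hl => loc_of_label hl
  rcases hs : (spell Φ)[h]? with _ | (_ | _) | k
  · simpa [scan, HPM.shiftHead] using hi
  · obtain ⟨w, hw⟩ := hlabel _ hs
    simp only [scan, HPM.shiftHead, Option.toList_none, List.append_nil]
    exact ⟨hk, hd, .inr ⟨_, _, hw⟩⟩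
  · obtain ⟨w, hw⟩ := hlabel _ hs
    simp only [scan, HPM.shiftHead, Option.toList_none, List.append_nil]
    exact ⟨hk, hd, _, _, hw, by simp [Word.clip]⟩
  · simp only [scan, HPM.shiftHead, Option.toList_none, List.append_nil]
    rcases hf with rfl | ⟨l, rfl⟩
    · refine ⟨hk, hd, .inr ?_⟩
      rcases hi.2.2 with rfl | ⟨m, w, hl⟩
      · obtain ⟨_, _, h0, -⟩ := spell_zero hs
        cases h0
      · obtain ⟨w', -, hl'⟩ := hl.key hs
        exact ⟨_, _, hl'⟩
    · obtain ⟨m, w, hl, hm⟩ := hi.2.2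
      obtain ⟨w', -, hl'⟩ := hl.key hs
      refine ⟨hk, hd, _, _, hl', ?_⟩
      simp only [Word.clip, hm]
      rw [List.take_append, List.take_append, List.take_take, min_self]
      congr 1
      rcases Nat.le_total K m.length with h1 | h1
      · rw [List.length_take, min_eq_left h1, Nat.sub_self, Nat.sub_eq_zero_of_le h1]
      · rw [List.length_take, min_eq_right h1]

/-- The transition `T` from a position `Φ`, where the head of the run tape is at `h` and `b` is in the
buffer, leads to a legal position in which the invariant holds, as long as the environment does not
move. -/
def StepOK (h : ℕ) (b : List Key) (Φ : Position) (T : S.Trans K) : Prop :=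
  open Classical in
  LegalPos (Φ ++ if T.1.2 = .moved then [⟨.machine, b ++ T.2.2.toList⟩] else []) ∧
    S.PhaseInv T.1.1 T.1.2 (HPM.shiftHead h T.2.1)
      (if T.1.2 = .moved then [] else b ++ T.2.2.toList)
      (Φ ++ if T.1.2 = .moved then [⟨.machine, b ++ T.2.2.toList⟩] else [])

theorem stepOK_of_ne {h : ℕ} {b : List Key} {Φ : Position} {T : S.Trans K} (hT : T.1.2 ≠ .moved)
    (hΦ : LegalPos Φ)
    (hi : S.PhaseInv T.1.1 T.1.2 (HPM.shiftHead h T.2.1) (b ++ T.2.2.toList) Φ) :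
    S.StepOK h b Φ T := by
  unfold StepOK
  rw [if_neg hT, if_neg hT, List.append_nil]
  exact ⟨hΦ, hi⟩

theorem stepOK_moved {q : S.nodes} {h : ℕ} {b : List Key} {Φ : Position} (hΦ : LegalPos Φ)
    (hk : Knows F q none Φ) {c : Cluster} {x : Cho Sym c.kind} (hd : S.decision q = some ⟨c, x⟩)
    {y : Cho ℕ c.kind} (hb : b = c.move y.num) (hy : x.Means Φ y) :
    S.StepOK (K := K) h b Φ ((q, .moved), none, none) := by
  obtain ⟨hn, hm, -⟩ := S.move q q.2 c x hd
  unfold StepOK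
  rw [if_pos rfl, if_pos rfl, Option.toList_none, List.append_nil, hb]
  refine ⟨legalPos_snoc.2 ⟨hΦ, c, y, by rw [hm.owner], fun m hmΦ a ha => ?_⟩, rfl, c, x, hd,
    ⟨fun d z hz => ?_, fun m hmΦ hp => ?_, hk.env⟩, y, ?_, hy.mono (List.subset_append_left _ _)⟩
  · obtain ⟨d, z, rfl⟩ := hΦ.eq_move hmΦ
    obtain ⟨rfl, -⟩ := Cluster.move_inj ha
    obtain ⟨d', a', h1, h2⟩ := hk.machine _ hmΦ hm.owner
    obtain ⟨rfl, -⟩ := Cluster.move_inj h1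
    exact h2.elim (fun h => h hn) (fun h => by cases h)
  · obtain ⟨y', h1, h2⟩ := hk.made d z hz
    exact ⟨y', List.mem_append_left _ h1, h2.mono (List.subset_append_left _ _)⟩
  · rcases List.mem_append.1 hmΦ with hmΦ | hmΦ
    · obtain ⟨d, a, h1, h2⟩ := hk.machine m hmΦ hp
      exact ⟨d, a, h1, .inl (h2.resolve_right fun h => by cases h)⟩
    · rw [List.mem_singleton.1 hmΦ]
      exact ⟨c, y.num, rfl, .inr rfl⟩
  · rw [hm.owner]
    simp

/-- After the work at a node has been finished or a move of the environment has been detected, work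
begins at the next node. -/
theorem stepOK_entry (hK : S.Bound K) {q : Asg Sym} (hq : q ∈ S.nodes) {h : ℕ} {Φ : Position}
    (hΦ : LegalPos Φ) (hk : Knows F q none Φ) :
    S.StepOK h [] Φ (S.entry K q, none, none) := by
  rw [S.entry_of_mem K hq]
  exact S.stepOK_of_ne (S.startPhase_ne_moved q) hΦ (S.phaseInv_start hK hq hk)

/-- Where the machine copies the choice in a cluster, the environment has made it. -/
theorem Knows.source {q : S.nodes} {Φ : Position} (hk : Knows F q none Φ) {c : Cluster}
    {x : Cho Sym c.kind} {d : ℕ} (hd : S.decision q = some ⟨c, x⟩) (hs : x.source = some d) :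
    ⟨.chall, d⟩ ∈ F ∧ ∃ a, (⟨.environment, Cluster.move ⟨.chall, d⟩ a⟩ : LabMove) ∈ Φ := by
  obtain ⟨-, hm, -⟩ := S.move q q.2 c x hd
  have hq : q.1 ⟨.chall, d⟩ ≠ none := by
    obtain ⟨k, i⟩ := c
    cases k
    · cases hs
    · cases hs
    · cases x with
      | const a => cases hs
      | copy e =>
        cases hs
        exact hm d rfl
    · cases hs
  refine ⟨hk.env _ hq rfl, ?_⟩
  obtain ⟨z, hz⟩ := Option.ne_none_iff_exists'.1 hq
  obtain ⟨y, hy, -⟩ := hk.made _ z hz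
  exact ⟨_, hy⟩

/-- Every step preserves the invariant. -/
theorem stepOK_trans (hK : S.Bound K) {q : S.nodes} {f : Phase K} {h : ℕ} {b : List Key}
    {Φ : Position} (hΦ : LegalPos Φ) (hi : S.PhaseInv q f h b Φ) :
    S.StepOK h b Φ (S.trans q f (spell Φ)[h]?) := by
  cases f with
  | write l =>
    obtain ⟨l, hl⟩ := l
    obtain ⟨hk, c, x, hd, hb⟩ := hi
    cases l with
    | nil =>
      rw [List.append_nil] at hb
      simp only [trans]
      split_ifs with hs
      · obtain ⟨c', x', hd', hs⟩ := hs
        obtain ⟨d, hs⟩ := Option.ne_none_iff_exists'.1 hs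
        obtain ⟨rfl, hx⟩ := Sigma.mk.inj (Option.some.inj (hd.symm.trans hd'))
        cases hx
        refine S.stepOK_of_ne (by simp) hΦ ?_
        simp only [Option.toList_none, List.append_nil]
        exact ⟨hk, .inr ⟨c, x, d, hd, hs, hb⟩⟩
      · have hs' : x.source = none := by
          by_contra h
          exact hs ⟨c, x, hd, h⟩
        refine S.stepOK_moved hΦ hk hd (y := x.plain) ?_ (Cho.means_plain (S.move q q.2 c x hd).2.1 hs')
        rw [hb, Cho.text, hs']
    | cons k l =>
      refine S.stepOK_of_ne (by simp [trans]) hΦ ?_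
      exact ⟨hk, c, x, hd, by simpa [trans] using hb⟩
  | rewind =>
    obtain ⟨hk, hd⟩ := hi
    rcases hs : (spell Φ)[h]? with _ | l | k
    · refine S.stepOK_of_ne (by simp [trans]) hΦ ?_
      simp only [trans, Option.toList_none, List.append_nil]
      exact ⟨hk, hd⟩
    · refine S.stepOK_of_ne (by simp [trans]) hΦ ?_
      simp only [trans, Option.toList_none, List.append_nil]
      exact ⟨hk, hd, h, l, rfl, hs⟩
    · refine S.stepOK_of_ne (by simp [trans]) hΦ ?_
      simp only [trans, Option.toList_none, List.append_nil]
      exact ⟨hk, hd⟩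
  | atLabel =>
    obtain ⟨hk, hd, h', l', hh, hl'⟩ := hi
    rcases hs : (spell Φ)[h]? with _ | l | k
    · refine S.stepOK_of_ne (by simp [trans]) hΦ ?_
      simp only [trans, Option.toList_none, List.append_nil]
      exact ⟨hk, hd⟩
    · have h0 : h = 0 := by
        rcases Nat.eq_zero_or_pos h' with h0 | h0
        · omega
        · rw [show h' = h + 1 by omega] at hl'
          exact (hΦ.not_adjacent hs hl').elim
      refine S.stepOK_of_ne (by simp [trans]) hΦ ?_
      simp only [trans, Option.toList_none, List.append_nil]
      exact ⟨hk, hd, .inl h0⟩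
    · refine S.stepOK_of_ne (by simp [trans]) hΦ ?_
      simp only [trans, Option.toList_none, List.append_nil]
      exact ⟨hk, hd⟩
  | skip =>
    exact S.stepOK_of_ne (S.scan_phase_ne_moved q (by simp) _) hΦ (S.phaseInv_scan (.inl rfl) hi)
  | read l =>
    have hscan : S.StepOK h b Φ (S.scan q (.read l) (spell Φ)[h]?) :=
      S.stepOK_of_ne (S.scan_phase_ne_moved q (by simp) _) hΦ (S.phaseInv_scan (.inr ⟨l, rfl⟩) hi)
    obtain ⟨hk, hb, m, w, hl, hm⟩ := hi
    rcases hd : S.decision q with _ | ⟨c, x⟩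
    · simp only [trans, hd]
      split_ifs with hdet
      · obtain rfl : b = [] := by
          rcases hb with hb | ⟨c, x, d, hd', -⟩
          · exact hb.2
          · rw [hd] at hd'
            cases hd'
        have hn := hdet.2.choose_spec
        obtain ⟨y, hy, hxy⟩ := S.detected hK hΦ ((hl.eq_nil_of_not_key hdet.1) ▸ hl) hm hn
        obtain ⟨hc, ho, hq, -⟩ := hn
        refine S.stepOK_entry hK ((S.wait q q.2 hd).2 _ hc hq _ (EnvOpt.symb ho _)) hΦ ?_
        exact hk.update (fun _ h => by cases h) hy (hxy ▸ Cho.means_symb hy) fun _ => hc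
      · exact hscan
    · simp only [trans, hd]
      split_ifs with hsrc
      · obtain ⟨d, hs, hld⟩ := hsrc
        refine S.stepOK_of_ne (by simp) hΦ ?_
        have hb' : b = x.text c := by
          rcases hb with ⟨hb, -⟩ | ⟨c', x', d', hd', -, hb⟩
          · rw [hd] at hb
            cases hb
          · obtain ⟨rfl, hx⟩ := Sigma.mk.inj (Option.some.inj (hd.symm.trans hd'))
            cases hx
            exact hb
        -- the part that has been read is shorter than `K`, so nothing has been forgotten
        have hm' : m = Cluster.name ⟨.chall, d⟩ ++ [.dot] := by
          have hlen := hK.name _ (hk.source S hd hs).1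
          rw [hld] at hm
          have := congrArg List.length hm
          rw [List.length_append, List.length_singleton, List.length_take] at this
          rw [hm, List.take_of_length_le (by omega)]
        subst hm'
        simp only [HPM.shiftHead, Option.toList_none, List.append_nil]
        exact ⟨hk, c, x, d, hd, hs, [], w, hl, by simpa using hb'⟩
      · exact hscan
  | copy =>
    obtain ⟨hk, c, x, d, hd, hs, r, w, hl, hb⟩ := hi
    have hend : (∀ k, (spell Φ)[h]? ≠ some (.key k)) →
        S.StepOK (K := K) h b Φ ((q, .moved), none, none) := by
      intro hnk
      obtain rfl := hl.eq_nil_of_not_key hnk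
      have hmem := hl.mem
      rw [List.append_nil] at hmem
      obtain ⟨d', y, hm⟩ := hΦ.eq_move hmem
      obtain ⟨h1, h2⟩ := append_cons_inj (dot_notMem_name _) (dot_notMem_name _)
        (LabMove.mk.inj hm).2
      obtain rfl := Cluster.name_injective h1
      obtain ⟨-, z, hz, hxz⟩ := Cho.means_copy (S.move q q.2 c x hd).2.1 hs
        (a := y.num) (by rw [Cluster.move, ← h2]; exact hmem)
      refine S.stepOK_moved hΦ hk hd (y := z) ?_ hxz
      rw [hb, Cho.text, hs, hz, h2]
      simp [Cluster.move]
    rcases hsy : (spell Φ)[h]? with _ | l | k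
    · exact hend (by simp [hsy])
    · exact hend (by simp [hsy])
    · refine S.stepOK_of_ne (by simp [trans]) hΦ ?_
      obtain ⟨w', -, hl'⟩ := hl.key hsy
      simp only [trans, HPM.shiftHead, Option.toList_some]
      exact ⟨hk, c, x, d, hd, hs, r ++ [k], w', by simpa using hl', by simp [hb]⟩
  | moved =>
    obtain ⟨rfl, c, x, hd, hk, y, hy, hxy⟩ := hi
    obtain ⟨hn, hm, hq⟩ := S.move q q.2 c x hd
    simp only [trans, hd]
    refine S.stepOK_entry hK hq hΦ (hk.update (fun _ h => (Option.some.inj h).symm) hy hxy ?_)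
    intro ho
    rw [hm.owner] at ho
    cases ho

/-- The step that the machine makes in a configuration: its own move, if any, is legal, and the invariant
holds right after it. -/
theorem phaseInv_step (hK : S.Bound K) {C : (S.machine K).Config} (hC : LegalPos C.position)
    (hi : S.Inv C) :
    LegalPos (C.position ++ (S.machine K).own C) ∧
      S.PhaseInv (S.act C).1.1 (S.act C).1.2 (HPM.shiftHead C.runHead (S.act C).2.1)
        (open Classical in if (S.act C).1.2 = .moved then [] else C.buffer ++ (S.act C).2.2.toList)
        (C.position ++ (S.machine K).own C) :=
  S.stepOK_trans hK hC hi

theorem inv_nextConfig (hK : S.Bound K) {C : (S.machine K).Config} (hC : LegalPos C.position)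
    (hi : S.Inv C) (e : List Move) : S.Inv ((S.machine K).nextConfig C e) :=
  PhaseInv.append S (S.phaseInv_step hK hC hi).2 e

theorem inv_init (hK : S.Bound K) : S.Inv (S.machine K).init := by
  have h : (S.machine K).init.state = (⟨_, S.root⟩, S.startPhase K (Asg.empty Sym)) :=
    S.entry_of_mem K S.root
  unfold Inv
  rw [h]
  refine S.phaseInv_start hK S.root ⟨fun c x hx => ?_, fun m hm => ?_, fun c hc => ?_⟩
  · cases hx
  · cases hm
  · exact absurd rfl hc

theorem inv_branch (hK : S.Bound K) (e : ℕ → List Move) (t : ℕ)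
    (h : LegalPos ((S.machine K).branch e t).position) : S.Inv ((S.machine K).branch e t) := by
  induction t with
  | zero => exact S.inv_init hK
  | succ t ih =>
    have h' := h.of_prefix ((S.machine K).position_prefix e (Nat.le_succ t))
    exact S.inv_nextConfig hK h' (ih h') _

end Strategy

/-! ### Liveness: the machine does not get stuck, and overlooks nothing -/

namespace Strategy

variable {F : Finset Cluster} {G : Asg Sym → Prop} (S : Strategy F G) {K : ℕ}
  {e : ℕ → List Move}

variable (K e) in
/-- The configuration at time `t`. -/
noncomputable def conf (t : ℕ) : (S.machine K).Config := (S.machine K).branch e t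

theorem mem_mono {s t : ℕ} (h : s ≤ t) {m : LabMove} (hm : m ∈ (S.conf K e s).position) :
    m ∈ (S.conf K e t).position :=
  ((S.machine K).position_prefix e h).subset hm

theorem loc_mono {s t : ℕ} (h : s ≤ t) {i : ℕ} {p : Player} {m w : List Key}
    (hl : Loc (S.conf K e s).position i p m w) : Loc (S.conf K e t).position i p m w := by
  obtain ⟨Ψ, hΨ⟩ := (S.machine K).position_prefix e h
  rw [conf, ← hΨ]
  exact hl.append Ψ

theorem getElem?_mono {s t : ℕ} (h : s ≤ t) {i : ℕ} {a : RunSymbol}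
    (ha : (spell (S.conf K e s).position)[i]? = some a) :
    (spell (S.conf K e t).position)[i]? = some a := by
  obtain ⟨Ψ, hΨ⟩ := (S.machine K).position_prefix e h
  obtain ⟨hi, -⟩ := List.getElem?_eq_some_iff.1 ha
  rw [conf, ← hΨ, spell_append]
  exact (List.getElem?_append_left hi).trans ha

theorem conf_succ {t : ℕ} {q : S.nodes} {f : Phase K} (h : (S.conf K e t).state = (q, f)) :
    (S.conf K e (t + 1)).state = (S.trans q f (S.sym (S.conf K e t))).1 ∧
      (S.conf K e (t + 1)).runHead = HPM.shiftHead (S.conf K e t).runHead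
        (S.trans q f (S.sym (S.conf K e t))).2.1 := by
  have h1 : (S.conf K e (t + 1)).state = (S.act (S.conf K e t)).1 := rfl
  have h2 : (S.conf K e (t + 1)).runHead = HPM.shiftHead (S.conf K e t).runHead
    (S.act (S.conf K e t)).2.1 := rfl
  rw [h1, h2, act, h]
  exact ⟨rfl, rfl⟩

/-- Writing comes to an end. -/
theorem write_ends {q : S.nodes} {c : Cluster} {x : Cho Sym c.kind}
    (hd : S.decision q = some ⟨c, x⟩) (l : List Key) : ∀ {hl : l.length ≤ K} {t : ℕ},
    (S.conf K e t).state = (q, .write ⟨l, hl⟩) →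
      ∃ t' > t, (S.conf K e t').state = (q, if x.source = none then .moved else .rewind) := by
  induction l with
  | nil =>
    intro hl t h
    refine ⟨t + 1, Nat.lt_succ_self t, ?_⟩
    rw [(S.conf_succ h).1]
    have : (∃ c x, S.decision q = some ⟨c, x⟩ ∧ x.source ≠ none) ↔ x.source ≠ none := by
      refine ⟨fun ⟨c', x', hd', hs⟩ => ?_, fun hs => ⟨c, x, hd, hs⟩⟩
      obtain ⟨rfl, hx⟩ := Sigma.mk.inj (Option.some.inj (hd.symm.trans hd'))
      cases hx
      exact hs
    simp only [trans, this]
    by_cases hs : x.source = none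
    · rw [if_neg (not_not.2 hs), if_pos hs]
    · rw [if_pos hs, if_neg hs]
  | cons k l ih =>
    intro hl t h
    obtain ⟨t', ht', h'⟩ := ih (S.conf_succ h).1
    exact ⟨t', (Nat.lt_succ_self t).trans ht', h'⟩

/-- Copying comes to an end. -/
theorem copy_ends {q : S.nodes} (w : List Key) : ∀ {t : ℕ} {p : Player} {m : List Key},
    (S.conf K e t).state = (q, .copy) → Loc (S.conf K e t).position (S.conf K e t).runHead p m w →
      ∃ t' > t, (S.conf K e t').state = (q, .moved) := by
  induction w with
  | nil =>
    intro t p m h hl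
    refine ⟨t + 1, Nat.lt_succ_self t, ?_⟩
    rw [(S.conf_succ h).1]
    rcases hs : S.sym (S.conf K e t) with _ | l | k
    · rfl
    · rfl
    · exact absurd hs (hl.not_key k)
  | cons k w ih =>
    intro t p m h hl
    rcases hs : S.sym (S.conf K e t) with _ | l | k
    · exact ⟨t + 1, Nat.lt_succ_self t, by rw [(S.conf_succ h).1, hs]; rfl⟩
    · exact ⟨t + 1, Nat.lt_succ_self t, by rw [(S.conf_succ h).1, hs]; rfl⟩
    · obtain ⟨w', hw, hl'⟩ := hl.key hs
      obtain rfl := (List.cons.inj hw).2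
      have hstep := S.conf_succ h
      rw [hs] at hstep
      obtain ⟨t', ht', h'⟩ := ih (t := t + 1) hstep.1 (by
        rw [hstep.2]
        exact S.loc_mono (Nat.le_succ t) hl')
      exact ⟨t', (Nat.lt_succ_self t).trans ht', h'⟩

section Legal

variable (hleg : ∀ t, LegalPos (S.conf K e t).position)

include hleg

/-- If there is anything on the run tape, then its left end is found. -/
theorem rewind_ends_of_ne {q : S.nodes} (h : ℕ) : ∀ {t : ℕ},
    (S.conf K e t).state = (q, .rewind) → (S.conf K e t).runHead = h →
    (S.conf K e t).position ≠ [] →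
      ∃ t' > t, (S.conf K e t').state = (q, .skip) ∧ (S.conf K e t').runHead = 0 := by
  induction h using Nat.strong_induction_on with
  | _ h ih =>
    intro t hst hh hne
    have hstep := S.conf_succ hst
    have hne' : ∀ {s}, t ≤ s → (S.conf K e s).position ≠ [] := fun hs h0 =>
      hne (List.prefix_nil.1 (h0 ▸ (S.machine K).position_prefix e hs))
    have hzero : ∀ {s}, t ≤ s → ∃ l, (spell (S.conf K e s).position)[0]? = some (.label l) := by
      intro s hs
      obtain ⟨m, Φ, hΦ⟩ := List.exists_cons_of_ne_nil (hne' hs)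
      exact ⟨m.player, by rw [hΦ, spell_cons]; rfl⟩
    by_cases hlab : ∃ l, S.sym (S.conf K e t) = some (.label l)
    · obtain ⟨l, hl⟩ := hlab
      rw [hl, hh] at hstep
      obtain ⟨hst1, hh1⟩ := hstep
      have hstep2 := S.conf_succ hst1
      rcases Nat.lt_or_ge h 2 with h2 | h2
      · -- the head is in the first cell, which contains a label
        have h0 : (S.conf K e (t + 1)).runHead = 0 := by
          rw [hh1]
          change h - 1 = 0
          omega
        obtain ⟨l', hl'⟩ := hzero (Nat.le_succ t)
        rw [sym, h0, hl'] at hstep2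
        exact ⟨t + 2, by omega, hstep2⟩
      · have hsym : ∀ l', S.sym (S.conf K e (t + 1)) ≠ some (.label l') := by
          intro l' hl'
          rw [sym, hh1] at hl'
          refine (hleg (t + 1)).not_adjacent hl' (l' := l) ?_
          rw [sym, hh] at hl
          change (spell _)[h - 1 + 1]? = _
          rw [show h - 1 + 1 = h by omega]
          exact S.getElem?_mono (Nat.le_succ t) hl
        have hrew : (S.conf K e (t + 2)).state = (q, .rewind) ∧
            (S.conf K e (t + 2)).runHead = h - 1 - 1 := by
          rw [hh1] at hstep2
          rcases hs : S.sym (S.conf K e (t + 1)) with _ | l' | k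
          · rw [hs] at hstep2
            exact hstep2
          · exact absurd hs (hsym l')
          · rw [hs] at hstep2
            exact hstep2
        obtain ⟨t', ht', h'⟩ := ih _ (by omega) hrew.1 hrew.2 (hne' (by omega))
        exact ⟨t', by omega, h'⟩
    · have hpos : h ≠ 0 := by
        rintro rfl
        obtain ⟨l, hl⟩ := hzero le_rfl
        exact hlab ⟨l, by rw [sym, hh, hl]⟩
      have hrew : (S.conf K e (t + 1)).state = (q, .rewind) ∧
          (S.conf K e (t + 1)).runHead = h - 1 := by
        rw [hh] at hstep
        rcases hs : S.sym (S.conf K e t) with _ | l' | k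
        · rw [hs] at hstep
          exact hstep
        · exact absurd ⟨l', hs⟩ hlab
        · rw [hs] at hstep
          exact hstep
      obtain ⟨t', ht', h'⟩ := ih _ (by omega) hrew.1 hrew.2 (hne' (by omega))
      exact ⟨t', by omega, h'⟩

/-- The left end of the run tape is found as soon as there is anything on the tape. -/
theorem rewind_ends {q : S.nodes} {t₀ : ℕ} (hne : (S.conf K e t₀).position ≠ []) {t : ℕ}
    (hst : (S.conf K e t).state = (q, .rewind)) :
    ∃ t' > t, (S.conf K e t').state = (q, .skip) ∧ (S.conf K e t').runHead = 0 := by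
  have key : ∀ n t, (S.conf K e t).state = (q, .rewind) → t₀ - t < n →
      ∃ t' > t, (S.conf K e t').state = (q, .skip) ∧ (S.conf K e t').runHead = 0 := by
    intro n
    induction n with
    | zero => exact fun _ _ h => absurd h (Nat.not_lt_zero _)
    | succ n ih =>
      intro t hst hn
      by_cases ht : (S.conf K e t).position = []
      · have hlt : t < t₀ := by
          by_contra hge
          exact hne (List.prefix_nil.1
            (ht ▸ (S.machine K).position_prefix e (not_lt.1 hge)))
        have hstep := (S.conf_succ hst).1
        rw [sym, ht] at hstep
        obtain ⟨t', ht', h'⟩ := ih (t + 1) hstep (by omega)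
        exact ⟨t', by omega, h'⟩
      · exact S.rewind_ends_of_ne hleg _ hst rfl ht
  exact key _ t hst (Nat.lt_succ_self _)

end Legal

variable (K e) in
/-- The machine has found on the run tape what it is looking for at the node `q`: a choice of the
environment that is not in `q`, or the choice that is to be copied. -/
def Found (q : S.nodes) (t : ℕ) : Prop :=
  S.decision q = none ∧ (∃ c ∈ F, ∃ y : Cho ℕ c.kind, c.kind.owner = .environment ∧ q.1 c = none ∧
      (S.conf K e t).state = S.entry K (Function.update q.1 c (some (Cho.symb c y)))) ∨
    S.decision q ≠ none ∧ (S.conf K e t).state = (q, .copy)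

/-- The scanning phases. -/
def Phase.Scans (f : Phase K) : Prop := f = .skip ∨ ∃ l, f = .read l

theorem scans_scan {q : S.nodes} {f : Phase K} (hf : Phase.Scans f) (s : Option RunSymbol) :
    ∃ f', Phase.Scans f' ∧ (S.scan q f s).1 = (q, f') := by
  rcases s with _ | (_ | _) | k
  · exact ⟨f, hf, rfl⟩
  · exact ⟨_, .inl rfl, rfl⟩
  · exact ⟨_, .inr ⟨_, rfl⟩, rfl⟩
  · rcases hf with rfl | ⟨l, rfl⟩
    · exact ⟨_, .inl rfl, rfl⟩
    · exact ⟨_, .inr ⟨_, rfl⟩, rfl⟩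

/-- Scanning goes on until something is found. -/
theorem scans_succ {q : S.nodes} {f : Phase K} (hf : Phase.Scans f) {t : ℕ}
    (hst : (S.conf K e t).state = (q, f)) :
    S.Found K e q (t + 1) ∨ ∃ f', Phase.Scans f' ∧ (S.conf K e (t + 1)).state = (q, f') ∧
      (S.conf K e (t + 1)).runHead = if S.sym (S.conf K e t) = none then (S.conf K e t).runHead
        else (S.conf K e t).runHead + 1 := by
  have hstep := S.conf_succ hst
  have hscan : S.trans q f (S.sym (S.conf K e t)) = S.scan q f (S.sym (S.conf K e t)) →
      ∃ f', Phase.Scans f' ∧ (S.conf K e (t + 1)).state = (q, f') ∧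
      (S.conf K e (t + 1)).runHead = if S.sym (S.conf K e t) = none then (S.conf K e t).runHead
        else (S.conf K e t).runHead + 1 := by
    intro h
    rw [h] at hstep
    obtain ⟨f', hf', h'⟩ := S.scans_scan (q := q) hf (S.sym (S.conf K e t))
    refine ⟨f', hf', hstep.1.trans h', hstep.2.trans ?_⟩
    rcases S.sym (S.conf K e t) with _ | (_ | _) | k <;> rfl
  rcases hf with rfl | ⟨l, rfl⟩
  · exact .inr (hscan rfl)
  · rcases hd : S.decision q with _ | ⟨c, x⟩
    · simp only [trans, hd] at hstep hscan
      by_cases hdet : (∀ k, S.sym (S.conf K e t) ≠ some (.key k)) ∧ ∃ m, Detects F (q : Asg Sym) l m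
      · rw [dif_pos hdet] at hstep
        obtain ⟨hc, ho, hq, -⟩ := hdet.2.choose_spec
        exact .inl (.inl ⟨hd, _, hc, _, ho, hq, hstep.1⟩)
      · exact .inr (hscan (dif_neg hdet))
    · simp only [trans, hd] at hstep hscan
      by_cases hsrc : ∃ d, x.source = some d ∧ l.1 = Cluster.name ⟨.chall, d⟩ ++ [.dot]
      · rw [if_pos hsrc] at hstep
        exact .inl (.inr ⟨by simp [hd], hstep.1⟩)
      · exact .inr (hscan (if_neg hsrc))

/-- Every cell of the run tape that is not blank, and the cell behind it, is reached unless something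
is found before. -/
theorem scans_reach {q : S.nodes} {h t₀ : ℕ} (hh : h ≤ (spell (S.conf K e t₀).position).length)
    {f : Phase K} (hf : Phase.Scans f) {t : ℕ} (hst : (S.conf K e t).state = (q, f))
    (hht : (S.conf K e t).runHead ≤ h) :
    (∃ t' > t, S.Found K e q t') ∨ ∃ t' ≥ t, ∃ f', Phase.Scans f' ∧
      (S.conf K e t').state = (q, f') ∧ (S.conf K e t').runHead = h := by
  have key : ∀ n t f, Phase.Scans f → (S.conf K e t).state = (q, f) →
      (S.conf K e t).runHead ≤ h → (h - (S.conf K e t).runHead) + (t₀ - t) < n →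
      (∃ t' > t, S.Found K e q t') ∨ ∃ t' ≥ t, ∃ f', Phase.Scans f' ∧
        (S.conf K e t').state = (q, f') ∧ (S.conf K e t').runHead = h := by
    intro n
    induction n with
    | zero => exact fun _ _ _ _ _ h => absurd h (Nat.not_lt_zero _)
    | succ n ih =>
      intro t f hf hst hht hn
      rcases hht.eq_or_lt with heq | hlt
      · exact .inr ⟨t, le_rfl, f, hf, hst, heq⟩
      rcases S.scans_succ hf hst with hfound | ⟨f', hf', hst', hh'⟩
      · exact .inl ⟨t + 1, Nat.lt_succ_self t, hfound⟩
      have hmeas : (S.conf K e (t + 1)).runHead ≤ h ∧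
          (h - (S.conf K e (t + 1)).runHead) + (t₀ - (t + 1)) < n := by
        split_ifs at hh' with hs
        · -- a cell that has not yet been written on
          have : t < t₀ := by
            by_contra hge
            have hpre := (S.machine K).position_prefix e (not_lt.1 hge)
            obtain ⟨Ψ, hΨ⟩ := hpre
            have hlen : (spell (S.conf K e t).position).length =
                (spell (S.conf K e t₀).position).length + (spell Ψ).length := by
              rw [← List.length_append, ← spell_append]
              exact congrArg (fun Φ => (spell Φ).length) hΨ.symm
            rw [sym, List.getElem?_eq_none_iff] at hs
            omega
          omega
        · omega
      rcases ih (t + 1) f' hf' hst' hmeas.1 hmeas.2 with ⟨t', ht', h'⟩ | ⟨t', ht', h'⟩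
      · exact .inl ⟨t', by omega, h'⟩
      · exact .inr ⟨t', by omega, h'⟩
  exact key _ t f hf hst hht (Nat.lt_succ_self _)

section Legal

variable (hleg : ∀ t, LegalPos (S.conf K e t).position) (hK : S.Bound K)

include hleg hK

/-- Every move of the environment is read, unless something is found before. -/
theorem rewind_read {q : S.nodes} {t₀ h : ℕ} {m w : List Key}
    (hl : Loc (S.conf K e t₀).position h .environment m w) {t : ℕ}
    (hst : (S.conf K e t).state = (q, .rewind)) :
    (∃ t' > t, S.Found K e q t') ∨ ∃ t' > t, ∃ l : Word K, l.1 = m.take K ∧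
      (S.conf K e t').state = (q, .read l) ∧ ∃ w', Loc (S.conf K e t').position
        (S.conf K e t').runHead .environment m w' ∧ w' = w := by
  have hne : (S.conf K e t₀).position ≠ [] := fun h0 => by
    have := hl.mem
    rw [h0] at this
    cases this
  obtain ⟨t₁, ht₁, hst₁, hh₁⟩ := S.rewind_ends hleg hne hst
  rcases S.scans_reach (Loc.le_length hl) (.inl rfl) hst₁ (by omega) with
    ⟨t', ht', h'⟩ | ⟨t', ht', f, hf, hst', hh'⟩
  · exact .inl ⟨t', by omega, h'⟩
  have hi : S.Inv (S.conf K e t') := S.inv_branch hK e t' (hleg t')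
  have huniq : ∀ {p m' w'}, Loc (S.conf K e t').position h p m' w' →
      Player.environment = p ∧ m = m' ∧ w = w' := fun hl' =>
    (S.loc_mono (le_max_left t₀ t') hl).unique (S.loc_mono (le_max_right t₀ t') hl')
  have hpos : h ≠ 0 := by
    obtain ⟨Φ₁, Φ₂, -, rfl⟩ := hl
    omega
  rw [Inv, hst', hh'] at hi
  rcases hf with rfl | ⟨l, rfl⟩
  · rcases hi.2.2 with h0 | ⟨m', w', hl'⟩
    · exact absurd h0 hpos
    · cases (huniq hl').1
  · obtain ⟨m', w', hl', hm'⟩ := hi.2.2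
    obtain ⟨-, rfl, rfl⟩ := huniq hl'
    exact .inr ⟨t', by omega, l, hm', hst', _, hh' ▸ hl', rfl⟩

/-- A move of the environment that is not in the node is found. -/
theorem found_of_wait {q : S.nodes} (hd : S.decision q = none) {c : Cluster} (hc : c ∈ F)
    (ho : c.kind.owner = .environment) (hq : q.1 c = none) {y : Cho ℕ c.kind} {t₀ : ℕ}
    (hy : ⟨.environment, c.move y.num⟩ ∈ (S.conf K e t₀).position) {t : ℕ}
    (hst : (S.conf K e t).state = (q, .rewind)) : ∃ t' > t, S.Found K e q t' := by
  obtain ⟨Φ₁, Φ₂, hΦ⟩ := List.append_of_mem hy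
  have hl : Loc (S.conf K e t₀).position _ .environment (c.move y.num) [] :=
    ⟨Φ₁, Φ₂, by rw [hΦ, List.append_nil], rfl⟩
  rcases S.rewind_read hleg hK hl hst with h | ⟨t', ht', l, hlm, hst', w', hl', rfl⟩
  · exact h
  have hdet : (∀ k, S.sym (S.conf K e t') ≠ some (.key k)) ∧
      ∃ m, Detects F (q : Asg Sym) l m := ⟨hl'.not_key, ⟨c, y⟩, hc, ho, hq, hlm⟩
  have hstep := (S.conf_succ hst').1
  simp only [trans, hd, dif_pos hdet] at hstep
  obtain ⟨hc', ho', hq', -⟩ := hdet.2.choose_spec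
  exact ⟨t' + 1, by omega, .inl ⟨hd, _, hc', _, ho', hq', hstep⟩⟩

/-- The choice that is to be copied is found. -/
theorem found_of_move {q : S.nodes} {c : Cluster} {x : Cho Sym c.kind}
    (hd : S.decision q = some ⟨c, x⟩) {d : ℕ} (hs : x.source = some d) {t : ℕ}
    (hst : (S.conf K e t).state = (q, .rewind)) :
    ∃ t' > t, (S.conf K e t').state = (q, .copy) := by
  have hi : S.Inv (S.conf K e t) := S.inv_branch hK e t (hleg t)
  rw [Inv, hst] at hi
  obtain ⟨hF, a, ha⟩ := hi.1.source S hd hs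
  have hfound : ∀ {t'}, S.Found K e q t' → (S.conf K e t').state = (q, .copy) := by
    rintro t' (⟨h, -⟩ | ⟨-, h⟩)
    · rw [hd] at h
      cases h
    · exact h
  obtain ⟨Φ₁, Φ₂, hΦ⟩ := List.append_of_mem ha
  have hl : Loc (S.conf K e t).position _ .environment (Cluster.name ⟨.chall, d⟩ ++ [.dot])
      (numeral a) := ⟨Φ₁, Φ₂, by rw [hΦ]; simp [Cluster.move], rfl⟩
  rcases S.rewind_read hleg hK hl hst with ⟨t', ht', h⟩ | ⟨t', ht', l, hlm, hst', -⟩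
  · exact ⟨t', ht', hfound h⟩
  rw [List.take_of_length_le (by have := hK.name _ hF; simp; omega)] at hlm
  have hstep := (S.conf_succ hst').1
  simp only [trans, hd] at hstep
  rw [if_pos ⟨d, hs, hlm⟩] at hstep
  exact ⟨t' + 1, by omega, hstep⟩

/-- The machine carries out the moves of its strategy. -/
theorem exists_entry_of_move {q : S.nodes} {c : Cluster} {x : Cho Sym c.kind}
    (hd : S.decision q = some ⟨c, x⟩) {t : ℕ} (hst : (S.conf K e t).state = S.entry K q) :
    ∃ t', (S.conf K e t').state = S.entry K (Function.update q.1 c (some x)) := by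
  rw [S.entry_of_mem K q.2] at hst
  have hmoved : ∀ {t}, (S.conf K e t).state = (q, .moved) →
      ∃ t', (S.conf K e t').state = S.entry K (Function.update q.1 c (some x)) := by
    intro t h
    have hstep := (S.conf_succ h).1
    simp only [trans, hd] at hstep
    exact ⟨t + 1, hstep⟩
  have hphase : S.startPhase K q = .write (Word.clip K (x.text c)) := by
    simp only [startPhase, hd]
  rw [hphase] at hst
  obtain ⟨t₁, -, h₁⟩ := S.write_ends hd _ hst
  split_ifs at h₁ with hs
  · exact hmoved h₁
  · obtain ⟨d, hs⟩ := Option.ne_none_iff_exists'.1 hs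
    obtain ⟨t₂, -, h₂⟩ := S.found_of_move hleg hK hd hs h₁
    have hi : S.Inv (S.conf K e t₂) := S.inv_branch hK e t₂ (hleg t₂)
    rw [Inv, h₂] at hi
    obtain ⟨-, _, _, _, -, -, r, w, hl, -⟩ := hi
    obtain ⟨t₃, -, h₃⟩ := S.copy_ends w h₂ hl
    exact hmoved h₃

/-- Eventually, the machine arrives at a node where it stays, and this node describes the run
completely. -/
theorem exists_final : ∃ q : Asg Sym, G q ∧ (∃ t₀, ∀ t ≥ t₀, Knows F q none (S.conf K e t).position) ∧
    ∀ c ∈ F, q c = none → ∀ t p (y : Cho ℕ c.kind), ⟨p, c.move y.num⟩ ∉ (S.conf K e t).position := by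
  -- a node that has been visited, and in which as many clusters as possible are resolved
  obtain ⟨q, ⟨hq, t₀, ht₀⟩, hmax⟩ := Set.Finite.exists_maximalFor
    (fun q : Asg Sym => {c | q c ≠ none}) {q | q ∈ S.nodes ∧ ∃ t, (S.conf K e t).state = S.entry K q}
    (S.finite.subset fun _ h => h.1) ⟨_, S.root, 0, rfl⟩
  have hno : ∀ c (x : Cho Sym c.kind), q c = none → Function.update q c (some x) ∈ S.nodes →
      ∀ t, (S.conf K e t).state ≠ S.entry K (Function.update q c (some x)) := by
    intro c x hn hx t ht
    have := hmax ⟨hx, t, ht⟩ (fun d hd => update_ne_none hd) (show c ∈ {c | _ ≠ none} by simp)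
    exact this hn
  have hd : S.decision q = none := by
    rcases hd : S.decision q with _ | ⟨c, x⟩
    · rfl
    · obtain ⟨t, ht⟩ := S.exists_entry_of_move hleg hK (q := ⟨q, hq⟩) hd ht₀
      obtain ⟨hn, -, hx⟩ := S.move q hq c x hd
      exact absurd ht (hno c x hn hx t)
  have hwait := S.wait q hq hd
  rw [S.entry_of_mem K hq, startPhase, hd] at ht₀
  have hnot : ∀ t, ¬ S.Found K e ⟨q, hq⟩ t := by
    rintro t (⟨-, c, hc, y, ho, hn, h⟩ | ⟨h, -⟩)
    · exact hno c _ hn (hwait.2 c hc hn _ (EnvOpt.symb ho y)) t h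
    · exact h hd
  have hstay : ∀ t ≥ t₀, ∃ f : Phase K, (f = .rewind ∨ f = .atLabel ∨ Phase.Scans f) ∧
      (S.conf K e t).state = (⟨q, hq⟩, f) := by
    intro t ht
    induction t, ht using Nat.le_induction with
    | base => exact ⟨_, .inl rfl, ht₀⟩
    | succ t _ ih =>
      obtain ⟨f, hf, hst⟩ := ih
      have hstep := (S.conf_succ hst).1
      rcases hf with rfl | rfl | hf
      · rcases hs : S.sym (S.conf K e t) with _ | l | k <;> rw [hs] at hstep
        exacts [⟨_, .inl rfl, hstep⟩, ⟨_, .inr (.inl rfl), hstep⟩, ⟨_, .inl rfl, hstep⟩]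
      · rcases hs : S.sym (S.conf K e t) with _ | l | k <;> rw [hs] at hstep
        exacts [⟨_, .inl rfl, hstep⟩, ⟨_, .inr (.inr (.inl rfl)), hstep⟩, ⟨_, .inl rfl, hstep⟩]
      · rcases S.scans_succ hf hst with h | ⟨f', hf', hst', -⟩
        · exact absurd h (hnot _)
        · exact ⟨f', .inr (.inr hf'), hst'⟩
  have hknows : ∀ t ≥ t₀, Knows F q none (S.conf K e t).position := by
    intro t ht
    obtain ⟨f, hf, hst⟩ := hstay t ht
    have hi : S.Inv (S.conf K e t) := S.inv_branch hK e t (hleg t)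
    rw [Inv, hst] at hi
    rcases hf with rfl | rfl | rfl | ⟨l, rfl⟩ <;> exact hi.1
  refine ⟨q, hwait.1, ⟨t₀, hknows⟩, fun c hc hn t p y hy => ?_⟩
  have hy' := S.mem_mono (le_max_right t₀ t) hy
  obtain ⟨d, z, hm⟩ := (hleg _).eq_move hy'
  obtain ⟨rfl, h2⟩ := LabMove.mk.inj hm
  obtain ⟨rfl, -⟩ := Cluster.move_inj h2
  rcases ho : c.kind.owner with _ | _
  · obtain ⟨d, a, h3, h4⟩ := (hknows _ (le_max_left t₀ t)).machine _ hy' ho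
    obtain ⟨rfl, -⟩ := Cluster.move_inj h3
    exact h4.elim (fun h => h hn) (fun h => by cases h)
  · rw [ho] at hy
    obtain ⟨t', -, h⟩ := S.found_of_wait hleg hK (q := ⟨q, hq⟩) hd hc ho hn hy ht₀
    exact hnot t' h

end Legal

end Strategy

/-! ### From winning strategies to logical solutions -/

/-- The number for which a symbol stands, when `v d` has been chosen in the `∀`-cluster `d`. -/
def Sym.val (v : ℕ → ℕ) : Sym → ℕ
  | .const a => a
  | .copy d => v d

theorem Cho.Means.map_eq {Φ : Position} {v : ℕ → ℕ}
    (hv : ∀ d a, ⟨.environment, Cluster.move ⟨.chall, d⟩ a⟩ ∈ Φ → v d = a) {k : ClusterKind}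
    {x : Cho Sym k} {y : Cho ℕ k} (h : x.Means Φ y) : x.map (Sym.val v) = y := by
  have key : ∀ {s : Sym} {a : ℕ}, s.Means Φ a → s.val v = a := by
    rintro _ a (rfl | ⟨d, rfl, hd⟩)
    exacts [rfl, hv d a hd]
  cases k
  exacts [h, h, key h, key h]

/-- In a legal run, the machine that follows a strategy ends up in a position that is described by an
assignment at which it may stop. -/
theorem Strategy.exists_agrees {F : Finset Cluster} {G : Asg Sym → Prop} (S : Strategy F G) {K : ℕ}
    (hK : S.Bound K) {e : ℕ → List Move} (h : ((S.machine K).run e).Legal) :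
    ∃ (q : Asg Sym) (v : ℕ → ℕ), G q ∧ Agrees F ((S.machine K).run e) (q.map (Sym.val v)) := by
  classical
  have hleg : ∀ t, LegalPos (S.conf K e t).position := (HPM.legal_run_iff _ e).1 h
  obtain ⟨q, hq, ⟨t₀, hk⟩, hno⟩ := S.exists_final hleg hK
  let v : ℕ → ℕ := fun d =>
    if h : ∃ a t, ⟨.environment, Cluster.move ⟨.chall, d⟩ a⟩ ∈ (S.conf K e t).position then h.choose
    else 0
  have hv : ∀ t d a, ⟨.environment, Cluster.move ⟨.chall, d⟩ a⟩ ∈ (S.conf K e t).position →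
      v d = a := by
    intro t d a ha
    have hex : ∃ a t, ⟨.environment, Cluster.move ⟨.chall, d⟩ a⟩ ∈ (S.conf K e t).position :=
      ⟨a, t, ha⟩
    obtain ⟨s, hs⟩ := hex.choose_spec
    rw [show v d = hex.choose from dif_pos hex]
    exact (hleg (max s t)).unique (S.mem_mono (le_max_left s t) hs)
      (S.mem_mono (le_max_right s t) ha)
  refine ⟨q, v, hq, fun c hc x => ?_⟩
  rw [HPM.has_run_iff]
  constructor
  · intro hx
    obtain ⟨z, hz, rfl⟩ := Option.map_eq_some_iff.1 hx
    obtain ⟨y, hy, hzy⟩ := (hk t₀ le_rfl).made c z hz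
    rw [hzy.map_eq (hv t₀)]
    exact ⟨t₀, _, hy⟩
  · rintro ⟨t, p, hx⟩
    have hn : q c ≠ none := fun hn => hno c hc hn t p x hx
    obtain ⟨z, hz⟩ := Option.ne_none_iff_exists'.1 hn
    obtain ⟨y, hy, hzy⟩ := (hk (max t₀ t) (le_max_left _ _)).made c z hz
    obtain rfl : y = x := Cho.num_injective
      ((hleg (max t₀ t)).unique hy (S.mem_mono (le_max_right t₀ t) hx))
    exact Option.map_eq_some_iff.2 ⟨z, hz, hzy.map_eq (hv _)⟩

/-- The machine that follows a winning strategy of the symbolic game is a logical solution: in a legal run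
it ends up in a true position, and a first illegal move is never its own. -/
theorem Winnable.valid {E : Cirquent 0} (h : Winnable E) : Valid E := by
  obtain ⟨S⟩ := (h E.clusters).exists_strategy
  obtain ⟨K, hK⟩ := S.exists_bound
  refine ⟨S.machine K, fun I e => ?_⟩
  by_cases hleg : ((S.machine K).run e).Legal
  · obtain ⟨q, v, hq, hag⟩ := S.exists_agrees hK hleg
    refine .inl ⟨hleg, (wonLegal_iff_ev hleg hag).2 ?_⟩
    have := (ev_map (ι := Sym.const) (κ := id) (J := I) (Sym.val v) E (fun _ _ => rfl)
      Fin.elim0).2 (hq _)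
    rwa [show Sym.val v ∘ Fin.elim0 = Fin.elim0 from funext fun i => i.elim0] at this
  · obtain ⟨t, h1, h2⟩ := HPM.exists_first_illegal hleg
    exact .inr (HPM.firstIllegalBy_of_legal_own (S.phaseInv_step hK h1 (S.inv_branch hK e t h1)).1 h2)

end CL17

theorem theorem7p1 (E : CL17.Cirquent 0) : CL17.Valid E ↔ CL17.Provable E :=
  ⟨CL17.Valid.provable, fun h => h.winnable.valid⟩
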